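/- Let $(\mathcal C,\otimes,\mathbf 1,\Psi)$ be a braided monoidal category in which idempotents split, and let $H=(H,\mathrm m,\eta,\Delta,\varepsilon,S)$ be a Hopf algebra in $\mathcal C$ with invertible antipode $S$. **Notation.** An $H$-Hopf bimodule $X=(X,\mu_r,\mu_l,\nu_r,\nu_l)$ is an $H$-bimodule and $H$-bicomodule whose coactions are bimodule morphisms (regular actions on $H$, diagonal actions on tensor products). Morphisms are the bimodule–bicomodule morphisms; the category is ${}^H_H\mathcal C^H_H$. Let ${}_X\mathrm i:{}_HX\to X$, ${}_X\mathrm p:X\to{}_HX$ be a chosen splitting of the idempotent ${}_X\Pi=\mu_l\circ(S\otimes\mathrm{id})\circ\nu_l$, so that ${}_X\mathrm i\circ{}_X\mathrm p={}_X\Pi$ and ${}_X\mathrm p\circ{}_X\mathrm i=\mathrm{id}$; ${}_HX$ carries the right action ${}_X\mathrm p\circ\mu_r\circ({}_X\mathrm i\otimes\mathrm{id})$ and the right coaction $({}_X\mathrm p\otimes\mathrm{id})\circ\nu_r\circ{}_X\mathrm i$. The category ${}^H_H\mathcal C^H_H$ is braided monoidal with $N\otimes_HM=N\otimes{}_HM$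 (left action and coaction induced by $N$, right ones diagonal), on morphisms $f\otimes_H g=f\otimes({}_{M'}\mathrm p\circ g\circ{}_M\mathrm i)$ for $f:N\to N'$, $g:M\to M'$, unit object $H$ (regular actions and coactions), the canonical associativity and unit isomorphisms $$(N\otimes_HM)\otimes_HP\to N\otimes_H(M\otimes_HP):\ \mathrm{id}_N\otimes\big({}_{M\otimes_HP}\mathrm p\circ({}_M\mathrm i\otimes\mathrm{id})\big),$$ $$H\otimes_HM\to M:\ \mu_l^M\circ(\mathrm{id}\otimes{}_M\mathrm i),\qquad N\otimes_HH\to N:\ \mathrm{id}_N\otimes(\varepsilon\circ{}_H\mathrm i),$$ and braiding $$(\mu_l^Y\otimes{}_X\mathrm p\circ\mu_r^X)\circ(\mathrm{id}_H\otimes\Psi_{X,Y}\otimes\mathrm{id}_H)\circ(\nu_l^X\otimes\nu_r^Y\circ{}_Y\mathrm i):X\otimes_HY\to Y\otimes_HX .$$ The canonical morphism to the tensor product over $H$ and the canonical morphism from the cotensor product over $H$ (both realized on $N\otimes{}_HM$) are $$\lambda_{N,M}=(\mu_r^N\otimes\mathrm{id})\circ\big(\mathrm{id}_N\otimes(\mathrm{id}_H\otimes{}_M\mathrm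 p)\circ\nu_l^M\big):N\otimes M\to N\otimes_HM,$$ $$\rho_{N,M}=\big(\mathrm{id}_N\otimes\mu_l^M\circ(\mathrm{id}_H\otimes{}_M\mathrm i)\big)\circ(\nu_r^N\otimes\mathrm{id}):N\otimes_HM\to N\otimes M.$$ Put $M_X=\mu_l\circ(\mathrm{id}_H\otimes\mu_r)$ and $N_X=(\mathrm{id}_H\otimes\nu_r)\circ\nu_l$; the relative antipode is $S_{X/H}=M_X\circ(S\otimes\mathrm{id}_X\otimes S)\circ N_X$. A bialgebra projection on $H$ is a bialgebra $B$ in $\mathcal C$ with bialgebra morphisms $H\xrightarrow{\underline\eta}B\xrightarrow{\underline\varepsilon}H$ such that $\underline\varepsilon\circ\underline\eta=\mathrm{id}_H$; its morphisms are the bialgebra morphisms $f$ with $f\circ\underline\eta=\underline\eta$ and $\underline\varepsilon\circ f=\underline\varepsilon$. These form the category $H\text{-Bialg-}\mathcal C$. Let $\text{Bialg-}{}^H_H\mathcal C^H_H$ be the category of bialgebras in the braided monoidal category ${}^H_H\mathcal C^H_H$. **Theorem.** 1. There are functors $F:H\text{-Bialg-}\mathcal C\to\text{Bialg-}{}^H_H\mathcal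 C^H_H$ and $G:\text{Bialg-}{}^H_H\mathcal C^H_H\to H\text{-Bialg-}\mathcal C$ with $GF=\mathrm{id}$ and $FG=\mathrm{id}$. Both leave the underlying object in $\mathcal C$ and the underlying morphisms in $\mathcal C$ unchanged, and are given on objects as follows. * $F(H,B,\underline\eta,\underline\varepsilon)=(\underline B,\underline{\mathrm m},\underline\eta,\underline\Delta,\underline\varepsilon)$, where $\underline B$ is $B$ with the Hopf bimodule structure $\mu_l=\mathrm m_B\circ(\underline\eta\otimes\mathrm{id})$, $\mu_r=\mathrm m_B\circ(\mathrm{id}\otimes\underline\eta)$, $\nu_l=(\underline\varepsilon\otimes\mathrm{id})\circ\Delta_B$, $\nu_r=(\mathrm{id}\otimes\underline\varepsilon)\circ\Delta_B$, and $\underline{\mathrm m}=\mathrm m_B\circ(\mathrm{id}_B\otimes{}_{\underline B}\mathrm i)$, $\underline\Delta=(\mathrm{id}_B\otimes{}_{\underline B}\mathrm p)\circ\Delta_B$. * $G(\underline B,\underline{\mathrm m},\underline\eta,\underline\Delta,\underline\varepsilon)$ is the bialgebra $B$ with $\mathrm m_B=\underline{\mathrm m}\circ\lambda_{B,B}$,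 $\eta_B=\underline\eta\circ\eta_H$, $\Delta_B=\rho_{B,B}\circ\underline\Delta$, $\varepsilon_B=\varepsilon_H\circ\underline\varepsilon$, with projection morphisms $(\underline\eta,\underline\varepsilon)$. 2. If $(H,B,\underline\eta,\underline\varepsilon)$ is a bialgebra projection and $S_B$ is an antipode of $B$, then $\underline S_B=M_B\circ(\mathrm{id}_H\otimes S_B\otimes\mathrm{id}_H)\circ N_B$ is an antipode of $\underline B$ in ${}^H_H\mathcal C^H_H$. 3. If $\underline B$ is a bialgebra in ${}^H_H\mathcal C^H_H$ with antipode $\underline S_B$, then $\underline S_B\circ S_{B/H}=S_{B/H}\circ\underline S_B$, and this morphism is an antipode of the corresponding bialgebra $B$ in $\mathcal C$. -/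

import Mathlib

open CategoryTheory MonoidalCategory MonObj ComonObj

universe v u

/-- A splitting of an endomorphism `e`: when `e` is idempotent, `e` factors as the projection `proj`
followed by the inclusion `incl`, and `incl` followed by `proj` is the identity. -/
structure IdemSplitting {C : Type u} [Category.{v} C] {X : C} (e : X ⟶ X) where
  obj : C
  incl : obj ⟶ X
  proj : X ⟶ obj
  incl_proj : e ≫ e = e → incl ≫ proj = 𝟙 obj
  proj_incl : e ≫ e = e → proj ≫ incl = e

theorem IdemSplitting.nonempty {C : Type u} [Category.{v} C] [IsIdempotentComplete C] {X : C}
    (e : X ⟶ X) : Nonempty (IdemSplitting e) := by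
  by_cases h : e ≫ e = e
  · obtain ⟨Y, i, p, h1, h2⟩ := IsIdempotentComplete.idempotents_split X e h
    exact ⟨⟨Y, i, p, fun _ => h1, fun _ => h2⟩⟩
  · exact ⟨⟨X, 𝟙 X, 𝟙 X, fun h' => absurd h' h, fun h' => absurd h' h⟩⟩

/-- An object with a left and a right action and a left and a right coaction of `H`
(no axioms yet). -/
@[ext]
structure HopfBimodData {C : Type u} [Category.{v} C] [MonoidalCategory C] (H : C) where
  X : C
  actL : H ⊗ X ⟶ X
  actR : X ⊗ H ⟶ X
  coactL : X ⟶ H ⊗ X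
  coactR : X ⟶ X ⊗ H

namespace HopfBimodData

section Basic

variable {C : Type u} [Category.{v} C] [MonoidalCategory C] {H : C}

/-- `f` is a morphism of Hopf bimodules: it commutes with both actions and both coactions. -/
structure IsHom (M N : HopfBimodData H) (f : M.X ⟶ N.X) : Prop where
  actL : M.actL ≫ f = H ◁ f ≫ N.actL
  actR : M.actR ≫ f = f ▷ H ≫ N.actR
  coactL : M.coactL ≫ H ◁ f = f ≫ N.coactL
  coactR : M.coactR ≫ f ▷ H = f ≫ N.coactR

theorem IsHom.id (M : HopfBimodData H) : IsHom M M (𝟙 M.X) := by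
  constructor <;> simp

theorem IsHom.comp {M N K : HopfBimodData H} {f : M.X ⟶ N.X} {g : N.X ⟶ K.X} (hf : IsHom M N f)
    (hg : IsHom N K g) : IsHom M K (f ≫ g) := by
  constructor
  · rw [reassoc_of% hf.actL, hg.actL]; simp
  · rw [reassoc_of% hf.actR, hg.actR]; simp
  · rw [whiskerLeft_comp, reassoc_of% hf.coactL, hg.coactL]; simp
  · rw [comp_whiskerRight, reassoc_of% hf.coactR, hg.coactR]; simp

/-- Both actions at once. -/
def biact (M : HopfBimodData H) : H ⊗ (M.X ⊗ H) ⟶ M.X :=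
  H ◁ M.actR ≫ M.actL

/-- Both coactions at once. -/
def bicoact (M : HopfBimodData H) : M.X ⟶ H ⊗ (M.X ⊗ H) :=
  M.coactL ≫ H ◁ M.coactR

variable [BraidedCategory C]

/-- The axioms of a Hopf bimodule: an `H`-bimodule and an `H`-bicomodule whose two coactions are
morphisms of bimodules, `H` carrying the regular and tensor products the diagonal actions. -/
structure IsHopfBimod [BimonObj H] (M : HopfBimodData H) : Prop where
  one_actL : η[H] ▷ M.X ≫ M.actL = (λ_ M.X).hom
  mul_actL : μ[H] ▷ M.X ≫ M.actL = (α_ H H M.X).hom ≫ H ◁ M.actL ≫ M.actL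
  actR_one : M.X ◁ η[H] ≫ M.actR = (ρ_ M.X).hom
  actR_mul : M.X ◁ μ[H] ≫ M.actR = (α_ M.X H H).inv ≫ M.actR ▷ H ≫ M.actR
  act_assoc : M.actL ▷ H ≫ M.actR = (α_ H M.X H).hom ≫ H ◁ M.actR ≫ M.actL
  coactL_counit : M.coactL ≫ ε[H] ▷ M.X = (λ_ M.X).inv
  coactL_comul : M.coactL ≫ Δ[H] ▷ M.X = M.coactL ≫ H ◁ M.coactL ≫ (α_ H H M.X).inv
  coactR_counit : M.coactR ≫ M.X ◁ ε[H] = (ρ_ M.X).inv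
  coactR_comul : M.coactR ≫ M.X ◁ Δ[H] = M.coactR ≫ M.coactR ▷ H ≫ (α_ M.X H H).hom
  coact_assoc : M.coactR ≫ M.coactL ▷ H = M.coactL ≫ H ◁ M.coactR ≫ (α_ H M.X H).inv
  actL_coactL : M.actL ≫ M.coactL =
    (Δ[H] ⊗ₘ M.coactL) ≫ tensorμ H H H M.X ≫ (μ[H] ⊗ₘ M.actL)
  actR_coactL : M.actR ≫ M.coactL =
    (M.coactL ⊗ₘ Δ[H]) ≫ tensorμ H M.X H H ≫ (μ[H] ⊗ₘ M.actR)
  actL_coactR : M.actL ≫ M.coactR =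
    (Δ[H] ⊗ₘ M.coactR) ≫ tensorμ H H M.X H ≫ (M.actL ⊗ₘ μ[H])
  actR_coactR : M.actR ≫ M.coactR =
    (M.coactR ⊗ₘ Δ[H]) ≫ tensorμ M.X H H H ≫ (M.actR ⊗ₘ μ[H])

/-- `H` with its regular actions and coactions. -/
def regular (H : C) [BimonObj H] : HopfBimodData H where
  X := H
  actL := μ[H]
  actR := μ[H]
  coactL := Δ[H]
  coactR := Δ[H]

end Basic

section Hopf

variable {C : Type u} [Category.{v} C] [MonoidalCategory C] [BraidedCategory C]
  {H : C} [HopfObj H]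

/-- The relative antipode, `x ↦ S(x₋₁) x₀ S(x₁)`. -/
def relAntipode (M : HopfBimodData H) : M.X ⟶ M.X :=
  M.bicoact ≫ (HopfObj.antipode (X := H) ⊗ₘ (M.X ◁ HopfObj.antipode (X := H))) ≫ M.biact

/-- The endomorphism `x ↦ S(x₋₁) x₀`, idempotent for every Hopf bimodule. -/
def idem (M : HopfBimodData H) : M.X ⟶ M.X :=
  M.coactL ≫ HopfObj.antipode (X := H) ▷ M.X ≫ M.actL

theorem IsHom.idem {M N : HopfBimodData H} {f : M.X ⟶ N.X} (h : IsHom M N f) :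
    M.idem ≫ f = f ≫ N.idem := by
  simp only [HopfBimodData.idem, Category.assoc, h.actL, ← reassoc_of% h.coactL]
  rw [whisker_exchange_assoc]

theorem tensorμ_braiding (A B X : C) : tensorμ A A B X ≫ (β_ A B).hom ▷ (A ⊗ X) ≫ (α_ B A (A ⊗ X)).hom
    ≫ B ◁ (α_ A A X).inv
   = (α_ (A ⊗ A) B X).inv ≫ (β_ (A ⊗ A) B).hom ▷ X ≫ (α_ B (A ⊗ A) X).hom := by
  simp only [tensorμ, BraidedCategory.braiding_tensor_left_hom, comp_whiskerRight, Category.assoc]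
  monoidal

open HopfObj in
theorem IsHopfBimod.actL_idem {M : HopfBimodData H} (h : M.IsHopfBimod) :
    M.actL ≫ M.idem = ε[H] ▷ M.X ≫ (λ_ M.X).hom ≫ M.idem := by
  have h1 : (μ[H] ⊗ₘ M.actL) ≫ antipode (X := H) ▷ M.X ≫ M.actL
      = (β_ H H).hom ▷ (H ⊗ M.X) ≫ ((antipode (X := H) ⊗ₘ antipode (X := H)) ▷ (H ⊗ M.X)) ≫
        (α_ H H (H ⊗ M.X)).hom ≫ H ◁ (α_ H H M.X).inv ≫ H ◁ (μ[H] ▷ M.X ≫ M.actL) ≫ M.actL := by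
    have e1 : (μ[H] ⊗ₘ M.actL) ≫ antipode (X := H) ▷ M.X
      = (μ[H] ≫ antipode (X := H)) ▷ (H ⊗ M.X) ≫ H ◁ M.actL := by
      rw [MonoidalCategory.tensorHom_def, Category.assoc, whisker_exchange, comp_whiskerRight, Category.assoc]
    have e2 : μ[H] ≫ antipode (X := H) =
        (β_ H H).hom ≫ (antipode (X := H) ⊗ₘ antipode (X := H)) ≫ μ[H] := by
      rw [mul_antipode, BraidedCategory.braiding_naturality_assoc]
    rw [← Category.assoc, e1, e2]
    simp only [comp_whiskerRight, Category.assoc]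
    rw [← whisker_exchange_assoc, h.mul_actL]
    simp
  have h2 : (antipode (X := H) ⊗ₘ antipode (X := H)) ▷ (H ⊗ M.X) ≫
        (α_ H H (H ⊗ M.X)).hom ≫ H ◁ (α_ H H M.X).inv ≫ H ◁ (μ[H] ▷ M.X ≫ M.actL)
      = (α_ H H (H ⊗ M.X)).hom ≫ H ◁ (α_ H H M.X).inv ≫ (α_ H (H ⊗ H) M.X).inv ≫
        (H ◁ (antipode (X := H) ▷ H ≫ μ[H])) ▷ M.X ≫ (α_ H H M.X).hom ≫
        H ◁ M.actL ≫ antipode (X := H) ▷ M.X := by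
    rw [MonoidalCategory.tensorHom_def', comp_whiskerRight, Category.assoc,
      whiskerRight_tensor]
    simp only [Category.assoc, Iso.inv_hom_id_assoc, associator_naturality_left_assoc,
      ← whisker_exchange, ← whisker_exchange_assoc]
    monoidal
  have h3 := congrArg (· ≫ (α_ H (H ⊗ H) M.X).inv ≫
        (H ◁ (antipode (X := H) ▷ H ≫ μ[H])) ▷ M.X ≫ (α_ H H M.X).hom ≫
        H ◁ M.actL ≫ antipode (X := H) ▷ M.X ≫ M.actL) (tensorμ_braiding H H M.X)
  simp only [Category.assoc, Iso.hom_inv_id_assoc] at h3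
  have h4 := congrArg (· ≫ M.actL) h2
  simp only [Category.assoc] at h4
  unfold idem
  rw [reassoc_of% h.actL_coactL, h1]
  simp only [whiskerLeft_comp, Category.assoc] at h4 h3 ⊢
  rw [h4, h3]
  have h5 : (Δ[H] ⊗ₘ M.coactL) ≫ (α_ (H ⊗ H) H M.X).inv ≫ (β_ (H ⊗ H) H).hom ▷ M.X
      = H ◁ M.coactL ≫ (α_ H H M.X).inv ≫ (β_ H H).hom ▷ M.X ≫ (H ◁ Δ[H]) ▷ M.X := by
    rw [← comp_whiskerRight, ← BraidedCategory.braiding_naturality_left, MonoidalCategory.tensorHom_def']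
    simp
  rw [reassoc_of% h5]
  have h6 : (H ◁ Δ[H]) ▷ M.X ≫ (H ◁ antipode (X := H) ▷ H ≫ H ◁ μ[H]) ▷ M.X =
     (H ◁ ε[H] ≫ H ◁ η[H]) ▷ M.X := by
    simp only [← comp_whiskerRight, ← whiskerLeft_comp, antipode_left]
  rw [reassoc_of% h6]
  have h7 : (β_ H H).hom ▷ M.X ≫ (H ◁ ε[H] ≫ H ◁ η[H]) ▷ M.X =
      (ε[H] ▷ H ≫ (λ_ H).hom ≫ (ρ_ H).inv) ▷ M.X ≫ (H ◁ η[H]) ▷ M.X := by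
    simp only [← comp_whiskerRight, Category.assoc]
    rw [← BraidedCategory.braiding_naturality_left_assoc, braiding_tensorUnit_left]
    simp
  have h8 : (H ◁ η[H]) ▷ M.X ≫ (α_ H H M.X).hom ≫ H ◁ M.actL =
      (α_ H (𝟙_ C) M.X).hom ≫ H ◁ (λ_ M.X).hom := by
    rw [← h.one_actL]
    simp
  rw [reassoc_of% h7, reassoc_of% h8]
  simp only [comp_whiskerRight, Category.assoc, triangle_assoc,
    inv_hom_whiskerRight_assoc]
  rw [← associator_inv_naturality_left_assoc, whisker_exchange_assoc,
    ← leftUnitor_tensor_hom_assoc, leftUnitor_naturality_assoc]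

open HopfObj in
theorem IsHopfBimod.idem_idem {M : HopfBimodData H} (h : M.IsHopfBimod) :
    M.idem ≫ M.idem = M.idem := by
  conv_lhs =>
    lhs
    unfold idem
  simp only [Category.assoc, h.actL_idem]
  rw [← comp_whiskerRight_assoc, antipode_counit, reassoc_of% h.coactL_counit]
  simp

variable [IsIdempotentComplete C]

/-- A chosen splitting of the idempotent `x ↦ S(x₋₁) x₀`. -/
noncomputable def splitting (M : HopfBimodData H) : IdemSplitting M.idem :=
  Classical.choice (IdemSplitting.nonempty M.idem)

/-- The object `_H M` of (left) invariants of a Hopf bimodule. -/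
noncomputable def invObj (M : HopfBimodData H) : C := M.splitting.obj

/-- The inclusion of the invariants. -/
noncomputable def inj (M : HopfBimodData H) : M.invObj ⟶ M.X := M.splitting.incl

/-- The projection to the invariants. -/
noncomputable def pr (M : HopfBimodData H) : M.X ⟶ M.invObj := M.splitting.proj

theorem IsHopfBimod.inj_pr {M : HopfBimodData H} (h : M.IsHopfBimod) :
    M.inj ≫ M.pr = 𝟙 M.invObj :=
  M.splitting.incl_proj h.idem_idem

theorem IsHopfBimod.pr_inj {M : HopfBimodData H} (h : M.IsHopfBimod) : M.pr ≫ M.inj = M.idem :=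
  M.splitting.proj_incl h.idem_idem

/-- The right action of the crossed module `_H M`. -/
noncomputable def invAct (M : HopfBimodData H) : M.invObj ⊗ H ⟶ M.invObj :=
  M.inj ▷ H ≫ M.actR ≫ M.pr

/-- The right coaction of the crossed module `_H M`. -/
noncomputable def invCoact (M : HopfBimodData H) : M.invObj ⟶ M.invObj ⊗ H :=
  M.inj ≫ M.coactR ≫ M.pr ▷ H

/-- The tensor product `N ⊗_H M := N ⊗ (_H M)` of Hopf bimodules: the left action and coaction are
induced by those of `N`, the right action and coaction are diagonal. -/
noncomputable def tensor (N M : HopfBimodData H) : HopfBimodData H where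
  X := N.X ⊗ M.invObj
  actL := (α_ H N.X M.invObj).inv ≫ N.actL ▷ M.invObj
  actR := (N.X ⊗ M.invObj) ◁ Δ[H] ≫ tensorμ N.X M.invObj H H ≫ (N.actR ⊗ₘ M.invAct)
  coactL := N.coactL ▷ M.invObj ≫ (α_ H N.X M.invObj).hom
  coactR := (N.coactR ⊗ₘ M.invCoact) ≫ tensorμ N.X H M.invObj H ≫ (N.X ⊗ M.invObj) ◁ μ[H]

/-- The tensor product over `H` of two morphisms of Hopf bimodules. -/
noncomputable def tensorMap (N N' M M' : HopfBimodData H) (f : N.X ⟶ N'.X) (g : M.X ⟶ M'.X) :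
    (N.tensor M).X ⟶ (N'.tensor M').X :=
  f ⊗ₘ (M.inj ≫ g ≫ M'.pr)

theorem IsHopfBimod.tensorMap_id {M : HopfBimodData H} (h : M.IsHopfBimod) (N : HopfBimodData H) :
    tensorMap N N M M (𝟙 N.X) (𝟙 M.X) = 𝟙 (N.tensor M).X := by
  simp [tensorMap, h.inj_pr, tensor]

theorem IsHom.tensorMap_comp {M M' M'' : HopfBimodData H} {g : M.X ⟶ M'.X} (hg : IsHom M M' g)
    (h : M.IsHopfBimod) (g' : M'.X ⟶ M''.X) (h' : M'.IsHopfBimod)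
    {N N' N'' : HopfBimodData H} (f : N.X ⟶ N'.X) (f' : N'.X ⟶ N''.X)  :
    tensorMap N N' M M' f g ≫ tensorMap N' N'' M' M'' f' g' =
      tensorMap N N'' M M'' (f ≫ f') (g ≫ g') := by
  have e : M.inj ≫ M.idem = M.inj := by
    rw [← h.pr_inj, ← Category.assoc, h.inj_pr, Category.id_comp]
  refine (tensorHom_comp_tensorHom _ _ _ _).trans ?_
  simp only [tensorMap, Category.assoc]
  rw [reassoc_of% h'.pr_inj, ← reassoc_of% hg.idem, reassoc_of% e]

/-- The associativity isomorphism `(N ⊗_H M) ⊗_H P ⟶ N ⊗_H (M ⊗_H P)`. -/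
noncomputable def assocHom (N M P : HopfBimodData H) :
    ((N.tensor M).tensor P).X ⟶ (N.tensor (M.tensor P)).X :=
  (α_ N.X M.invObj P.invObj).hom ≫ N.X ◁ (M.inj ▷ P.invObj ≫ (M.tensor P).pr)

/-- The inverse of the associativity isomorphism. -/
noncomputable def assocInv (N M P : HopfBimodData H) :
    (N.tensor (M.tensor P)).X ⟶ ((N.tensor M).tensor P).X :=
  N.X ◁ ((M.tensor P).inj ≫ M.pr ▷ P.invObj) ≫ (α_ N.X M.invObj P.invObj).inv

/-- The left unit isomorphism `H ⊗_H M ⟶ M`. -/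
noncomputable def leftUnitHom (M : HopfBimodData H) : ((regular H).tensor M).X ⟶ M.X :=
  H ◁ M.inj ≫ M.actL

/-- The inverse of the left unit isomorphism. -/
noncomputable def leftUnitInv (M : HopfBimodData H) : M.X ⟶ ((regular H).tensor M).X :=
  M.coactL ≫ H ◁ M.pr

/-- The right unit isomorphism `N ⊗_H H ⟶ N`. -/
noncomputable def rightUnitHom (N : HopfBimodData H) : (N.tensor (regular H)).X ⟶ N.X :=
  N.X ◁ ((regular H).inj ≫ ε[H]) ≫ (ρ_ N.X).hom

/-- The braiding `N ⊗_H M ⟶ M ⊗_H N` of Hopf bimodules. -/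
noncomputable def braid (N M : HopfBimodData H) : (N.tensor M).X ⟶ (M.tensor N).X :=
  (N.coactL ⊗ₘ (M.inj ≫ M.coactR)) ≫ tensorμ H N.X M.X H ≫ (M.actL ⊗ₘ (N.actR ≫ N.pr))

/-- The exchange `(K ⊗_H L) ⊗_H (M ⊗_H N) ⟶ (K ⊗_H M) ⊗_H (L ⊗_H N)` of the two middle factors. -/
noncomputable def exchange (K L M N : HopfBimodData H) :
    ((K.tensor L).tensor (M.tensor N)).X ⟶ ((K.tensor M).tensor (L.tensor N)).X :=
  assocHom K L (M.tensor N) ≫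
    tensorMap K K (L.tensor (M.tensor N)) (M.tensor (L.tensor N)) (𝟙 K.X)
      (assocInv L M N ≫
        tensorMap (L.tensor M) (M.tensor L) N N (braid L M) (𝟙 N.X) ≫
        assocHom M L N) ≫
    assocInv K M (L.tensor N)

/-- The canonical morphism `N ⊗ M ⟶ N ⊗_H M` (the coequalizer of the inner actions). -/
noncomputable def toTensor (N M : HopfBimodData H) : N.X ⊗ M.X ⟶ (N.tensor M).X :=
  N.X ◁ (M.coactL ≫ H ◁ M.pr) ≫ (α_ N.X H M.invObj).inv ≫ N.actR ▷ M.invObj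

/-- The canonical morphism `N □_H M ⟶ N ⊗ M` (the equalizer of the inner coactions), where the
cotensor product `N □_H M` is realized on the same object `N ⊗ (_H M)`. -/
noncomputable def ofCotensor (N M : HopfBimodData H) : (N.tensor M).X ⟶ N.X ⊗ M.X :=
  N.coactR ▷ M.invObj ≫ (α_ N.X H M.invObj).hom ≫ N.X ◁ (H ◁ M.inj ≫ M.actL)

end Hopf

end HopfBimodData

/-- The structure morphisms of a bialgebra in the category of `H`-Hopf bimodules
(no axioms yet). -/
structure HopfBimodBialgData {C : Type u} [Category.{v} C] [MonoidalCategory C]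
    [BraidedCategory C] [IsIdempotentComplete C] (H : C) [HopfObj H] where
  base : HopfBimodData H
  mul : (base.tensor base).X ⟶ base.X
  one : H ⟶ base.X
  comul : base.X ⟶ (base.tensor base).X
  counit : base.X ⟶ H

namespace HopfBimodBialgData

section

variable {C : Type u} [Category.{v} C] [MonoidalCategory C] [BraidedCategory C]
  [IsIdempotentComplete C] {H : C} [HopfObj H]

open HopfBimodData

/-- The axioms of a bialgebra in the braided monoidal category of `H`-Hopf bimodules. -/
structure IsBialg (B : HopfBimodBialgData H) : Prop where
  isHopfBimod : B.base.IsHopfBimod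
  mul_hom : IsHom (B.base.tensor B.base) B.base B.mul
  one_hom : IsHom (regular H) B.base B.one
  comul_hom : IsHom B.base (B.base.tensor B.base) B.comul
  counit_hom : IsHom B.base (regular H) B.counit
  one_mul : tensorMap (regular H) B.base B.base B.base
    B.one (𝟙 B.base.X) ≫ B.mul = leftUnitHom B.base
  mul_one : tensorMap B.base B.base (regular H) B.base
    (𝟙 B.base.X) B.one ≫ B.mul = rightUnitHom B.base
  mul_assoc : tensorMap (B.base.tensor B.base) B.base B.base B.base
      B.mul (𝟙 B.base.X) ≫ B.mul =
    assocHom B.base B.base B.base ≫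
      tensorMap B.base B.base (B.base.tensor B.base) B.base
        (𝟙 B.base.X) B.mul ≫ B.mul
  counit_comul : B.comul ≫ tensorMap B.base (regular H) B.base B.base
    B.counit (𝟙 B.base.X) ≫ leftUnitHom B.base = 𝟙 B.base.X
  comul_counit : B.comul ≫ tensorMap B.base B.base B.base (regular H)
    (𝟙 B.base.X) B.counit ≫ rightUnitHom B.base = 𝟙 B.base.X
  comul_assoc : B.comul ≫
      tensorMap B.base (B.base.tensor B.base) B.base B.base
        B.comul (𝟙 B.base.X) ≫ assocHom B.base B.base B.base =
    B.comul ≫ tensorMap B.base B.base B.base (B.base.tensor B.base)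
      (𝟙 B.base.X) B.comul
  mul_comul : B.mul ≫ B.comul =
    tensorMap B.base (B.base.tensor B.base) B.base
        (B.base.tensor B.base) B.comul B.comul ≫
      exchange B.base B.base B.base B.base ≫
      tensorMap (B.base.tensor B.base) B.base (B.base.tensor B.base)
        B.base B.mul B.mul
  one_comul : B.one ≫ B.comul =
    leftUnitInv (regular H) ≫
      tensorMap (regular H) B.base (regular H) B.base B.one B.one
  mul_counit : B.mul ≫ B.counit =
    tensorMap B.base (regular H) B.base (regular H)
      B.counit B.counit ≫ leftUnitHom (regular H)
  one_counit : B.one ≫ B.counit = 𝟙 H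

/-- `s` is an antipode of the bialgebra `B` in the category of Hopf bimodules. -/
structure IsAntipode (B : HopfBimodBialgData H) (s : B.base.X ⟶ B.base.X) : Prop where
  hom : IsHom B.base B.base s
  left : B.comul ≫ tensorMap B.base B.base B.base B.base
    s (𝟙 B.base.X) ≫ B.mul = B.counit ≫ B.one
  right : B.comul ≫ tensorMap B.base B.base B.base B.base
    (𝟙 B.base.X) s ≫ B.mul = B.counit ≫ B.one

end

end HopfBimodBialgData

/-- Bialgebras in the category of `H`-Hopf bimodules. -/
structure HopfBimodBialg {C : Type u} [Category.{v} C] [MonoidalCategory C]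
    [BraidedCategory C] [IsIdempotentComplete C] (H : C) [HopfObj H]
    extends HopfBimodBialgData H where
  isBialg : toHopfBimodBialgData.IsBialg

namespace HopfBimodBialg

section

variable {C : Type u} [Category.{v} C] [MonoidalCategory C] [BraidedCategory C]
  [IsIdempotentComplete C] {H : C} [HopfObj H]

open HopfBimodData

/-- Morphisms of bialgebras in the category of `H`-Hopf bimodules. -/
@[ext]
structure Hom (A B : HopfBimodBialg H) where
  hom : A.base.X ⟶ B.base.X
  isHom : IsHom A.base B.base hom
  mul_hom : A.mul ≫ hom = tensorMap A.base B.base A.base B.base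
    hom hom ≫ B.mul
  one_hom : A.one ≫ hom = B.one
  hom_comul : hom ≫ B.comul =
    A.comul ≫ tensorMap A.base B.base A.base B.base hom hom
  hom_counit : hom ≫ B.counit = A.counit

instance : Category (HopfBimodBialg H) where
  Hom := Hom
  id A :=
    { hom := 𝟙 A.base.X
      isHom := .id A.base
      mul_hom := by
        rw [A.isBialg.isHopfBimod.tensorMap_id, Category.comp_id]; exact (Category.id_comp _).symm
      one_hom := Category.comp_id _
      hom_comul := by
        rw [A.isBialg.isHopfBimod.tensorMap_id, Category.id_comp]; exact (Category.comp_id _).symm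
      hom_counit := Category.id_comp _ }
  comp {A B D} f g :=
    { hom := f.hom ≫ g.hom
      isHom := f.isHom.comp g.isHom
      mul_hom := by
        rw [← f.isHom.tensorMap_comp A.isBialg.isHopfBimod g.hom B.isBialg.isHopfBimod f.hom g.hom,
          ← Category.assoc, f.mul_hom, Category.assoc, Category.assoc, g.mul_hom]
      one_hom := by rw [← Category.assoc, f.one_hom, g.one_hom]
      hom_comul := by
        rw [← f.isHom.tensorMap_comp A.isBialg.isHopfBimod g.hom B.isBialg.isHopfBimod f.hom g.hom,
          Category.assoc, g.hom_comul, ← Category.assoc, f.hom_comul, Category.assoc]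
      hom_counit := by rw [Category.assoc, g.hom_counit, f.hom_counit] }
  id_comp f := Hom.ext (Category.id_comp f.hom)
  comp_id f := Hom.ext (Category.comp_id f.hom)
  assoc f g h := Hom.ext (Category.assoc f.hom g.hom h.hom)

end

end HopfBimodBialg

/-- The data of a bialgebra `X` with morphisms `H ⟶ X ⟶ H` (no axioms). -/
@[ext]
structure BialgProjData {C : Type u} [Category.{v} C] [MonoidalCategory C] (H : C) where
  X : C
  mul : X ⊗ X ⟶ X
  one : 𝟙_ C ⟶ X
  comul : X ⟶ X ⊗ X
  counit : X ⟶ 𝟙_ C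
  incl : H ⟶ X
  proj : X ⟶ H

/-- Bialgebra projections on `H`: a bialgebra `X` and bialgebra morphisms `incl : H ⟶ X` and
`proj : X ⟶ H` whose composite `H ⟶ X ⟶ H` is the identity. -/
structure BialgProj {C : Type u} [Category.{v} C] [MonoidalCategory C] [BraidedCategory C]
    (H : C) [BimonObj H] where
  X : C
  [bimon : BimonObj X]
  incl : H ⟶ X
  proj : X ⟶ H
  [incl_hom : IsBimonHom incl]
  [proj_hom : IsBimonHom proj]
  incl_proj : incl ≫ proj = 𝟙 H

namespace BialgProj

attribute [instance] bimon incl_hom proj_hom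

section

variable {C : Type u} [Category.{v} C] [MonoidalCategory C] [BraidedCategory C]
  {H : C} [BimonObj H]

/-- The underlying data of a bialgebra projection. -/
def toData (P : BialgProj H) : BialgProjData H where
  X := P.X
  mul := μ[P.X]
  one := η[P.X]
  comul := Δ[P.X]
  counit := ε[P.X]
  incl := P.incl
  proj := P.proj

/-- Morphisms of bialgebra projections on `H`. -/
@[ext]
structure Hom (P Q : BialgProj H) where
  hom : P.X ⟶ Q.X
  [isBimonHom : IsBimonHom hom]
  incl_hom : P.incl ≫ hom = Q.incl
  hom_proj : hom ≫ Q.proj = P.proj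

instance : Category (BialgProj H) where
  Hom := Hom
  id P :=
    { hom := 𝟙 P.X
      isBimonHom := { one_hom := by simp, mul_hom := by simp
                      hom_counit := by simp, hom_comul := by simp }
      incl_hom := by simp
      hom_proj := by simp }
  comp {P Q R} f g :=
    { hom := f.hom ≫ g.hom
      isBimonHom :=
        haveI := f.isBimonHom
        haveI := g.isBimonHom
        { one_hom := by simp, mul_hom := by simp
          hom_counit := by simp, hom_comul := by simp }
      incl_hom := by rw [← Category.assoc, f.incl_hom, g.incl_hom]
      hom_proj := by rw [Category.assoc, g.hom_proj, f.hom_proj] }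
  id_comp f := Hom.ext (Category.id_comp f.hom)
  comp_id f := Hom.ext (Category.comp_id f.hom)
  assoc f g h := Hom.ext (Category.assoc f.hom g.hom h.hom)

end

end BialgProj

namespace BialgProjData

section

variable {C : Type u} [Category.{v} C] [MonoidalCategory C] {H : C}

/-- `s` is an antipode for the underlying bialgebra of `P`. -/
structure IsAntipode (P : BialgProjData H) (s : P.X ⟶ P.X) : Prop where
  left : P.comul ≫ s ▷ P.X ≫ P.mul = P.counit ≫ P.one
  right : P.comul ≫ P.X ◁ s ≫ P.mul = P.counit ≫ P.one

/-- The actions of `H` on `X` by multiplication through `incl`, and the coactions by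
comultiplication followed by `proj`. -/
def toHopfBimodData (P : BialgProjData H) : HopfBimodData H where
  X := P.X
  actL := P.incl ▷ P.X ≫ P.mul
  actR := P.X ◁ P.incl ≫ P.mul
  coactL := P.comul ≫ P.proj ▷ P.X
  coactR := P.comul ≫ P.X ◁ P.proj

variable [BraidedCategory C]

/-- The endomorphism `x ↦ x₋₁ s(x₀) x₁`. -/
def bimodAntipode (P : BialgProjData H) (s : P.X ⟶ P.X) : P.X ⟶ P.X :=
  P.toHopfBimodData.bicoact ≫ H ◁ (s ▷ H) ≫ P.toHopfBimodData.biact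

/-- From a bialgebra projection to a bialgebra in the category of Hopf bimodules. -/
noncomputable def toHopfBimodBialgData [IsIdempotentComplete C] [HopfObj H]
    (P : BialgProjData H) : HopfBimodBialgData H where
  base := P.toHopfBimodData
  mul := P.X ◁ P.toHopfBimodData.inj ≫ P.mul
  one := P.incl
  comul := P.comul ≫ P.X ◁ P.toHopfBimodData.pr
  counit := P.proj

end

end BialgProjData

/-- From a bialgebra in the category of Hopf bimodules to a bialgebra projection. -/
noncomputable def HopfBimodBialgData.toBialgProjData {C : Type u} [Category.{v} C]
    [MonoidalCategory C] [BraidedCategory C] [IsIdempotentComplete C] {H : C} [HopfObj H]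
    (B : HopfBimodBialgData H) : BialgProjData H where
  X := B.base.X
  mul := B.base.toTensor B.base ≫ B.mul
  one := η[H] ≫ B.one
  comul := B.comul ≫ B.base.ofCotensor B.base
  counit := B.counit ≫ ε[H]
  incl := B.one
  proj := B.counit

/-!
A Hopf bimodule `M` is free over its invariants: `M ≅ H ⊗ _H M` by `h ⊗ x ↦ h x`, with inverse
`x ↦ x₋₁ ⊗ pr x₀` (`IsHopfBimod.coactL_idem_actL`, `IsHopfBimod.inj_actL_coactL_pr`).
Consequently the canonical morphism `λ = toTensor : N ⊗ M ⟶ N ⊗_H M` is a split epimorphism, with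
section `N ◁ inj`, and `ρ = ofCotensor : N ⊗_H M ⟶ N ⊗ M` is a split monomorphism, with retraction
`N ◁ pr` (`IsHopfBimod.inj_toTensor`, `IsHopfBimod.ofCotensor_pr`). Both are natural, and they turn
`-⊗_H-` into a lax and an oplax structure on the forgetful functor to `C`: `λ` is associative and
unital, `ρ` is coassociative and counital (`toTensor_assoc`, `ofCotensor_assoc` and the lemmas on
the unit constraints). The two structures are compatible with the braidings: sandwiching the
exchange of the middle factors over `H` between `λ` and `ρ` gives the exchange in `C` between `ρ`
and `λ` (`toTensor_exchange_ofCotensor`). This identity, which carries the first half of the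
theorem, is computed on invariants, where the braiding becomes `l ⊗ m ↦ m₀ ⊗ l m₁`
(`exchange_eq`, `toTensor_invBraid_ofCotensor`).

A forgetful functor with such a structure sends bialgebras to bialgebras: the multiplication
`λ ≫ m` and the comultiplication `Δ ≫ ρ` of a bialgebra over `H` satisfy the bialgebra axioms
in `C`. Conversely, the multiplication `m` and the comultiplication `Δ` over `H` attached to a
bialgebra projection `P` satisfy `λ ≫ m = μ[P]` and `Δ ≫ ρ = Δ[P]` (`toTensor_tensorMul`,
`tensorComul_ofCotensor`), so most of their axioms follow from those of `P` by cancelling the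
epimorphism `λ` and the monomorphism `ρ`. The same two equations show that the constructions are
inverse to each other, because the unit and counit axioms over `H` recover the two actions from
`λ ≫ m` and the two coactions from `Δ ≫ ρ`.

For antipodes, let `*` be the convolution of endomorphisms of `P`, let `π = proj ≫ incl` and
`ϖ = proj ≫ S ≫ incl`, which are convolution inverse to each other. The convolution over `H` of two
morphisms `f`, `g` of Hopf bimodules is `f * ϖ * g` (`of_tensorComul_tensorMap_tensorMul`), and its
unit is `π`. Hence `t` is an antipode over `H` exactly when it is a morphism of Hopf bimodules and
`t * ϖ * 𝟙 = π = 𝟙 * ϖ * t` (`isAntipode_iff`), that is, when `ϖ * t * ϖ` is a convolution inverse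
of the identity. The two antipodes in the theorem are `π * s * π` (`of_bimodAntipode`) and
`ϖ * t * ϖ` (`of_relAntipode_comp`), so each half is a computation in the convolution monoid; that
`π * s * π` is a morphism of Hopf bimodules holds because an antipode reverses products and
coproducts (`isHom_of_conv`). The relative antipode is natural for morphisms of Hopf bimodules
(`IsHom.relAntipode_comp`), hence commutes with `t`.
-/


/-! ### The invariants of a Hopf bimodule -/

namespace HopfBimodData
section

open HopfObj

variable {C : Type u} [Category.{v} C] [MonoidalCategory C] [BraidedCategory C]
  {H : C} [HopfObj H] {M : HopfBimodData H}

/-- The endomorphism `x ↦ S(x₋₁) x₀` takes values in the left coinvariants, because the antipode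
reverses coproducts. -/
theorem IsHopfBimod.idem_coactL (h : M.IsHopfBimod) :
    M.idem ≫ M.coactL = M.idem ≫ (λ_ M.X).inv ≫ η[H] ▷ M.X := by
  calc
    _ = M.coactL ≫ ((𝒮[H] ≫ Δ[H]) ▷ M.X ≫ (H ⊗ H) ◁ M.coactL) ⊗≫
          H ◁ (β_ H H).hom ▷ M.X ⊗≫ (μ[H] ▷ (H ⊗ M.X)) ⊗≫ H ◁ M.actL := by
      simp only [idem, Category.assoc, h.actL_coactL, MonoidalCategory.tensorHom_def, tensorμ]
      monoidal
    _ = M.coactL ≫ H ◁ M.coactL ⊗≫ Δ[H] ▷ H ▷ M.X ⊗≫ ((β_ H H).hom ▷ H ▷ M.X) ⊗≫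
          𝒮[H] ▷ H ▷ H ▷ M.X ⊗≫
          (H ◁ (𝒮[H] ▷ H ≫ (β_ H H).hom)) ▷ M.X ⊗≫
          (μ[H] ▷ (H ⊗ M.X)) ⊗≫ H ◁ M.actL := by
      rw [← whisker_exchange, antipode_comul, MonoidalCategory.tensorHom_def]
      monoidal
    _ = M.coactL ≫ H ◁ M.coactL ⊗≫ Δ[H] ▷ H ▷ M.X ⊗≫ ((β_ H H).hom ▷ H ▷ M.X) ⊗≫
          𝒮[H] ▷ H ▷ H ▷ M.X ⊗≫
          (H ◁ ((β_ H H).hom)) ▷ M.X ⊗≫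
          ((H ⊗ H) ◁ 𝒮[H] ≫ μ[H] ▷ H) ▷ M.X ⊗≫ H ◁ M.actL := by
      rw [BraidedCategory.braiding_naturality_left]
      monoidal
    _ = M.coactL ≫ H ◁ M.coactL ⊗≫ Δ[H] ▷ H ▷ M.X ⊗≫ ((β_ H H).hom ▷ H ▷ M.X) ⊗≫
          (𝒮[H] ▷ (H ⊗ H) ≫
          (H ◁ ((β_ H H).hom))) ▷ M.X ⊗≫
          μ[H] ▷ H ▷ M.X ⊗≫ H ◁ (𝒮[H] ▷ M.X ≫ M.actL) := by
      rw [whisker_exchange]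
      monoidal
    _ = M.coactL ≫ H ◁ M.coactL ⊗≫ Δ[H] ▷ H ▷ M.X ⊗≫ ((β_ H (H ⊗ H)).hom ≫
          (𝒮[H] ▷ H ≫ μ[H]) ▷ H) ▷ M.X ⊗≫ H ◁ (𝒮[H] ▷ M.X ≫ M.actL) := by
      rw [← whisker_exchange, BraidedCategory.braiding_tensor_right_hom]
      monoidal
    _ = (M.coactL ≫ H ◁ M.coactL ≫ (α_ H H M.X).inv) ⊗≫ Δ[H] ▷ H ▷ M.X ⊗≫ ((H ◁
          (𝒮[H] ▷ H ≫ μ[H])) ≫ (β_ H H).hom) ▷ M.X ⊗≫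
             H ◁ (𝒮[H] ▷ M.X ≫ M.actL) := by
      rw [← BraidedCategory.braiding_naturality_right]
      monoidal
    _ = M.coactL ⊗≫ (Δ[H] ≫ Δ[H] ▷ H) ▷ M.X ⊗≫ ((H ◁
          (𝒮[H] ▷ H ≫ μ[H])) ≫ (β_ H H).hom) ▷ M.X ⊗≫
             H ◁ (𝒮[H] ▷ M.X ≫ M.actL) := by
      rw [← h.coactL_comul]
      monoidal
    _ = (M.coactL ≫ Δ[H] ▷ M.X) ⊗≫ (H ◁ (Δ[H] ≫ 𝒮[H] ▷ H ≫ μ[H]) ≫ (β_ H H).hom) ▷ M.X ⊗≫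
             H ◁ (𝒮[H] ▷ M.X ≫ M.actL) := by
      rw [ComonObj.comul_assoc_flip]
      monoidal
    _ = M.coactL ≫ H ◁ (M.coactL ≫ ε[H] ▷ M.X) ⊗≫ (H ◁ η[H] ≫ (β_ H H).hom) ▷ M.X ⊗≫
             H ◁ (𝒮[H] ▷ M.X ≫ M.actL) := by
      rw [h.coactL_comul, antipode_left]
      monoidal
    _ = M.coactL ⊗≫ ((β_ H (𝟙_ C)).hom ≫ η[H] ▷ H) ▷ M.X ⊗≫
             H ◁ (𝒮[H] ▷ M.X ≫ M.actL) := by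
      rw [h.coactL_counit, BraidedCategory.braiding_naturality_right]
      monoidal
    _ = M.coactL ⊗≫ (η[H] ▷ (H ⊗ M.X) ≫
             H ◁ (𝒮[H] ▷ M.X ≫ M.actL)) := by
      rw [braiding_tensorUnit_right]
      monoidal
    _ = _ := by
      rw [← whisker_exchange, idem]
      monoidal

theorem inj_pr_of_idem (h : M.idem ≫ M.idem = M.idem) [IsIdempotentComplete C] :
    M.inj ≫ M.pr = 𝟙 M.invObj :=
  M.splitting.incl_proj h

theorem pr_inj_of_idem (h : M.idem ≫ M.idem = M.idem) [IsIdempotentComplete C] :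
    M.pr ≫ M.inj = M.idem :=
  M.splitting.proj_incl h

theorem inj_idem (h : M.idem ≫ M.idem = M.idem) [IsIdempotentComplete C] :
    M.inj ≫ M.idem = M.inj := by
  rw [← pr_inj_of_idem h, reassoc_of% inj_pr_of_idem h]

theorem idem_pr (h : M.idem ≫ M.idem = M.idem) [IsIdempotentComplete C] :
    M.idem ≫ M.pr = M.pr := by
  rw [← pr_inj_of_idem h, Category.assoc, inj_pr_of_idem h, Category.comp_id]

/-- `x₋₂ S(x₋₁) x₀ = x`: a Hopf bimodule is generated by its invariants. -/
theorem IsHopfBimod.coactL_idem_actL (h : M.IsHopfBimod) :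
    M.coactL ≫ H ◁ M.idem ≫ M.actL = 𝟙 M.X := by
  calc
    _ = (M.coactL ≫ H ◁ M.coactL ≫ (α_ H H M.X).inv) ≫ (H ◁ 𝒮[H]) ▷ M.X ≫
          ((α_ H H M.X).hom ≫ H ◁ M.actL ≫ M.actL) := by
      rw [idem]
      monoidal
    _ = M.coactL ≫ (Δ[H] ≫ H ◁ 𝒮[H] ≫ μ[H]) ▷ M.X ≫ M.actL := by
      rw [← h.coactL_comul, ← h.mul_actL]
      monoidal
    _ = (M.coactL ≫ ε[H] ▷ M.X) ≫ (η[H] ▷ M.X ≫ M.actL) := by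
      rw [antipode_right]
      monoidal
    _ = 𝟙 M.X := by
      rw [h.coactL_counit, h.one_actL]
      simp

variable [IsIdempotentComplete C]

theorem IsHopfBimod.inj_idem (h : M.IsHopfBimod) : M.inj ≫ M.idem = M.inj :=
  HopfBimodData.inj_idem h.idem_idem

theorem IsHopfBimod.idem_pr (h : M.IsHopfBimod) : M.idem ≫ M.pr = M.pr :=
  HopfBimodData.idem_pr h.idem_idem

/-- The projection to the invariants coequalizes the left action and the trivial one:
`pr (h x) = ε(h) pr x`. -/
theorem IsHopfBimod.actL_pr (h : M.IsHopfBimod) :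
    M.actL ≫ M.pr = ε[H] ▷ M.X ≫ (λ_ M.X).hom ≫ M.pr := by
  rw [← h.idem_pr, reassoc_of% h.actL_idem]

/-- The invariants are left coinvariant: `x₋₁ ⊗ x₀ = 1 ⊗ x`. -/
theorem IsHopfBimod.inj_coactL (h : M.IsHopfBimod) :
    M.inj ≫ M.coactL = M.inj ≫ (λ_ M.X).inv ≫ η[H] ▷ M.X := by
  rw [← h.inj_idem, Category.assoc, h.idem_coactL, Category.assoc]

theorem IsHopfBimod.coactL_pr_inj_actL (h : M.IsHopfBimod) :
    M.coactL ≫ H ◁ M.pr ≫ H ◁ M.inj ≫ M.actL = 𝟙 M.X := by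
  rw [← whiskerLeft_comp_assoc, h.pr_inj, h.coactL_idem_actL]

/-- The left coaction on a product `h x` with `x` invariant is `h₁ ⊗ h₂ x`. -/
theorem IsHopfBimod.inj_actL_coactL (h : M.IsHopfBimod) :
    H ◁ M.inj ≫ M.actL ≫ M.coactL =
      Δ[H] ▷ M.invObj ≫ (α_ H H M.invObj).hom ≫ H ◁ (H ◁ M.inj ≫ M.actL) := by
  calc
    _ = (H ◁ (M.inj ≫ M.coactL) ≫ Δ[H] ▷ (H ⊗ M.X)) ⊗≫ H ◁ (β_ H H).hom ▷ M.X ⊗≫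
          μ[H] ▷ (H ⊗ M.X) ≫ H ◁ M.actL := by
      rw [h.actL_coactL, tensorμ, MonoidalCategory.tensorHom_def' Δ[H],
        MonoidalCategory.tensorHom_def μ[H]]
      monoidal
    _ = Δ[H] ▷ M.invObj ⊗≫ (H ⊗ H) ◁ M.inj ⊗≫ H ◁ (H ◁ η[H] ≫ (β_ H H).hom) ▷ M.X ⊗≫
          μ[H] ▷ (H ⊗ M.X) ≫ H ◁ M.actL := by
      rw [whisker_exchange, h.inj_coactL]
      monoidal
    _ = Δ[H] ▷ M.invObj ⊗≫ (H ⊗ H) ◁ M.inj ⊗≫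
          (H ◁ η[H] ≫ μ[H]) ▷ (H ⊗ M.X) ⊗≫ H ◁ M.actL := by
      rw [BraidedCategory.braiding_naturality_right, braiding_tensorUnit_right]
      monoidal
    _ = _ := by
      rw [MonObj.mul_one]
      monoidal

/-- The invariants are stable under the right coaction. -/
theorem IsHopfBimod.inj_coactR (h : M.IsHopfBimod) :
    M.inj ≫ M.coactR = M.invCoact ≫ M.inj ▷ H := by
  symm
  calc
    _ = M.inj ≫ M.coactR ≫ (M.pr ≫ M.inj) ▷ H := by
      rw [invCoact]
      monoidal
    _ = M.inj ≫ (M.coactR ≫ M.coactL ▷ H) ≫ (𝒮[H] ▷ M.X) ▷ H ≫ M.actL ▷ H := by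
      rw [h.pr_inj, idem]
      monoidal
    _ = (M.inj ≫ M.coactL) ≫ H ◁ M.coactR ⊗≫ (𝒮[H] ▷ M.X) ▷ H ≫ M.actL ▷ H := by
      rw [h.coact_assoc]
      monoidal
    _ = M.inj ⊗≫ (η[H] ▷ M.X ≫ H ◁ M.coactR) ⊗≫ (𝒮[H] ▷ M.X) ▷ H ≫ M.actL ▷ H := by
      rw [h.inj_coactL]
      monoidal
    _ = M.inj ≫ M.coactR ⊗≫ ((η[H] ≫ 𝒮[H]) ▷ M.X ≫ M.actL) ▷ H := by
      rw [← whisker_exchange]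
      monoidal
    _ = _ := by
      rw [one_antipode, h.one_actL]
      monoidal

/-- The right action descends along the projection to the invariants. -/
theorem IsHopfBimod.actR_pr (h : M.IsHopfBimod) :
    M.actR ≫ M.pr = M.pr ▷ H ≫ M.invAct := by
  symm
  calc
    _ = (M.pr ≫ M.inj) ▷ H ≫ M.actR ≫ M.pr := by
      rw [invAct]
      monoidal
    _ = M.coactL ▷ H ≫ (𝒮[H] ▷ M.X) ▷ H ≫ (M.actL ▷ H ≫ M.actR) ≫ M.pr := by
      rw [h.pr_inj, idem]
      monoidal
    _ = M.coactL ▷ H ≫ (𝒮[H] ▷ M.X) ▷ H ⊗≫ H ◁ M.actR ≫ (M.actL ≫ M.pr) := by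
      rw [h.act_assoc]
      monoidal
    _ = M.coactL ▷ H ≫ (𝒮[H] ▷ M.X) ▷ H ⊗≫ (H ◁ M.actR ≫ ε[H] ▷ M.X) ⊗≫ M.pr := by
      rw [h.actL_pr]
      monoidal
    _ = (M.coactL ≫ (𝒮[H] ≫ ε[H]) ▷ M.X) ▷ H ⊗≫ M.actR ⊗≫ M.pr := by
      rw [whisker_exchange]
      monoidal
    _ = _ := by
      rw [antipode_counit, h.coactL_counit]
      monoidal

/-- The left coaction on a product `x h` with `x` invariant is `h₁ ⊗ x h₂`. -/
theorem IsHopfBimod.inj_actR_coactL (h : M.IsHopfBimod) :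
    M.inj ▷ H ≫ M.actR ≫ M.coactL =
      M.invObj ◁ Δ[H] ≫ (α_ M.invObj H H).inv ≫ (β_ M.invObj H).hom ▷ H ≫
        (α_ H M.invObj H).hom ≫ H ◁ (M.inj ▷ H ≫ M.actR) := by
  calc
    _ = (M.inj ≫ M.coactL) ▷ H ≫ (H ⊗ M.X) ◁ Δ[H] ⊗≫ H ◁ (β_ M.X H).hom ▷ H ⊗≫
          μ[H] ▷ (M.X ⊗ H) ≫ H ◁ M.actR := by
      rw [h.actR_coactL, tensorμ, MonoidalCategory.tensorHom_def, MonoidalCategory.tensorHom_def]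
      monoidal
    _ = 𝟙 _ ⊗≫ M.inj ▷ H ⊗≫ ((η[H] ▷ M.X) ▷ H ≫ (H ⊗ M.X) ◁ Δ[H]) ⊗≫
          H ◁ (β_ M.X H).hom ▷ H ⊗≫ μ[H] ▷ (M.X ⊗ H) ≫ H ◁ M.actR := by
      rw [h.inj_coactL]
      monoidal
    _ = 𝟙 _ ⊗≫ (M.inj ▷ H ≫ M.X ◁ Δ[H]) ⊗≫ (η[H] ▷ (M.X ⊗ H) ≫
          H ◁ (β_ M.X H).hom) ▷ H ⊗≫ μ[H] ▷ (M.X ⊗ H) ≫ H ◁ M.actR := by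
      rw [← whisker_exchange]
      monoidal
    _ = 𝟙 _ ⊗≫ M.invObj ◁ Δ[H] ⊗≫ (M.inj ▷ H ≫ (β_ M.X H).hom) ▷ H ⊗≫
          (η[H] ▷ H ≫ μ[H]) ▷ (M.X ⊗ H) ≫ H ◁ M.actR := by
      rw [← whisker_exchange, ← whisker_exchange]
      monoidal
    _ = _ := by
      rw [BraidedCategory.braiding_naturality_left, MonObj.one_mul]
      monoidal

/-- The right coaction on `h x`, projected to the invariants, is `x₀ ⊗ h x₁`. -/
theorem IsHopfBimod.actL_coactR_pr (h : M.IsHopfBimod) :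
    M.actL ≫ M.coactR ≫ M.pr ▷ H =
      H ◁ (M.coactR ≫ M.pr ▷ H) ≫ (α_ H M.invObj H).inv ≫ (β_ H M.invObj).hom ▷ H ≫
        (α_ M.invObj H H).hom ≫ M.invObj ◁ μ[H] := by
  calc
    _ = Δ[H] ▷ M.X ≫ (H ⊗ H) ◁ M.coactR ⊗≫ H ◁ (β_ H M.X).hom ▷ H ⊗≫
          (H ⊗ M.X) ◁ μ[H] ≫ (M.actL ≫ M.pr) ▷ H := by
      rw [reassoc_of% h.actL_coactR, tensorμ, MonoidalCategory.tensorHom_def,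
        MonoidalCategory.tensorHom_def']
      monoidal
    _ = Δ[H] ▷ M.X ≫ (H ⊗ H) ◁ M.coactR ⊗≫ H ◁ (β_ H M.X).hom ▷ H ⊗≫
          ((H ⊗ M.X) ◁ μ[H] ≫ ε[H] ▷ M.X ▷ H) ⊗≫ M.pr ▷ H := by
      rw [h.actL_pr]
      monoidal
    _ = Δ[H] ▷ M.X ≫ (H ⊗ H) ◁ M.coactR ⊗≫ (H ◁ (β_ H M.X).hom ≫ ε[H] ▷ (M.X ⊗ H)) ▷ H ⊗≫
          (M.X ◁ μ[H] ≫ M.pr ▷ H) := by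
      have := whisker_exchange ε[H] (M.X ◁ μ[H])
      calc
        _ = Δ[H] ▷ M.X ≫ (H ⊗ H) ◁ M.coactR ⊗≫ H ◁ (β_ H M.X).hom ▷ H ⊗≫
          (H ◁ M.X ◁ μ[H] ≫ ε[H] ▷ (M.X ⊗ H)) ⊗≫ M.pr ▷ H := by monoidal
        _ = _ := by rw [this]; monoidal
    _ = Δ[H] ▷ M.X ≫ ((H ⊗ H) ◁ M.coactR ≫ (ε[H] ▷ H) ▷ (M.X ⊗ H)) ⊗≫
          ((β_ H M.X).hom ≫ M.pr ▷ H) ▷ H ⊗≫ M.invObj ◁ μ[H] := by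
      rw [whisker_exchange, whisker_exchange]
      monoidal
    _ = (Δ[H] ≫ ε[H] ▷ H) ▷ M.X ⊗≫ H ◁ M.coactR ⊗≫
          (H ◁ M.pr ≫ (β_ H M.invObj).hom) ▷ H ⊗≫ M.invObj ◁ μ[H] := by
      rw [whisker_exchange, BraidedCategory.braiding_naturality_right]
      monoidal
    _ = _ := by
      rw [counit_comul]
      monoidal

end

end HopfBimodData

/-! ### The canonical morphisms to and from the tensor product over `H` -/

namespace HopfBimodData
section

open HopfObj

variable {C : Type u} [Category.{v} C] [MonoidalCategory C] [BraidedCategory C]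
  [IsIdempotentComplete C] {H : C} [HopfObj H]

/-- The left structures of `N ⊗_H M` come from `N`, hence so does its idempotent. -/
theorem tensor_idem (N M : HopfBimodData H) :
    (N.tensor M).idem = N.idem ▷ M.invObj := by
  change (N.coactL ▷ M.invObj ≫ (α_ H N.X M.invObj).hom) ≫ 𝒮[H] ▷ (N.X ⊗ M.invObj) ≫
    (α_ H N.X M.invObj).inv ≫ N.actL ▷ M.invObj = _
  rw [idem]
  monoidal

theorem IsHopfBimod.tensor_idem_idem {N : HopfBimodData H} (hN : N.IsHopfBimod)
    (M : HopfBimodData H) : (N.tensor M).idem ≫ (N.tensor M).idem = (N.tensor M).idem := by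
  rw [tensor_idem]
  exact (comp_whiskerRight _ _ _).symm.trans (congrArg (· ▷ M.invObj) hN.idem_idem)

/-- The projection to the invariants of `N ⊗_H M`, with its domain written as a tensor product
in `C`. -/
noncomputable def tensorPr (N M : HopfBimodData H) : N.X ⊗ M.invObj ⟶ (N.tensor M).invObj :=
  (N.tensor M).pr

/-- The inclusion of the invariants of `N ⊗_H M`, with its codomain written as a tensor product
in `C`. -/
noncomputable def tensorInj (N M : HopfBimodData H) : (N.tensor M).invObj ⟶ N.X ⊗ M.invObj :=
  (N.tensor M).inj

theorem IsHopfBimod.tensorInj_tensorPr {N : HopfBimodData H} (hN : N.IsHopfBimod)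
    (M : HopfBimodData H) : tensorInj N M ≫ tensorPr N M = 𝟙 _ :=
  inj_pr_of_idem (hN.tensor_idem_idem M)

theorem IsHopfBimod.tensorPr_tensorInj {N : HopfBimodData H} (hN : N.IsHopfBimod)
    (M : HopfBimodData H) : tensorPr N M ≫ tensorInj N M = N.idem ▷ M.invObj :=
  (pr_inj_of_idem (hN.tensor_idem_idem M)).trans (tensor_idem N M)

theorem IsHopfBimod.idem_tensorPr {N : HopfBimodData H} (hN : N.IsHopfBimod)
    (M : HopfBimodData H) : N.idem ▷ M.invObj ≫ tensorPr N M = tensorPr N M := by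
  rw [← hN.tensorPr_tensorInj, Category.assoc, hN.tensorInj_tensorPr, Category.comp_id]

/-- `N ◁ inj` is a section of the canonical morphism `N ⊗ M ⟶ N ⊗_H M`. -/
theorem IsHopfBimod.inj_toTensor {N M : HopfBimodData H} (hN : N.IsHopfBimod)
    (hM : M.IsHopfBimod) : N.X ◁ M.inj ≫ toTensor N M = 𝟙 (N.X ⊗ M.invObj) := by
  calc
    _ = N.X ◁ ((M.inj ≫ M.coactL) ≫ H ◁ M.pr) ⊗≫ N.actR ▷ M.invObj := by
      rw [toTensor]
      monoidal
    _ = N.X ◁ M.inj ⊗≫ N.X ◁ (η[H] ▷ M.X ≫ H ◁ M.pr) ⊗≫ N.actR ▷ M.invObj := by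
      rw [hM.inj_coactL]
      monoidal
    _ = N.X ◁ (M.inj ≫ M.pr) ⊗≫ (N.X ◁ η[H] ≫ N.actR) ▷ M.invObj := by
      rw [← whisker_exchange]
      monoidal
    _ = _ := by
      rw [hM.inj_pr, hN.actR_one]
      monoidal

/-- `N ◁ pr` is a retraction of the canonical morphism `N ⊗_H M ⟶ N ⊗ M`. -/
theorem IsHopfBimod.ofCotensor_pr {N M : HopfBimodData H} (hN : N.IsHopfBimod)
    (hM : M.IsHopfBimod) : ofCotensor N M ≫ N.X ◁ M.pr = 𝟙 (N.X ⊗ M.invObj) := by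
  calc
    _ = N.coactR ▷ M.invObj ⊗≫ N.X ◁ (H ◁ M.inj ≫ (M.actL ≫ M.pr)) := by
      rw [ofCotensor]
      monoidal
    _ = N.coactR ▷ M.invObj ⊗≫ N.X ◁ (H ◁ M.inj ≫ ε[H] ▷ M.X) ⊗≫ N.X ◁ M.pr := by
      rw [hM.actL_pr]
      monoidal
    _ = (N.coactR ≫ N.X ◁ ε[H]) ▷ M.invObj ⊗≫ N.X ◁ (M.inj ≫ M.pr) := by
      rw [whisker_exchange]
      monoidal
    _ = _ := by
      rw [hM.inj_pr, hN.coactR_counit]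
      monoidal

theorem toTensor_naturality {N N' M M' : HopfBimodData H} {f : N.X ⟶ N'.X} {g : M.X ⟶ M'.X}
    (hf : IsHom N N' f) (hg : IsHom M M' g) (hM : M.idem ≫ M.idem = M.idem)
    (hM' : M'.idem ≫ M'.idem = M'.idem) :
    toTensor N M ≫ tensorMap N N' M M' f g = (f ⊗ₘ g) ≫ toTensor N' M' := by
  have e : M.pr ≫ M.inj ≫ g ≫ M'.pr = g ≫ M'.pr := by
    rw [reassoc_of% pr_inj_of_idem hM, reassoc_of% hg.idem, idem_pr hM']
  calc
    _ = N.X ◁ (M.coactL ≫ H ◁ M.pr) ⊗≫ (N.actR ≫ f) ▷ M.invObj ≫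
          N'.X ◁ (M.inj ≫ g ≫ M'.pr) := by
      rw [toTensor, tensorMap, MonoidalCategory.tensorHom_def]
      monoidal
    _ = N.X ◁ M.coactL ⊗≫ (N.X ⊗ H) ◁ (M.pr ≫ M.inj ≫ g ≫ M'.pr) ⊗≫
          (f ▷ H ≫ N'.actR) ▷ M'.invObj := by
      rw [← whisker_exchange, hf.actR]
      monoidal
    _ = N.X ◁ (M.coactL ≫ H ◁ g) ⊗≫ (N.X ◁ H ◁ M'.pr ≫ f ▷ (H ⊗ M'.invObj)) ⊗≫
          N'.actR ▷ M'.invObj := by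
      rw [e]
      monoidal
    _ = _ := by
      rw [hg.coactL, whisker_exchange, toTensor, MonoidalCategory.tensorHom_def']
      have := whisker_exchange f (g ≫ M'.coactL)
      calc
        _ = (N.X ◁ (g ≫ M'.coactL) ≫ f ▷ (H ⊗ M'.X)) ≫ N'.X ◁ H ◁ M'.pr ⊗≫
          N'.actR ▷ M'.invObj := by monoidal
        _ = _ := by
          rw [this, ← MonoidalCategory.tensorHom_def', MonoidalCategory.tensorHom_def]
          monoidal

theorem ofCotensor_naturality {N N' M M' : HopfBimodData H} {f : N.X ⟶ N'.X} {g : M.X ⟶ M'.X}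
    (hf : IsHom N N' f) (hg : IsHom M M' g) (hM : M.idem ≫ M.idem = M.idem)
    (hM' : M'.idem ≫ M'.idem = M'.idem) :
    tensorMap N N' M M' f g ≫ ofCotensor N' M' = ofCotensor N M ≫ (f ⊗ₘ g) := by
  have e : M.inj ≫ g ≫ M'.pr ≫ M'.inj = M.inj ≫ g := by
    rw [pr_inj_of_idem hM', ← hg.idem, reassoc_of% inj_idem hM]
  calc
    _ = f ▷ M.invObj ≫ (N'.X ◁ (M.inj ≫ g ≫ M'.pr) ≫ N'.coactR ▷ M'.invObj) ⊗≫
          N'.X ◁ (H ◁ M'.inj ≫ M'.actL) := by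
      rw [ofCotensor, tensorMap, MonoidalCategory.tensorHom_def]
      monoidal
    _ = (f ≫ N'.coactR) ▷ M.invObj ⊗≫ N'.X ◁ (H ◁ (M.inj ≫ g ≫ M'.pr ≫ M'.inj) ≫ M'.actL) := by
      rw [whisker_exchange]
      monoidal
    _ = (N.coactR ≫ f ▷ H) ▷ M.invObj ⊗≫ N'.X ◁ (H ◁ M.inj ≫ (H ◁ g ≫ M'.actL)) := by
      rw [e, ← hf.coactR]
      monoidal
    _ = N.coactR ▷ M.invObj ⊗≫ (f ▷ (H ⊗ M.invObj) ≫
          N'.X ◁ (H ◁ M.inj ≫ (M.actL ≫ g))) := by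
      rw [← hg.actL]
      monoidal
    _ = _ := by
      rw [← whisker_exchange, ofCotensor, MonoidalCategory.tensorHom_def']
      monoidal

/-- The canonical morphism `N ⊗ M ⟶ N ⊗_H M` is right `H`-linear for the right action of `M` on the
source. -/
theorem IsHopfBimod.toTensor_actR {N M : HopfBimodData H} (hN : N.IsHopfBimod)
    (hM : M.IsHopfBimod) :
    toTensor N M ▷ H ≫ (N.tensor M).actR =
      (α_ N.X M.X H).hom ≫ N.X ◁ M.actR ≫ toTensor N M := by
  symm
  change (α_ N.X M.X H).hom ≫ N.X ◁ M.actR ≫ N.X ◁ (M.coactL ≫ H ◁ M.pr) ≫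
      (α_ N.X H M.invObj).inv ≫ N.actR ▷ M.invObj =
    (N.X ◁ (M.coactL ≫ H ◁ M.pr) ≫ (α_ N.X H M.invObj).inv ≫ N.actR ▷ M.invObj) ▷ H ≫
      (N.X ⊗ M.invObj) ◁ Δ[H] ≫ tensorμ N.X M.invObj H H ≫ (N.actR ⊗ₘ M.invAct)
  calc
    _ = 𝟙 ((N.X ⊗ M.X) ⊗ H) ⊗≫ N.X ◁ ((M.actR ≫ M.coactL) ≫ H ◁ M.pr) ⊗≫ N.actR ▷ M.invObj := by
      monoidal
    _ = 𝟙 ((N.X ⊗ M.X) ⊗ H) ⊗≫ N.X ◁ (M.coactL ▷ H ≫ (H ⊗ M.X) ◁ Δ[H] ⊗≫ H ◁ (β_ M.X H).hom ▷ H ⊗≫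
          μ[H] ▷ (M.X ⊗ H) ≫ H ◁ (M.actR ≫ M.pr)) ⊗≫ N.actR ▷ M.invObj := by
      rw [hM.actR_coactL, tensorμ, MonoidalCategory.tensorHom_def, MonoidalCategory.tensorHom_def]
      monoidal
    _ = 𝟙 ((N.X ⊗ M.X) ⊗ H) ⊗≫ N.X ◁ (M.coactL ▷ H ≫ (H ⊗ M.X) ◁ Δ[H] ⊗≫ H ◁ (β_ M.X H).hom ▷ H ⊗≫
          (H ⊗ H) ◁ (M.pr ▷ H ≫ M.invAct)) ⊗≫ (N.X ◁ μ[H] ≫ N.actR) ▷ M.invObj := by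
      rw [← whisker_exchange, hM.actR_pr]
      monoidal
    _ = 𝟙 ((N.X ⊗ M.X) ⊗ H) ⊗≫ N.X ◁ (M.coactL ▷ H ≫ (H ⊗ M.X) ◁ Δ[H] ⊗≫
          H ◁ ((β_ M.X H).hom ≫ H ◁ M.pr) ▷ H) ⊗≫ (N.X ⊗ H ⊗ H) ◁ M.invAct ⊗≫
          ((N.actR ▷ H ≫ N.actR)) ▷ M.invObj := by
      rw [hN.actR_mul]
      monoidal
    _ = 𝟙 ((N.X ⊗ M.X) ⊗ H) ⊗≫ N.X ◁ (M.coactL ▷ H ⊗≫ H ◁ (M.X ◁ Δ[H] ≫ M.pr ▷ (H ⊗ H)) ⊗≫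
          H ◁ (β_ M.invObj H).hom ▷ H) ⊗≫
          ((N.X ⊗ H) ◁ H ◁ M.invAct ≫ N.actR ▷ (H ⊗ M.invObj)) ⊗≫ N.actR ▷ M.invObj := by
      rw [← BraidedCategory.braiding_naturality_left]
      monoidal
    _ = 𝟙 ((N.X ⊗ M.X) ⊗ H) ⊗≫ N.X ◁ ((M.coactL ≫ H ◁ M.pr) ▷ H ⊗≫ (H ⊗ M.invObj) ◁ Δ[H]) ⊗≫
          ((N.X ⊗ H) ◁ (β_ M.invObj H).hom ≫ N.actR ▷ (H ⊗ M.invObj)) ▷ H ⊗≫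
          N.X ◁ H ◁ M.invAct ⊗≫ N.actR ▷ M.invObj := by
      rw [whisker_exchange, whisker_exchange]
      monoidal
    _ = 𝟙 ((N.X ⊗ M.X) ⊗ H) ⊗≫ N.X ◁ ((M.coactL ≫ H ◁ M.pr) ▷ H) ⊗≫
          ((N.X ⊗ H) ◁ M.invObj ◁ Δ[H] ≫ N.actR ▷ (M.invObj ⊗ H ⊗ H)) ⊗≫
          N.X ◁ (β_ M.invObj H).hom ▷ H ⊗≫ ((N.X ⊗ H) ◁ M.invAct ≫ N.actR ▷ M.invObj) := by
      rw [whisker_exchange]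
      monoidal
    _ = _ := by
      rw [whisker_exchange, whisker_exchange]
      rw [tensorμ, MonoidalCategory.tensorHom_def]
      monoidal

/-- The canonical morphism `N ⊗_H M ⟶ N ⊗ M` is right `H`-colinear for the right coaction of `M` on
the target. -/
theorem IsHopfBimod.coactR_ofCotensor {N M : HopfBimodData H} (hN : N.IsHopfBimod)
    (hM : M.IsHopfBimod) :
    (N.tensor M).coactR ≫ ofCotensor N M ▷ H =
      ofCotensor N M ≫ N.X ◁ M.coactR ≫ (α_ N.X M.X H).inv := by
  symm
  change (N.coactR ▷ M.invObj ≫ (α_ N.X H M.invObj).hom ≫ N.X ◁ (H ◁ M.inj ≫ M.actL)) ≫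
      N.X ◁ M.coactR ≫ (α_ N.X M.X H).inv =
    ((N.coactR ⊗ₘ M.invCoact) ≫ tensorμ N.X H M.invObj H ≫ (N.X ⊗ M.invObj) ◁ μ[H]) ≫
      (N.coactR ▷ M.invObj ≫ (α_ N.X H M.invObj).hom ≫ N.X ◁ (H ◁ M.inj ≫ M.actL)) ▷ H
  calc
    _ = N.coactR ▷ M.invObj ⊗≫ N.X ◁ (H ◁ M.inj ≫ (M.actL ≫ M.coactR)) ⊗≫ 𝟙 ((N.X ⊗ M.X) ⊗ H) := by
      monoidal
    _ = N.coactR ▷ M.invObj ⊗≫ N.X ◁ (H ◁ (M.inj ≫ M.coactR) ≫ Δ[H] ▷ (M.X ⊗ H) ⊗≫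
          H ◁ (β_ H M.X).hom ▷ H ⊗≫ (H ⊗ M.X) ◁ μ[H] ≫ M.actL ▷ H) ⊗≫ 𝟙 ((N.X ⊗ M.X) ⊗ H) := by
      rw [hM.actL_coactR, tensorμ, MonoidalCategory.tensorHom_def',
        MonoidalCategory.tensorHom_def' M.actL]
      monoidal
    _ = N.coactR ▷ M.invObj ⊗≫ N.X ◁ ((H ◁ (M.invCoact ≫ M.inj ▷ H) ≫ Δ[H] ▷ (M.X ⊗ H)) ⊗≫
          H ◁ (β_ H M.X).hom ▷ H ⊗≫ (H ⊗ M.X) ◁ μ[H] ≫ M.actL ▷ H) ⊗≫ 𝟙 ((N.X ⊗ M.X) ⊗ H) := by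
      rw [hM.inj_coactR]
      monoidal
    _ = (N.coactR ≫ N.X ◁ Δ[H]) ▷ M.invObj ⊗≫ N.X ◁ (H ◁ H ◁ M.invCoact ⊗≫
          H ◁ (H ◁ M.inj ≫ (β_ H M.X).hom) ▷ H ⊗≫ (H ⊗ M.X) ◁ μ[H] ≫ M.actL ▷ H) ⊗≫
          𝟙 ((N.X ⊗ M.X) ⊗ H) := by
      rw [whisker_exchange]
      monoidal
    _ = N.coactR ▷ M.invObj ⊗≫ (N.coactR ▷ (H ⊗ M.invObj) ≫ (N.X ⊗ H) ◁ H ◁ M.invCoact) ⊗≫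
          N.X ◁ (H ◁ (β_ H M.invObj).hom ▷ H ⊗≫ H ◁ (M.inj ▷ (H ⊗ H) ≫
            M.X ◁ μ[H]) ⊗≫ M.actL ▷ H) ⊗≫ 𝟙 ((N.X ⊗ M.X) ⊗ H) := by
      rw [hN.coactR_comul, BraidedCategory.braiding_naturality_right]
      monoidal
    _ = N.coactR ▷ M.invObj ⊗≫ N.X ◁ H ◁ M.invCoact ⊗≫ (N.coactR ▷ (H ⊗ M.invObj) ≫
          (N.X ⊗ H) ◁ (β_ H M.invObj).hom) ▷ H ⊗≫
          N.X ◁ (H ◁ (M.invObj ◁ μ[H] ≫ M.inj ▷ H) ⊗≫ M.actL ▷ H) ⊗≫ 𝟙 ((N.X ⊗ M.X) ⊗ H) := by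
      rw [← whisker_exchange, ← whisker_exchange]
      monoidal
    _ = N.coactR ▷ M.invObj ⊗≫ N.X ◁ H ◁ M.invCoact ⊗≫ N.X ◁ (β_ H M.invObj).hom ▷ H ⊗≫
          (N.coactR ▷ (M.invObj ⊗ H ⊗ H) ≫
          (N.X ⊗ H) ◁ M.invObj ◁ μ[H]) ⊗≫ N.X ◁ (H ◁ M.inj ≫ M.actL) ▷ H ⊗≫
          𝟙 ((N.X ⊗ M.X) ⊗ H) := by
      rw [← whisker_exchange]
      monoidal
    _ = _ := by
      rw [← whisker_exchange]
      rw [tensorμ, MonoidalCategory.tensorHom_def]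
      monoidal

end
end HopfBimodData

/-! ### The regular Hopf bimodule -/

namespace HopfBimodData
section

open HopfObj

variable {C : Type u} [Category.{v} C] [MonoidalCategory C] [BraidedCategory C]
  {H : C} [HopfObj H]

theorem isHopfBimod_regular : (regular H).IsHopfBimod where
  one_actL := MonObj.one_mul H
  mul_actL := MonObj.mul_assoc H
  actR_one := MonObj.mul_one H
  actR_mul := MonObj.mul_assoc_flip H
  act_assoc := MonObj.mul_assoc H
  coactL_counit := ComonObj.counit_comul H
  coactL_comul := ComonObj.comul_assoc_flip H
  coactR_counit := ComonObj.comul_counit H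
  coactR_comul := ComonObj.comul_assoc H
  coact_assoc := ComonObj.comul_assoc_flip H
  actL_coactL := BimonObj.mul_comul H
  actR_coactL := BimonObj.mul_comul H
  actL_coactR := BimonObj.mul_comul H
  actR_coactR := BimonObj.mul_comul H

theorem regular_idem : (regular H).idem = ε[H] ≫ η[H] :=
  antipode_left H

variable [IsIdempotentComplete C]

/-! ### Associativity and unit constraints -/

/-- The canonical morphisms `N ⊗ M ⟶ N ⊗_H M` are associative. -/
theorem toTensor_assoc {N M P : HopfBimodData H} (hN : N.IsHopfBimod) (hM : M.IsHopfBimod) :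
    toTensor N M ▷ P.X ≫ toTensor (N.tensor M) P ≫ assocHom N M P =
      (α_ N.X M.X P.X).hom ≫ N.X ◁ toTensor M P ≫ toTensor N (M.tensor P) := by
  have e := hN.toTensor_actR hM
  -- `a` and `l` are the two morphisms with domains and codomains spelled out as tensor products
  -- in `C`, the form that `monoidal` recognizes.
  obtain ⟨a, ha⟩ : ∃ a : (N.X ⊗ M.invObj) ⊗ H ⟶ N.X ⊗ M.invObj, a = (N.tensor M).actR :=
    ⟨_, rfl⟩
  obtain ⟨l, hl⟩ : ∃ l : N.X ⊗ M.X ⟶ N.X ⊗ M.invObj, l = toTensor N M := ⟨_, rfl⟩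
  replace e : l ▷ H ≫ a = (α_ N.X M.X H).hom ≫ N.X ◁ M.actR ≫ l := by rw [ha, hl]; exact e
  have hl' : l = N.X ◁ (M.coactL ≫ H ◁ M.pr) ≫ (α_ N.X H M.invObj).inv ≫ N.actR ▷ M.invObj := hl
  have hp : M.pr ▷ P.invObj ≫ M.inj ▷ P.invObj ≫ tensorPr M P = tensorPr M P := by
    rw [← comp_whiskerRight_assoc, hM.pr_inj, hM.idem_tensorPr]
  trans l ▷ P.X ≫ ((N.X ⊗ M.invObj) ◁ (P.coactL ≫ H ◁ P.pr) ≫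
    (α_ (N.X ⊗ M.invObj) H P.invObj).inv ≫ a ▷ P.invObj) ≫
    (α_ N.X M.invObj P.invObj).hom ≫ N.X ◁ (M.inj ▷ P.invObj ≫ tensorPr M P)
  · rw [hl, ha]
    rfl
  trans (α_ N.X M.X P.X).hom ≫ N.X ◁ (M.X ◁ (P.coactL ≫ H ◁ P.pr) ≫
    (α_ M.X H P.invObj).inv ≫ M.actR ▷ P.invObj) ≫ N.X ◁ ((M.coactL ▷ P.invObj ≫
    (α_ H M.X P.invObj).hom) ≫ H ◁ tensorPr M P) ≫
    (α_ N.X H (M.tensor P).invObj).inv ≫ N.actR ▷ (M.tensor P).invObj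
  swap
  · rfl
  calc
    _ = (l ▷ P.X ≫ (N.X ⊗ M.invObj) ◁ (P.coactL ≫ H ◁ P.pr)) ⊗≫
          a ▷ P.invObj ⊗≫ N.X ◁ (M.inj ▷ P.invObj ≫ tensorPr M P) := by
      monoidal
    _ = (N.X ⊗ M.X) ◁ (P.coactL ≫ H ◁ P.pr) ⊗≫ (l ▷ H ≫ a) ▷ P.invObj ⊗≫
          N.X ◁ (M.inj ▷ P.invObj ≫ tensorPr M P) := by
      rw [← whisker_exchange]
      monoidal
    _ = (N.X ⊗ M.X) ◁ (P.coactL ≫ H ◁ P.pr) ⊗≫ (N.X ◁ M.actR) ▷ P.invObj ⊗≫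
          N.X ◁ (M.coactL ≫ H ◁ M.pr) ▷ P.invObj ⊗≫ (N.actR ▷ (M.invObj ⊗ P.invObj) ≫
          N.X ◁ (M.inj ▷ P.invObj ≫ tensorPr M P)) := by
      rw [e, hl']
      monoidal
    _ = (N.X ⊗ M.X) ◁ (P.coactL ≫ H ◁ P.pr) ⊗≫ (N.X ◁ M.actR) ▷ P.invObj ⊗≫
          N.X ◁ M.coactL ▷ P.invObj ⊗≫
          (N.X ⊗ H) ◁ (M.pr ▷ P.invObj ≫ M.inj ▷ P.invObj ≫ tensorPr M P) ⊗≫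
          N.actR ▷ (M.tensor P).invObj := by
      rw [← whisker_exchange]
      monoidal
    _ = _ := by
      rw [hp]
      monoidal

/-- The canonical morphisms `N ⊗_H M ⟶ N ⊗ M` are coassociative. -/
theorem ofCotensor_assoc {N M P : HopfBimodData H} (hN : N.IsHopfBimod) (hM : M.IsHopfBimod) :
    ofCotensor (N.tensor M) P ≫ ofCotensor N M ▷ P.X ≫ (α_ N.X M.X P.X).hom =
      assocHom N M P ≫ ofCotensor N (M.tensor P) ≫ N.X ◁ ofCotensor M P := by
  have e := hN.coactR_ofCotensor hM
  -- `a` and `l` are the two morphisms with domains and codomains spelled out as tensor products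
  -- in `C`, the form that `monoidal` recognizes.
  obtain ⟨a, ha⟩ : ∃ a : N.X ⊗ M.invObj ⟶ (N.X ⊗ M.invObj) ⊗ H, a = (N.tensor M).coactR :=
    ⟨_, rfl⟩
  obtain ⟨l, hl⟩ : ∃ l : N.X ⊗ M.invObj ⟶ N.X ⊗ M.X, l = ofCotensor N M := ⟨_, rfl⟩
  replace e : a ≫ l ▷ H = l ≫ N.X ◁ M.coactR ≫ (α_ N.X M.X H).inv := by rw [ha, hl]; exact e
  have hl' : l = N.coactR ▷ M.invObj ≫ (α_ N.X H M.invObj).hom ≫ N.X ◁ (H ◁ M.inj ≫ M.actL) := hl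
  have hp : M.inj ▷ P.invObj ≫ tensorPr M P ≫ tensorInj M P = M.inj ▷ P.invObj := by
    rw [hM.tensorPr_tensorInj, ← comp_whiskerRight, hM.inj_idem]
  trans (a ▷ P.invObj ≫ (α_ (N.X ⊗ M.invObj) H P.invObj).hom ≫
    (N.X ⊗ M.invObj) ◁ (H ◁ P.inj ≫ P.actL)) ≫ l ▷ P.X ≫ (α_ N.X M.X P.X).hom
  · rw [hl, ha]
    rfl
  trans ((α_ N.X M.invObj P.invObj).hom ≫ N.X ◁ (M.inj ▷ P.invObj ≫ tensorPr M P)) ≫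
    (N.coactR ▷ (M.tensor P).invObj ≫ (α_ N.X H (M.tensor P).invObj).hom ≫
    N.X ◁ (H ◁ tensorInj M P ≫ (α_ H M.X P.invObj).inv ≫ M.actL ▷ P.invObj)) ≫
    N.X ◁ (M.coactR ▷ P.invObj ≫ (α_ M.X H P.invObj).hom ≫ M.X ◁ (H ◁ P.inj ≫ P.actL))
  swap
  · rfl
  symm
  calc
    _ = 𝟙 ((N.X ⊗ M.invObj) ⊗ P.invObj) ⊗≫
          (N.X ◁ (M.inj ▷ P.invObj ≫ tensorPr M P) ≫ N.coactR ▷ (M.tensor P).invObj) ⊗≫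
          N.X ◁ (H ◁ tensorInj M P ⊗≫ M.actL ▷ P.invObj ≫
            M.coactR ▷ P.invObj) ⊗≫ (N.X ⊗ M.X) ◁ (H ◁ P.inj ≫ P.actL) ⊗≫ 𝟙 (N.X ⊗ M.X ⊗ P.X) := by
      monoidal
    _ = N.coactR ▷ M.invObj ▷ P.invObj ⊗≫
          N.X ◁ (H ◁ (M.inj ▷ P.invObj ≫ tensorPr M P ≫ tensorInj M P) ⊗≫ M.actL ▷ P.invObj ≫
            M.coactR ▷ P.invObj) ⊗≫ (N.X ⊗ M.X) ◁ (H ◁ P.inj ≫ P.actL) ⊗≫ 𝟙 (N.X ⊗ M.X ⊗ P.X) := by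
      rw [whisker_exchange]
      monoidal
    _ = (l ≫ N.X ◁ M.coactR ≫ (α_ N.X M.X H).inv) ▷ P.invObj ⊗≫
          (N.X ⊗ M.X) ◁ (H ◁ P.inj ≫ P.actL) ⊗≫ 𝟙 (N.X ⊗ M.X ⊗ P.X) := by
      rw [hp, hl']
      monoidal
    _ = a ▷ P.invObj ⊗≫ (l ▷ (H ⊗ P.invObj) ≫ (N.X ⊗ M.X) ◁ (H ◁ P.inj ≫ P.actL)) ⊗≫
          𝟙 (N.X ⊗ M.X ⊗ P.X) := by
      rw [← e]
      monoidal
    _ = _ := by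
      rw [← whisker_exchange]
      monoidal

/-- The inclusion of the invariants of `H`, with its codomain written as `H`. -/
noncomputable def regularInj (H : C) [HopfObj H] : (regular H).invObj ⟶ H := (regular H).inj

/-- The projection to the invariants of `H`, with its domain written as `H`. -/
noncomputable def regularPr (H : C) [HopfObj H] : H ⟶ (regular H).invObj := (regular H).pr

theorem regularPr_inj : regularPr H ≫ regularInj H = ε[H] ≫ η[H] :=
  isHopfBimod_regular.pr_inj.trans regular_idem

theorem regularInj_counit_one : regularInj H ≫ ε[H] ≫ η[H] = regularInj H :=
  (congrArg (regularInj H ≫ ·) regular_idem.symm).trans isHopfBimod_regular.inj_idem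

theorem IsHopfBimod.toTensor_leftUnitHom {M : HopfBimodData H} (hM : M.IsHopfBimod) :
    toTensor (regular H) M ≫ leftUnitHom M = M.actL := by
  change (H ◁ (M.coactL ≫ H ◁ M.pr) ≫ (α_ H H M.invObj).inv ≫ μ[H] ▷ M.invObj) ≫
    H ◁ M.inj ≫ M.actL = _
  calc
    _ = H ◁ (M.coactL ≫ H ◁ M.pr) ⊗≫ (μ[H] ▷ M.invObj ≫ H ◁ M.inj) ≫ M.actL := by
      monoidal
    _ = H ◁ (M.coactL ≫ H ◁ M.pr ≫ H ◁ M.inj) ⊗≫ (μ[H] ▷ M.X ≫ M.actL) := by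
      rw [← whisker_exchange]
      monoidal
    _ = H ◁ (M.coactL ≫ H ◁ M.pr ≫ H ◁ M.inj ≫ M.actL) ≫ M.actL := by
      rw [hM.mul_actL]
      monoidal
    _ = _ := by
      rw [hM.coactL_pr_inj_actL]
      simp

theorem IsHopfBimod.leftUnitHom_coactL {M : HopfBimodData H} (hM : M.IsHopfBimod) :
    leftUnitHom M ≫ M.coactL = ofCotensor (regular H) M :=
  (Category.assoc _ _ _).trans hM.inj_actL_coactL

theorem IsHopfBimod.leftUnitInv_leftUnitHom {M : HopfBimodData H} (hM : M.IsHopfBimod) :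
    leftUnitInv M ≫ leftUnitHom M = 𝟙 M.X :=
  (Category.assoc _ _ _).trans hM.coactL_pr_inj_actL

theorem toTensor_rightUnitHom (N : HopfBimodData H) :
    toTensor N (regular H) ≫ rightUnitHom N = N.actR := by
  change (N.X ◁ (Δ[H] ≫ H ◁ regularPr H) ≫ (α_ N.X H _).inv ≫ N.actR ▷ _) ≫
    N.X ◁ (regularInj H ≫ ε[H]) ≫ (ρ_ N.X).hom = _
  calc
    _ = N.X ◁ (Δ[H] ≫ H ◁ regularPr H) ⊗≫ (N.actR ▷ _ ≫ N.X ◁ (regularInj H ≫ ε[H])) ⊗≫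
          𝟙 N.X := by
      monoidal
    _ = N.X ◁ (Δ[H] ≫ H ◁ ((regularPr H ≫ regularInj H) ≫ ε[H])) ⊗≫ N.actR := by
      rw [← whisker_exchange]
      monoidal
    _ = N.X ◁ (Δ[H] ≫ H ◁ ε[H]) ⊗≫ N.actR := by
      rw [regularPr_inj, Category.assoc, BimonObj.one_counit, Category.comp_id]
    _ = _ := by
      rw [comul_counit]
      monoidal

theorem rightUnitHom_coactR (N : HopfBimodData H) :
    rightUnitHom N ≫ N.coactR = ofCotensor N (regular H) := by
  symm
  change N.coactR ▷ _ ≫ (α_ N.X H _).hom ≫ N.X ◁ (H ◁ regularInj H ≫ μ[H]) =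
    (N.X ◁ (regularInj H ≫ ε[H]) ≫ (ρ_ N.X).hom) ≫ N.coactR
  calc
    _ = N.coactR ▷ _ ⊗≫ N.X ◁ (H ◁ (regularInj H ≫ ε[H] ≫ η[H]) ≫ μ[H]) := by
      rw [regularInj_counit_one]
      monoidal
    _ = N.coactR ▷ _ ⊗≫ (N.X ⊗ H) ◁ (regularInj H ≫ ε[H]) ⊗≫ N.X ◁ (H ◁ η[H] ≫ μ[H]) := by
      monoidal
    _ = (N.coactR ▷ _ ≫ (N.X ⊗ H) ◁ (regularInj H ≫ ε[H])) ⊗≫ 𝟙 (N.X ⊗ H) := by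
      rw [MonObj.mul_one]
      monoidal
    _ = _ := by
      rw [← whisker_exchange]
      monoidal

theorem leftUnitInv_ofCotensor :
    leftUnitInv (regular H) ≫ ofCotensor (regular H) (regular H) = Δ[H] :=
  (congrArg (leftUnitInv (regular H) ≫ ·) isHopfBimod_regular.leftUnitHom_coactL.symm).trans
    ((Category.assoc _ _ _).symm.trans
    ((congrArg (· ≫ Δ[H]) isHopfBimod_regular.leftUnitInv_leftUnitHom).trans
      (Category.id_comp _)))

end
end HopfBimodData

/-! ### The braiding and the exchange of the two middle factors -/

namespace HopfBimodData
section

open HopfObj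

variable {C : Type u} [Category.{v} C] [MonoidalCategory C] [BraidedCategory C]
  [IsIdempotentComplete C] {H : C} [HopfObj H]

/-- With `IsHopfBimod.coactL_pr_inj_actL`, this says that `H ⊗ _H M ⟶ M`, `h ⊗ x ↦ h x`, is an
isomorphism. -/
theorem IsHopfBimod.inj_actL_coactL_pr {M : HopfBimodData H} (hM : M.IsHopfBimod) :
    H ◁ M.inj ≫ M.actL ≫ M.coactL ≫ H ◁ M.pr = 𝟙 (H ⊗ M.invObj) := by
  calc
    _ = (H ◁ M.inj ≫ M.actL ≫ M.coactL) ≫ H ◁ M.pr := by monoidal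
    _ = Δ[H] ▷ M.invObj ⊗≫ H ◁ (H ◁ M.inj ≫ (M.actL ≫ M.pr)) := by
      rw [hM.inj_actL_coactL]
      monoidal
    _ = Δ[H] ▷ M.invObj ⊗≫ H ◁ (H ◁ M.inj ≫ ε[H] ▷ M.X) ⊗≫ H ◁ M.pr := by
      rw [hM.actL_pr]
      monoidal
    _ = (Δ[H] ≫ H ◁ ε[H]) ▷ M.invObj ⊗≫ H ◁ (M.inj ≫ M.pr) := by
      rw [whisker_exchange]
      monoidal
    _ = _ := by
      rw [comul_counit, hM.inj_pr]
      monoidal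

theorem IsHopfBimod.invCoact_comul {M : HopfBimodData H} (hM : M.IsHopfBimod) :
    M.invCoact ≫ M.invCoact ▷ H = M.invCoact ≫ M.invObj ◁ Δ[H] ≫ (α_ M.invObj H H).inv := by
  calc
    _ = (M.invCoact ≫ M.inj ▷ H) ≫ M.coactR ▷ H ≫ M.pr ▷ H ▷ H := by
      nth_rw 2 [invCoact]
      monoidal
    _ = M.inj ≫ (M.coactR ≫ M.coactR ▷ H ≫ (α_ M.X H H).hom) ⊗≫ M.pr ▷ H ▷ H := by
      rw [← hM.inj_coactR]
      monoidal
    _ = M.inj ≫ M.coactR ≫ (M.X ◁ Δ[H] ≫ M.pr ▷ (H ⊗ H)) ⊗≫ 𝟙 ((M.invObj ⊗ H) ⊗ H) := by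
      rw [← hM.coactR_comul]
      monoidal
    _ = _ := by
      rw [whisker_exchange, invCoact]
      monoidal

/-- `h₁ e(x h₂) = x h` for `x` invariant, where `e` is the idempotent onto the invariants. -/
theorem IsHopfBimod.inj_actR_idem_actL {M : HopfBimodData H} (hM : M.IsHopfBimod) :
    M.invObj ◁ Δ[H] ≫ (α_ M.invObj H H).inv ≫ (β_ M.invObj H).hom ▷ H ≫
      (α_ H M.invObj H).hom ≫ H ◁ (M.inj ▷ H ≫ M.actR ≫ M.idem) ≫ M.actL =
    M.inj ▷ H ≫ M.actR := by
  calc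
    _ = (M.invObj ◁ Δ[H] ≫ (α_ M.invObj H H).inv ≫ (β_ M.invObj H).hom ▷ H ≫
          (α_ H M.invObj H).hom ≫ H ◁ (M.inj ▷ H ≫ M.actR)) ≫ H ◁ M.idem ≫ M.actL := by
      monoidal
    _ = _ := by
      rw [← hM.inj_actR_coactL, Category.assoc, Category.assoc, hM.coactL_idem_actL,
        Category.comp_id]

/-- `pr e(x₀)₀ ⊗ x₋₁ e(x₀)₁ = pr x₀ ⊗ x₁`, where `e` is the idempotent onto the invariants; the dual
of `IsHopfBimod.inj_actR_idem_actL`. -/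
theorem IsHopfBimod.coactL_idem_coactR {M : HopfBimodData H} (hM : M.IsHopfBimod) :
    M.coactL ≫ H ◁ (M.idem ≫ M.coactR ≫ M.pr ▷ H) ≫ (α_ H M.invObj H).inv ≫
      (β_ H M.invObj).hom ▷ H ≫ (α_ M.invObj H H).hom ≫ M.invObj ◁ μ[H] =
    M.coactR ≫ M.pr ▷ H := by
  calc
    _ = M.coactL ≫ H ◁ M.idem ≫ (H ◁ (M.coactR ≫ M.pr ▷ H) ≫ (α_ H M.invObj H).inv ≫
          (β_ H M.invObj).hom ▷ H ≫ (α_ M.invObj H H).hom ≫ M.invObj ◁ μ[H]) := by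
      monoidal
    _ = (M.coactL ≫ H ◁ M.idem ≫ M.actL) ≫ M.coactR ≫ M.pr ▷ H := by
      rw [← hM.actL_coactR_pr]
      monoidal
    _ = _ := by
      rw [hM.coactL_idem_actL, Category.id_comp]

/-- The braiding `l ⊗ m ↦ m₀ ⊗ l m₁` of the crossed modules of invariants. -/
noncomputable def invBraid (L M : HopfBimodData H) : L.invObj ⊗ M.invObj ⟶ M.invObj ⊗ L.invObj :=
  L.invObj ◁ M.invCoact ≫ (α_ L.invObj M.invObj H).inv ≫ (β_ L.invObj M.invObj).hom ▷ H ≫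
    (α_ M.invObj L.invObj H).hom ≫ M.invObj ◁ L.invAct

/-- The morphism `l ⊗ m ↦ m₀ ⊗ l m₁`, for `m` invariant. -/
noncomputable def halfBraid (L M : HopfBimodData H) : L.X ⊗ M.invObj ⟶ M.invObj ⊗ L.X :=
  L.X ◁ M.invCoact ≫ (α_ L.X M.invObj H).inv ≫ (β_ L.X M.invObj).hom ▷ H ≫
    (α_ M.invObj L.X H).hom ≫ M.invObj ◁ L.actR

/-- The morphism `l ⊗ m ↦ m₀ ⊗ l m₁`. -/
def swapAct (L M : HopfBimodData H) : L.X ⊗ M.X ⟶ M.X ⊗ L.X :=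
  L.X ◁ M.coactR ≫ (α_ L.X M.X H).inv ≫ (β_ L.X M.X).hom ▷ H ≫
    (α_ M.X L.X H).hom ≫ M.X ◁ L.actR

/-- On invariants, the braiding of Hopf bimodules is the braiding of crossed modules. -/
theorem IsHopfBimod.inj_braid_pr {L M : HopfBimodData H} (hL : L.IsHopfBimod)
    (hM : M.IsHopfBimod) :
    L.inj ▷ M.invObj ≫ braid L M ≫ M.pr ▷ L.invObj = invBraid L M := by
  change L.inj ▷ M.invObj ≫ ((L.coactL ⊗ₘ (M.inj ≫ M.coactR)) ≫ tensorμ H L.X M.X H ≫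
    (M.actL ⊗ₘ (L.actR ≫ L.pr))) ≫ M.pr ▷ L.invObj = _
  calc
    _ = (L.inj ≫ L.coactL) ▷ M.invObj ⊗≫ (H ⊗ L.X) ◁ (M.inj ≫ M.coactR) ⊗≫
          H ◁ (β_ L.X M.X).hom ▷ H ⊗≫ M.actL ▷ (L.X ⊗ H) ⊗≫
          M.X ◁ (L.actR ≫ L.pr) ⊗≫ M.pr ▷ L.invObj := by
      rw [tensorμ, MonoidalCategory.tensorHom_def, MonoidalCategory.tensorHom_def]
      monoidal
    _ = L.inj ▷ M.invObj ⊗≫ (η[H] ▷ (L.X ⊗ M.invObj) ≫ H ◁ (L.X ◁ (M.inj ≫ M.coactR) ⊗≫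
          (β_ L.X M.X).hom ▷ H)) ⊗≫ M.actL ▷ (L.X ⊗ H) ⊗≫
          M.X ◁ (L.actR ≫ L.pr) ⊗≫ M.pr ▷ L.invObj := by
      rw [hL.inj_coactL]
      monoidal
    _ = (L.inj ▷ M.invObj ≫ L.X ◁ (M.inj ≫ M.coactR)) ⊗≫
          (β_ L.X M.X).hom ▷ H ⊗≫ (η[H] ▷ M.X ≫ M.actL) ▷ (L.X ⊗ H) ⊗≫
          M.X ◁ (L.actR ≫ L.pr) ⊗≫ M.pr ▷ L.invObj := by
      rw [← whisker_exchange]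
      monoidal
    _ = L.invObj ◁ (M.inj ≫ M.coactR) ⊗≫ (L.inj ▷ M.X ≫ (β_ L.X M.X).hom) ▷ H ⊗≫
          (M.X ◁ (L.pr ▷ H ≫ L.invAct) ≫ M.pr ▷ L.invObj) := by
      rw [← whisker_exchange, hM.one_actL, hL.actR_pr]
      monoidal
    _ = L.invObj ◁ (M.inj ≫ M.coactR) ⊗≫ ((β_ L.invObj M.X).hom ≫ M.X ◁ (L.inj ≫ L.pr) ≫
          M.pr ▷ L.invObj) ▷ H ⊗≫ M.invObj ◁ L.invAct := by
      rw [whisker_exchange, BraidedCategory.braiding_naturality_left]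
      have := whisker_exchange M.pr (L.pr ▷ H)
      calc
        _ = L.invObj ◁ (M.inj ≫ M.coactR) ⊗≫ (β_ L.invObj M.X).hom ▷ H ⊗≫
          M.X ◁ L.inj ▷ H ⊗≫ (M.pr ▷ (L.X ⊗ H) ≫ M.invObj ◁ L.pr ▷ H) ⊗≫
          M.invObj ◁ L.invAct := by monoidal
        _ = _ := by
          rw [← this]
          monoidal
    _ = L.invObj ◁ (M.inj ≫ M.coactR) ⊗≫ (L.invObj ◁ M.pr ≫ (β_ L.invObj M.invObj).hom) ▷ H ⊗≫
          M.invObj ◁ L.invAct := by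
      rw [hL.inj_pr, BraidedCategory.braiding_naturality_right]
      monoidal
    _ = _ := by
      rw [invBraid, invCoact]
      monoidal

/-- Under the identification of the invariants of `M ⊗_H N` with `_H M ⊗ _H N`, the exchange of the
middle factors is the braiding of crossed modules. -/
theorem exchange_eq {K L M : HopfBimodData H} (N : HopfBimodData H) (hL : L.IsHopfBimod)
    (hM : M.IsHopfBimod) (hN : N.IsHopfBimod) :
    exchange K L M N =
      (K.X ⊗ L.invObj) ◁ (tensorInj M N ≫ M.pr ▷ N.invObj) ⊗≫
        K.X ◁ invBraid L M ▷ N.invObj ⊗≫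
        (K.X ⊗ M.invObj) ◁ (L.inj ▷ N.invObj ≫ tensorPr L N) := by
  -- `b` is the braiding with domain and codomain spelled out as tensor products in `C`.
  obtain ⟨b, hb⟩ : ∃ b : L.X ⊗ M.invObj ⟶ M.X ⊗ L.invObj, b = braid L M := ⟨_, rfl⟩
  have hb' : L.inj ▷ M.invObj ≫ b ≫ M.pr ▷ L.invObj = invBraid L M := by
    rw [hb]; exact hL.inj_braid_pr hM
  trans ((α_ K.X L.invObj (M.tensor N).invObj).hom ≫
      K.X ◁ (L.inj ▷ (M.tensor N).invObj ≫ tensorPr L (M.tensor N))) ≫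
    (𝟙 K.X ⊗ₘ (tensorInj L (M.tensor N) ≫
      ((L.X ◁ (tensorInj M N ≫ M.pr ▷ N.invObj) ≫ (α_ L.X M.invObj N.invObj).inv) ≫
        (b ⊗ₘ (N.inj ≫ 𝟙 N.X ≫ N.pr)) ≫
        ((α_ M.X L.invObj N.invObj).hom ≫ M.X ◁ (L.inj ▷ N.invObj ≫ tensorPr L N))) ≫
      tensorPr M (L.tensor N))) ≫
    (K.X ◁ (tensorInj M (L.tensor N) ≫ M.pr ▷ (L.tensor N).invObj) ≫
      (α_ K.X M.invObj (L.tensor N).invObj).inv)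
  · rw [hb]
    rfl
  calc
    _ = 𝟙 ((K.X ⊗ L.invObj) ⊗ (M.tensor N).invObj) ⊗≫ K.X ◁ (L.inj ▷ (M.tensor N).invObj ≫
          (tensorPr L (M.tensor N) ≫ tensorInj L (M.tensor N)) ≫
          L.X ◁ (tensorInj M N ≫ M.pr ▷ N.invObj) ⊗≫ b ▷ N.invObj ⊗≫
          M.X ◁ (L.inj ▷ N.invObj ≫ tensorPr L N) ≫
          (tensorPr M (L.tensor N) ≫ tensorInj M (L.tensor N)) ≫
          M.pr ▷ (L.tensor N).invObj) ⊗≫ 𝟙 ((K.X ⊗ M.invObj) ⊗ (L.tensor N).invObj) := by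
      rw [Category.id_comp, hN.inj_pr, tensorHom_id, id_tensorHom]
      monoidal
    _ = 𝟙 ((K.X ⊗ L.invObj) ⊗ (M.tensor N).invObj) ⊗≫
          K.X ◁ (((L.inj ≫ L.idem) ▷ (M.tensor N).invObj ≫
          L.X ◁ (tensorInj M N ≫ M.pr ▷ N.invObj)) ⊗≫ b ▷ N.invObj ⊗≫
          (M.X ◁ (L.inj ▷ N.invObj ≫ tensorPr L N) ≫
          (M.idem ≫ M.pr) ▷ (L.tensor N).invObj)) ⊗≫
          𝟙 ((K.X ⊗ M.invObj) ⊗ (L.tensor N).invObj) := by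
      rw [hL.tensorPr_tensorInj, hM.tensorPr_tensorInj]
      monoidal
    _ = (K.X ⊗ L.invObj) ◁ (tensorInj M N ≫ M.pr ▷ N.invObj) ⊗≫
          K.X ◁ (L.inj ▷ M.invObj ≫ b ≫ M.pr ▷ L.invObj) ▷ N.invObj ⊗≫
          (K.X ⊗ M.invObj) ◁ (L.inj ▷ N.invObj ≫ tensorPr L N) := by
      rw [hL.inj_idem, hM.idem_pr, whisker_exchange M.pr, ← whisker_exchange L.inj]
      monoidal
    _ = _ := by
      rw [hb']

/-- `toTensor` for `M ⊗_H P` is `toTensor` for `M`, once the invariants of `M ⊗_H P` are identified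
with `_H M ⊗ _H P`. -/
theorem toTensor_tensorInj_pr (N : HopfBimodData H) {M : HopfBimodData H} (P : HopfBimodData H)
    (hM : M.IsHopfBimod) :
    toTensor N (M.tensor P) ≫ N.X ◁ (tensorInj M P ≫ M.pr ▷ P.invObj) =
      (α_ N.X M.X P.invObj).inv ≫ toTensor N M ▷ P.invObj ≫ (α_ N.X M.invObj P.invObj).hom := by
  change (N.X ◁ ((M.coactL ▷ P.invObj ≫ (α_ H M.X P.invObj).hom) ≫ H ◁ tensorPr M P) ≫
    (α_ N.X H (M.tensor P).invObj).inv ≫ N.actR ▷ (M.tensor P).invObj) ≫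
    N.X ◁ (tensorInj M P ≫ M.pr ▷ P.invObj) = (α_ N.X M.X P.invObj).inv ≫
    (N.X ◁ (M.coactL ≫ H ◁ M.pr) ≫ (α_ N.X H M.invObj).inv ≫ N.actR ▷ M.invObj) ▷ P.invObj ≫
    (α_ N.X M.invObj P.invObj).hom
  calc
    _ = N.X ◁ (M.coactL ▷ P.invObj ⊗≫ H ◁ tensorPr M P) ⊗≫
          (N.actR ▷ (M.tensor P).invObj ≫ N.X ◁ (tensorInj M P ≫ M.pr ▷ P.invObj)) := by
      monoidal
    _ = N.X ◁ (M.coactL ▷ P.invObj ⊗≫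
          H ◁ ((tensorPr M P ≫ tensorInj M P) ≫ M.pr ▷ P.invObj)) ⊗≫
          N.actR ▷ (M.invObj ⊗ P.invObj) := by
      rw [← whisker_exchange]
      monoidal
    _ = _ := by
      rw [hM.tensorPr_tensorInj, ← comp_whiskerRight, hM.idem_pr]
      monoidal

/-- `ofCotensor` for `M ⊗_H P` is `ofCotensor` for `M`, once the invariants of `M ⊗_H P` are
identified with `_H M ⊗ _H P`. -/
theorem inj_tensorPr_ofCotensor (N : HopfBimodData H) {M : HopfBimodData H} (P : HopfBimodData H)
    (hM : M.IsHopfBimod) :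
    N.X ◁ (M.inj ▷ P.invObj ≫ tensorPr M P) ≫ ofCotensor N (M.tensor P) =
      (α_ N.X M.invObj P.invObj).inv ≫ ofCotensor N M ▷ P.invObj ≫ (α_ N.X M.X P.invObj).hom := by
  change N.X ◁ (M.inj ▷ P.invObj ≫ tensorPr M P) ≫ (N.coactR ▷ (M.tensor P).invObj ≫
    (α_ N.X H (M.tensor P).invObj).hom ≫
    N.X ◁ (H ◁ tensorInj M P ≫ (α_ H M.X P.invObj).inv ≫ M.actL ▷ P.invObj)) =
    (α_ N.X M.invObj P.invObj).inv ≫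
    (N.coactR ▷ M.invObj ≫ (α_ N.X H M.invObj).hom ≫ N.X ◁ (H ◁ M.inj ≫ M.actL)) ▷ P.invObj ≫
    (α_ N.X M.X P.invObj).hom
  calc
    _ = (N.X ◁ (M.inj ▷ P.invObj ≫ tensorPr M P) ≫ N.coactR ▷ (M.tensor P).invObj) ⊗≫
          N.X ◁ (H ◁ tensorInj M P ⊗≫ M.actL ▷ P.invObj) := by
      monoidal
    _ = N.coactR ▷ (M.invObj ⊗ P.invObj) ⊗≫
          N.X ◁ (H ◁ (M.inj ▷ P.invObj ≫ (tensorPr M P ≫ tensorInj M P)) ⊗≫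
            M.actL ▷ P.invObj) := by
      rw [whisker_exchange]
      monoidal
    _ = _ := by
      rw [hM.tensorPr_tensorInj, ← comp_whiskerRight, hM.inj_idem]
      monoidal

end
end HopfBimodData

/-! ### Compatibility of the canonical morphisms with the braidings -/

namespace HopfBimodData
section

open HopfObj

variable {C : Type u} [Category.{v} C] [MonoidalCategory C] [BraidedCategory C]
  [IsIdempotentComplete C] {H : C} [HopfObj H]

/-- The canonical morphism `N ⊗_H M ⟶ N ⊗ M` is right `H`-linear for the diagonal action on the
target. -/
theorem IsHopfBimod.actR_ofCotensor {N M : HopfBimodData H} (hN : N.IsHopfBimod)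
    (hM : M.IsHopfBimod) :
    (N.tensor M).actR ≫ ofCotensor N M =
      ofCotensor N M ▷ H ≫ (N.X ⊗ M.X) ◁ Δ[H] ≫ tensorμ N.X M.X H H ≫ (N.actR ⊗ₘ M.actR) := by
  have hC := hM.inj_actR_idem_actL
  change ((N.X ⊗ M.invObj) ◁ Δ[H] ≫ tensorμ N.X M.invObj H H ≫ (N.actR ⊗ₘ M.invAct)) ≫
    (N.coactR ▷ M.invObj ≫ (α_ N.X H M.invObj).hom ≫ N.X ◁ (H ◁ M.inj ≫ M.actL)) =
    (N.coactR ▷ M.invObj ≫ (α_ N.X H M.invObj).hom ≫ N.X ◁ (H ◁ M.inj ≫ M.actL)) ▷ H ≫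
      (N.X ⊗ M.X) ◁ Δ[H] ≫ tensorμ N.X M.X H H ≫ (N.actR ⊗ₘ M.actR)
  calc
    _ = (N.X ⊗ M.invObj) ◁ Δ[H] ⊗≫ N.X ◁ (β_ M.invObj H).hom ▷ H ⊗≫
          ((N.X ⊗ H) ◁ M.invAct ≫ (N.actR ≫ N.coactR) ▷ M.invObj) ⊗≫
          N.X ◁ (H ◁ M.inj ≫ M.actL) := by
      rw [tensorμ, MonoidalCategory.tensorHom_def']
      monoidal
    _ = (N.X ⊗ M.invObj) ◁ Δ[H] ⊗≫ N.X ◁ (β_ M.invObj H).hom ▷ H ⊗≫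
          ((N.coactR ⊗ₘ Δ[H]) ≫ tensorμ N.X H H H ≫ (N.actR ⊗ₘ μ[H])) ▷ (M.invObj ⊗ H) ⊗≫
          N.X ◁ (H ◁ (M.inj ▷ H ≫ M.actR ≫ (M.pr ≫ M.inj)) ≫ M.actL) := by
      rw [whisker_exchange, hN.actR_coactR]
      nth_rw 1 [invAct]
      monoidal
    _ = (N.X ⊗ M.invObj) ◁ Δ[H] ⊗≫ N.X ◁ (β_ M.invObj H).hom ▷ H ⊗≫
          (N.coactR ▷ H ⊗≫ (N.X ⊗ H) ◁ Δ[H] ⊗≫ N.X ◁ (β_ H H).hom ▷ H ⊗≫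
            N.actR ▷ (H ⊗ H)) ▷ (M.invObj ⊗ H) ⊗≫
          N.X ◁ ((μ[H] ▷ (M.invObj ⊗ H) ≫ H ◁ (M.inj ▷ H ≫ M.actR ≫ M.idem)) ≫ M.actL) := by
      rw [hM.pr_inj, tensorμ, MonoidalCategory.tensorHom_def, MonoidalCategory.tensorHom_def]
      monoidal
    _ = (N.X ⊗ M.invObj) ◁ Δ[H] ⊗≫ N.X ◁ (β_ M.invObj H).hom ▷ H ⊗≫
          (N.coactR ▷ H ⊗≫ (N.X ⊗ H) ◁ Δ[H] ⊗≫ N.X ◁ (β_ H H).hom ▷ H ⊗≫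
            N.actR ▷ (H ⊗ H)) ▷ (M.invObj ⊗ H) ⊗≫
          N.X ◁ ((H ⊗ H) ◁ (M.inj ▷ H ≫ M.actR ≫ M.idem) ≫ (μ[H] ▷ M.X ≫ M.actL)) := by
      rw [← whisker_exchange]
      monoidal
    _ = 𝟙 ((N.X ⊗ M.invObj) ⊗ H) ⊗≫
          (N.X ◁ (M.invObj ◁ Δ[H] ⊗≫ (β_ M.invObj H).hom ▷ H ⊗≫ 𝟙 (H ⊗ M.invObj ⊗ H)) ≫
          N.coactR ▷ (H ⊗ M.invObj ⊗ H)) ⊗≫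
          ((N.X ⊗ H) ◁ Δ[H] ⊗≫ N.X ◁ (β_ H H).hom ▷ H ⊗≫
            N.actR ▷ (H ⊗ H)) ▷ (M.invObj ⊗ H) ⊗≫
          N.X ◁ (H ◁ (H ◁ (M.inj ▷ H ≫ M.actR ≫ M.idem) ≫ M.actL) ≫ M.actL) := by
      rw [hM.mul_actL]
      monoidal
    _ = N.coactR ▷ M.invObj ▷ H ⊗≫ (N.X ⊗ H) ◁ (M.invObj ◁ Δ[H] ⊗≫
          ((β_ M.invObj H).hom ≫ Δ[H] ▷ M.invObj) ▷ H) ⊗≫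
          (N.X ◁ (β_ H H).hom ▷ H ⊗≫ N.actR ▷ (H ⊗ H)) ▷ (M.invObj ⊗ H) ⊗≫
          N.X ◁ (H ◁ (H ◁ (M.inj ▷ H ≫ M.actR ≫ M.idem) ≫ M.actL) ≫ M.actL) := by
      rw [whisker_exchange]
      monoidal
    _ = N.coactR ▷ M.invObj ▷ H ⊗≫ (N.X ⊗ H) ◁ (M.invObj ◁ (Δ[H] ≫ Δ[H] ▷ H) ⊗≫
          (β_ M.invObj H).hom ▷ H ▷ H ⊗≫ H ◁ (β_ M.invObj H).hom ▷ H) ⊗≫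
          (N.X ◁ (β_ H H).hom ▷ H ⊗≫ N.actR ▷ (H ⊗ H)) ▷ (M.invObj ⊗ H) ⊗≫
          N.X ◁ (H ◁ (H ◁ (M.inj ▷ H ≫ M.actR ≫ M.idem) ≫ M.actL) ≫ M.actL) := by
      rw [← BraidedCategory.braiding_naturality_right, BraidedCategory.braiding_tensor_right_hom]
      monoidal
    _ = N.coactR ▷ M.invObj ▷ H ⊗≫ (N.X ⊗ H) ◁ (M.invObj ◁ Δ[H] ⊗≫
          ((M.invObj ⊗ H) ◁ Δ[H] ≫ (β_ M.invObj H).hom ▷ (H ⊗ H)) ⊗≫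
          H ◁ (β_ M.invObj H).hom ▷ H) ⊗≫
          (N.X ◁ (β_ H H).hom ▷ H ⊗≫ N.actR ▷ (H ⊗ H)) ▷ (M.invObj ⊗ H) ⊗≫
          N.X ◁ (H ◁ (H ◁ (M.inj ▷ H ≫ M.actR ≫ M.idem) ≫ M.actL) ≫ M.actL) := by
      rw [ComonObj.comul_assoc_flip]
      monoidal
    _ = N.coactR ▷ M.invObj ▷ H ⊗≫ (N.X ⊗ H) ◁ (M.invObj ◁ Δ[H] ⊗≫
          (β_ M.invObj H).hom ▷ H) ⊗≫
          ((N.X ⊗ H ⊗ H) ◁ (M.invObj ◁ Δ[H] ⊗≫ (β_ M.invObj H).hom ▷ H) ≫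
          (N.X ◁ (β_ H H).hom ⊗≫ N.actR ▷ H) ▷ ((H ⊗ M.invObj) ⊗ H)) ⊗≫
          N.X ◁ (H ◁ (H ◁ (M.inj ▷ H ≫ M.actR ≫ M.idem) ≫ M.actL) ≫ M.actL) := by
      rw [whisker_exchange]
      monoidal
    _ = N.coactR ▷ M.invObj ▷ H ⊗≫ (N.X ⊗ H) ◁ (M.invObj ◁ Δ[H] ⊗≫
          (β_ M.invObj H).hom ▷ H) ⊗≫ (N.X ◁ (β_ H H).hom ⊗≫ N.actR ▷ H) ▷ (M.invObj ⊗ H) ⊗≫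
          N.X ◁ (H ◁ (M.invObj ◁ Δ[H] ≫ (α_ M.invObj H H).inv ≫ (β_ M.invObj H).hom ▷ H ≫
            (α_ H M.invObj H).hom ≫ H ◁ (M.inj ▷ H ≫ M.actR ≫ M.idem) ≫ M.actL) ≫ M.actL) := by
      rw [whisker_exchange]
      monoidal
    _ = N.coactR ▷ M.invObj ▷ H ⊗≫ (N.X ⊗ H ⊗ M.invObj) ◁ Δ[H] ⊗≫
          N.X ◁ (β_ (H ⊗ M.invObj) H).hom ▷ H ⊗≫ N.actR ▷ (H ⊗ M.invObj ⊗ H) ⊗≫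
          N.X ◁ (H ◁ M.inj ▷ H ⊗≫ (H ◁ M.actR ≫ M.actL)) := by
      rw [hC, BraidedCategory.braiding_tensor_left_hom]
      monoidal
    _ = N.coactR ▷ M.invObj ▷ H ⊗≫ (N.X ⊗ H ⊗ M.invObj) ◁ Δ[H] ⊗≫
          N.X ◁ (β_ (H ⊗ M.invObj) H).hom ▷ H ⊗≫ (N.actR ▷ (H ⊗ M.invObj ⊗ H) ≫
          N.X ◁ (H ◁ M.inj ▷ H ⊗≫ M.actL ▷ H)) ⊗≫ N.X ◁ M.actR := by
      have := hM.act_assoc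
      rw [← Iso.inv_comp_eq] at this
      rw [← this]
      monoidal
    _ = N.coactR ▷ M.invObj ▷ H ⊗≫ (N.X ⊗ H ⊗ M.invObj) ◁ Δ[H] ⊗≫
          N.X ◁ ((β_ (H ⊗ M.invObj) H).hom ≫ H ◁ (H ◁ M.inj ≫ M.actL)) ▷ H ⊗≫
          N.actR ▷ (M.X ⊗ H) ⊗≫ N.X ◁ M.actR := by
      rw [← whisker_exchange]
      monoidal
    _ = N.coactR ▷ M.invObj ▷ H ⊗≫ N.X ◁ ((H ⊗ M.invObj) ◁ Δ[H] ≫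
          (H ◁ M.inj ≫ M.actL) ▷ (H ⊗ H)) ⊗≫ N.X ◁ (β_ M.X H).hom ▷ H ⊗≫
          N.actR ▷ (M.X ⊗ H) ⊗≫ N.X ◁ M.actR := by
      rw [← BraidedCategory.braiding_naturality_left]
      monoidal
    _ = _ := by
      rw [whisker_exchange, tensorμ, MonoidalCategory.tensorHom_def]
      monoidal

/-- The canonical morphism `ofCotensor` turns the braiding of the invariants of `L` and `M` into the
morphism `l ⊗ m ↦ m₀ ⊗ l m₁` on all of `L`. -/
theorem invBraid_ofCotensor (K : HopfBimodData H) {L M : HopfBimodData H}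
    (hL : L.IsHopfBimod) (hM : M.IsHopfBimod) :
    K.X ◁ invBraid L M ≫ (α_ K.X M.invObj L.invObj).inv ≫ ofCotensor (K.tensor M) L =
      (α_ K.X L.invObj M.invObj).inv ≫ ofCotensor K L ▷ M.invObj ≫
        (α_ K.X L.X M.invObj).hom ≫ K.X ◁ halfBraid L M ≫ (α_ K.X M.invObj L.X).inv := by
  have hC := hL.inj_actR_idem_actL
  change K.X ◁ invBraid L M ≫ (α_ K.X M.invObj L.invObj).inv ≫
      (((K.coactR ⊗ₘ M.invCoact) ≫ tensorμ K.X H M.invObj H ≫ (K.X ⊗ M.invObj) ◁ μ[H]) ▷ L.invObj ≫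
      (α_ (K.X ⊗ M.invObj) H L.invObj).hom ≫ (K.X ⊗ M.invObj) ◁ (H ◁ L.inj ≫ L.actL)) =
    (α_ K.X L.invObj M.invObj).inv ≫
      (K.coactR ▷ L.invObj ≫ (α_ K.X H L.invObj).hom ≫
        K.X ◁ (H ◁ L.inj ≫ L.actL)) ▷ M.invObj ≫
      (α_ K.X L.X M.invObj).hom ≫ K.X ◁ halfBraid L M ≫ (α_ K.X M.invObj L.X).inv
  calc
    _ = K.X ◁ (L.invObj ◁ M.invCoact ⊗≫ (β_ L.invObj M.invObj).hom ▷ H) ⊗≫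
          ((K.X ⊗ M.invObj) ◁ L.invAct ≫
          ((K.coactR ⊗ₘ M.invCoact) ≫ tensorμ K.X H M.invObj H ≫
            (K.X ⊗ M.invObj) ◁ μ[H]) ▷ L.invObj) ⊗≫
            (K.X ⊗ M.invObj) ◁ (H ◁ L.inj ≫ L.actL) := by
      rw [invBraid]
      monoidal
    _ = K.X ◁ (L.invObj ◁ M.invCoact ⊗≫ (β_ L.invObj M.invObj).hom ▷ H) ⊗≫
          K.coactR ▷ M.invObj ▷ L.invObj ▷ H ⊗≫ (K.X ⊗ H) ◁ M.invCoact ▷ L.invObj ▷ H ⊗≫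
          K.X ◁ (β_ H M.invObj).hom ▷ H ▷ L.invObj ▷ H ⊗≫
            (K.X ⊗ M.invObj) ◁ ((μ[H] ▷ (L.invObj ⊗ H) ≫
              H ◁ (L.inj ▷ H ≫ L.actR ≫ (L.pr ≫ L.inj))) ≫ L.actL) := by
      rw [whisker_exchange, tensorμ, MonoidalCategory.tensorHom_def, invAct]
      monoidal
    _ = K.X ◁ (L.invObj ◁ M.invCoact ⊗≫ (β_ L.invObj M.invObj).hom ▷ H) ⊗≫
          K.coactR ▷ M.invObj ▷ L.invObj ▷ H ⊗≫ (K.X ⊗ H) ◁ M.invCoact ▷ L.invObj ▷ H ⊗≫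
          K.X ◁ (β_ H M.invObj).hom ▷ H ▷ L.invObj ▷ H ⊗≫
            (K.X ⊗ M.invObj) ◁ ((H ⊗ H) ◁ (L.inj ▷ H ≫ L.actR ≫ L.idem) ≫
              (μ[H] ▷ L.X ≫ L.actL)) := by
      rw [← whisker_exchange, hL.pr_inj]
      monoidal
    _ = (K.X ◁ (L.invObj ◁ M.invCoact ⊗≫ (β_ L.invObj M.invObj).hom ▷ H) ≫
          K.coactR ▷ ((M.invObj ⊗ L.invObj) ⊗ H)) ⊗≫
          (K.X ⊗ H) ◁ M.invCoact ▷ L.invObj ▷ H ⊗≫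
          K.X ◁ (β_ H M.invObj).hom ▷ H ▷ L.invObj ▷ H ⊗≫
            (K.X ⊗ M.invObj) ◁ (H ◁ (H ◁ (L.inj ▷ H ≫ L.actR ≫ L.idem) ≫ L.actL) ≫ L.actL) := by
      rw [hL.mul_actL]
      monoidal
    _ = K.coactR ▷ (L.invObj ⊗ M.invObj) ⊗≫
          (K.X ⊗ H) ◁ (L.invObj ◁ M.invCoact ⊗≫
            ((β_ L.invObj M.invObj).hom ≫ M.invCoact ▷ L.invObj) ▷ H) ⊗≫
          K.X ◁ (β_ H M.invObj).hom ▷ H ▷ L.invObj ▷ H ⊗≫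
            (K.X ⊗ M.invObj) ◁ (H ◁ (H ◁ (L.inj ▷ H ≫ L.actR ≫ L.idem) ≫ L.actL) ≫ L.actL) := by
      rw [whisker_exchange]
      monoidal
    _ = K.coactR ▷ (L.invObj ⊗ M.invObj) ⊗≫
          (K.X ⊗ H) ◁ (L.invObj ◁ (M.invCoact ≫ M.invCoact ▷ H) ⊗≫
            (β_ L.invObj M.invObj).hom ▷ H ▷ H ⊗≫ M.invObj ◁ (β_ L.invObj H).hom ▷ H) ⊗≫
          K.X ◁ (β_ H M.invObj).hom ▷ H ▷ L.invObj ▷ H ⊗≫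
            (K.X ⊗ M.invObj) ◁ (H ◁ (H ◁ (L.inj ▷ H ≫ L.actR ≫ L.idem) ≫ L.actL) ≫ L.actL) := by
      rw [← BraidedCategory.braiding_naturality_right, BraidedCategory.braiding_tensor_right_hom]
      monoidal
    _ = K.coactR ▷ (L.invObj ⊗ M.invObj) ⊗≫
          (K.X ⊗ H) ◁ (L.invObj ◁ M.invCoact ⊗≫ ((L.invObj ⊗ M.invObj) ◁ Δ[H] ≫
            (β_ L.invObj M.invObj).hom ▷ (H ⊗ H)) ⊗≫ M.invObj ◁ (β_ L.invObj H).hom ▷ H) ⊗≫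
          K.X ◁ (β_ H M.invObj).hom ▷ H ▷ L.invObj ▷ H ⊗≫
            (K.X ⊗ M.invObj) ◁ (H ◁ (H ◁ (L.inj ▷ H ≫ L.actR ≫ L.idem) ≫ L.actL) ≫ L.actL) := by
      rw [hM.invCoact_comul]
      monoidal
    _ = K.coactR ▷ (L.invObj ⊗ M.invObj) ⊗≫
          (K.X ⊗ H) ◁ (L.invObj ◁ M.invCoact ⊗≫ (β_ L.invObj M.invObj).hom ▷ H) ⊗≫
          K.X ◁ ((H ⊗ M.invObj) ◁ (L.invObj ◁ Δ[H] ⊗≫ (β_ L.invObj H).hom ▷ H) ≫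
          (β_ H M.invObj).hom ▷ ((H ⊗ L.invObj) ⊗ H)) ⊗≫
            (K.X ⊗ M.invObj) ◁ (H ◁ (H ◁ (L.inj ▷ H ≫ L.actR ≫ L.idem) ≫ L.actL) ≫ L.actL) := by
      rw [whisker_exchange]
      monoidal
    _ = K.coactR ▷ (L.invObj ⊗ M.invObj) ⊗≫
          (K.X ⊗ H) ◁ (L.invObj ◁ M.invCoact ⊗≫ (β_ L.invObj M.invObj).hom ▷ H) ⊗≫
          K.X ◁ (β_ H M.invObj).hom ▷ (L.invObj ⊗ H) ⊗≫
            (K.X ⊗ M.invObj) ◁ (H ◁ (L.invObj ◁ Δ[H] ≫ (α_ L.invObj H H).inv ≫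
              (β_ L.invObj H).hom ▷ H ≫ (α_ H L.invObj H).hom ≫
              H ◁ (L.inj ▷ H ≫ L.actR ≫ L.idem) ≫ L.actL) ≫ L.actL) := by
      rw [whisker_exchange]
      monoidal
    _ = K.coactR ▷ (L.invObj ⊗ M.invObj) ⊗≫
          (K.X ⊗ H) ◁ L.invObj ◁ M.invCoact ⊗≫
          K.X ◁ (β_ (H ⊗ L.invObj) M.invObj).hom ▷ H ⊗≫
          (K.X ⊗ M.invObj) ◁ (H ◁ L.inj ▷ H ⊗≫ (H ◁ L.actR ≫ L.actL)) := by
      rw [hC, BraidedCategory.braiding_tensor_left_hom]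
      monoidal
    _ = K.coactR ▷ (L.invObj ⊗ M.invObj) ⊗≫
          (K.X ⊗ H) ◁ L.invObj ◁ M.invCoact ⊗≫
          K.X ◁ ((β_ (H ⊗ L.invObj) M.invObj).hom ≫ M.invObj ◁ (H ◁ L.inj ≫ L.actL)) ▷ H ⊗≫
          (K.X ⊗ M.invObj) ◁ L.actR := by
      have := hL.act_assoc
      rw [← Iso.inv_comp_eq] at this
      rw [← this]
      monoidal
    _ = K.coactR ▷ (L.invObj ⊗ M.invObj) ⊗≫
          K.X ◁ ((H ⊗ L.invObj) ◁ M.invCoact ≫ (H ◁ L.inj ≫ L.actL) ▷ (M.invObj ⊗ H)) ⊗≫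
          K.X ◁ (β_ L.X M.invObj).hom ▷ H ⊗≫
          (K.X ⊗ M.invObj) ◁ L.actR := by
      rw [← BraidedCategory.braiding_naturality_left]
      monoidal
    _ = _ := by
      rw [whisker_exchange, halfBraid]
      monoidal

/-- The compatibility of the two canonical morphisms with the braiding, for three factors. -/
theorem toTensor_invBraid_ofCotensor {K L M : HopfBimodData H} (hK : K.IsHopfBimod)
    (hL : L.IsHopfBimod) (hM : M.IsHopfBimod) :
    toTensor (K.tensor L) M ≫ (α_ K.X L.invObj M.invObj).hom ≫ K.X ◁ invBraid L M ≫
        (α_ K.X M.invObj L.invObj).inv ≫ ofCotensor (K.tensor M) L =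
      ofCotensor K L ▷ M.X ≫ (α_ K.X L.X M.X).hom ≫ K.X ◁ swapAct L M ≫
        (α_ K.X M.X L.X).inv ≫ toTensor K M ▷ L.X := by
  -- `a` and `r` are the two morphisms with domains and codomains spelled out as tensor products
  -- in `C`, the form that `monoidal` recognizes.
  obtain ⟨a, ha⟩ : ∃ a : (K.X ⊗ L.invObj) ⊗ H ⟶ K.X ⊗ L.invObj, a = (K.tensor L).actR :=
    ⟨_, rfl⟩
  obtain ⟨r, hr⟩ : ∃ r : K.X ⊗ L.invObj ⟶ K.X ⊗ L.X, r = ofCotensor K L := ⟨_, rfl⟩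
  have e : a ≫ r = r ▷ H ≫ (K.X ⊗ L.X) ◁ Δ[H] ≫ tensorμ K.X L.X H H ≫ (K.actR ⊗ₘ L.actR) := by
    rw [ha, hr]; exact hK.actR_ofCotensor hL
  have hp : M.pr ≫ M.invCoact = M.idem ≫ M.coactR ≫ M.pr ▷ H := by
    rw [invCoact, reassoc_of% hM.pr_inj]
  have hC := hM.coactL_idem_coactR
  refine Eq.trans (b := r ▷ M.X ≫ (α_ K.X L.X M.X).hom ≫ K.X ◁ swapAct L M ≫ (α_ K.X M.X L.X).inv ≫
    (K.X ◁ (M.coactL ≫ H ◁ M.pr) ≫ (α_ K.X H M.invObj).inv ≫ K.actR ▷ M.invObj) ▷ L.X)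
    ?_ (by rw [hr]; rfl)
  refine Eq.trans (b := ((K.X ⊗ L.invObj) ◁ (M.coactL ≫ H ◁ M.pr) ≫
    (α_ (K.X ⊗ L.invObj) H M.invObj).inv ≫
    a ▷ M.invObj) ≫ r ▷ M.invObj ≫ (α_ K.X L.X M.invObj).hom ≫ K.X ◁ halfBraid L M ≫
    (α_ K.X M.invObj L.X).inv) ?_ ?_
  · have h1 := invBraid_ofCotensor K hL hM
    rw [hr, ha]
    refine (congrArg (fun x => toTensor (K.tensor L) M ≫ (α_ K.X L.invObj M.invObj).hom ≫ x)
      h1).trans ?_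
    exact congrArg (toTensor (K.tensor L) M ≫ ·) (Iso.hom_inv_id_assoc _ _)
  calc
    _ = (K.X ⊗ L.invObj) ◁ (M.coactL ≫ H ◁ M.pr) ⊗≫ (a ≫ r) ▷ M.invObj ⊗≫
          K.X ◁ halfBraid L M ⊗≫ 𝟙 ((K.X ⊗ M.invObj) ⊗ L.X) := by
      monoidal
    _ = ((K.X ⊗ L.invObj) ◁ (M.coactL ≫ H ◁ M.pr) ≫ r ▷ (H ⊗ M.invObj)) ⊗≫
          (K.X ⊗ L.X) ◁ Δ[H] ▷ M.invObj ⊗≫ K.X ◁ (β_ L.X H).hom ▷ H ▷ M.invObj ⊗≫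
          K.actR ▷ (L.X ⊗ H ⊗ M.invObj) ⊗≫
          K.X ◁ (L.actR ▷ M.invObj ≫ L.X ◁ M.invCoact) ⊗≫ K.X ◁ (β_ L.X M.invObj).hom ▷ H ⊗≫
          K.X ◁ M.invObj ◁ L.actR ⊗≫ 𝟙 ((K.X ⊗ M.invObj) ⊗ L.X) := by
      rw [e, tensorμ, MonoidalCategory.tensorHom_def, halfBraid]
      monoidal
    _ = r ▷ M.X ⊗≫ (K.X ⊗ L.X) ◁ (M.coactL ≫ H ◁ M.pr ≫ Δ[H] ▷ M.invObj) ⊗≫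
          K.X ◁ (β_ L.X H).hom ▷ H ▷ M.invObj ⊗≫ K.actR ▷ (L.X ⊗ H ⊗ M.invObj) ⊗≫
          K.X ◁ (L.X ⊗ H) ◁ M.invCoact ⊗≫
          K.X ◁ (L.actR ▷ M.invObj ≫ (β_ L.X M.invObj).hom) ▷ H ⊗≫
          K.X ◁ M.invObj ◁ L.actR ⊗≫ 𝟙 ((K.X ⊗ M.invObj) ⊗ L.X) := by
      rw [whisker_exchange, ← whisker_exchange L.actR]
      monoidal
    _ = r ▷ M.X ⊗≫ (K.X ⊗ L.X) ◁ (M.coactL ≫ (H ◁ M.pr ≫ Δ[H] ▷ M.invObj)) ⊗≫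
          K.X ◁ (β_ L.X H).hom ▷ H ▷ M.invObj ⊗≫ K.actR ▷ (L.X ⊗ H ⊗ M.invObj) ⊗≫
          K.X ◁ (L.X ⊗ H) ◁ M.invCoact ⊗≫
          K.X ◁ (L.X ◁ (β_ H M.invObj).hom ⊗≫ (β_ L.X M.invObj).hom ▷ H) ▷ H ⊗≫
          K.X ◁ M.invObj ◁ (L.actR ▷ H ≫ L.actR) ⊗≫ 𝟙 ((K.X ⊗ M.invObj) ⊗ L.X) := by
      rw [BraidedCategory.braiding_naturality_left, BraidedCategory.braiding_tensor_left_hom]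
      monoidal
    _ = r ▷ M.X ⊗≫ (K.X ⊗ L.X) ◁ ((M.coactL ≫ Δ[H] ▷ M.X) ≫ (H ⊗ H) ◁ M.pr) ⊗≫
          (K.X ◁ (β_ L.X H).hom ⊗≫ K.actR ▷ L.X) ▷ (H ⊗ M.invObj) ⊗≫
          K.X ◁ L.X ◁ (H ◁ M.invCoact ⊗≫ (β_ H M.invObj).hom ▷ H) ⊗≫
          (K.X ◁ (β_ L.X M.invObj).hom) ▷ (H ⊗ H) ⊗≫
          K.X ◁ M.invObj ◁ (L.X ◁ μ[H] ≫ L.actR) ⊗≫ 𝟙 ((K.X ⊗ M.invObj) ⊗ L.X) := by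
      rw [whisker_exchange, hL.actR_mul]
      monoidal
    _ = r ▷ M.X ⊗≫ (K.X ⊗ L.X) ◁ (M.coactL ≫ H ◁ (M.coactL ≫ H ◁ M.pr)) ⊗≫
          ((K.X ◁ (β_ L.X H).hom ⊗≫ K.actR ▷ L.X) ▷ (H ⊗ M.invObj) ≫
          (K.X ⊗ L.X) ◁ (H ◁ M.invCoact ⊗≫ (β_ H M.invObj).hom ▷ H)) ⊗≫
          (K.X ◁ ((β_ L.X M.invObj).hom ▷ (H ⊗ H) ≫ (M.invObj ⊗ L.X) ◁ μ[H])) ⊗≫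
          K.X ◁ M.invObj ◁ L.actR ⊗≫ 𝟙 ((K.X ⊗ M.invObj) ⊗ L.X) := by
      rw [hM.coactL_comul]
      monoidal
    _ = r ▷ M.X ⊗≫ (K.X ⊗ L.X) ◁ (M.coactL ≫ H ◁ (M.coactL ≫ H ◁ (M.pr ≫ M.invCoact) ⊗≫
          (β_ H M.invObj).hom ▷ H)) ⊗≫
          ((K.X ◁ (β_ L.X H).hom ⊗≫ K.actR ▷ L.X) ▷ ((M.invObj ⊗ H) ⊗ H) ≫
          (K.X ⊗ L.X) ◁ ((α_ M.invObj H H).hom ≫ M.invObj ◁ μ[H])) ⊗≫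
          K.X ◁ (β_ L.X M.invObj).hom ▷ H ⊗≫
          K.X ◁ M.invObj ◁ L.actR ⊗≫ 𝟙 ((K.X ⊗ M.invObj) ⊗ L.X) := by
      rw [← whisker_exchange, ← whisker_exchange]
      monoidal
    _ = r ▷ M.X ⊗≫ (K.X ⊗ L.X) ◁ (M.coactL ≫ H ◁ (M.coactL ≫
          H ◁ (M.idem ≫ M.coactR ≫ M.pr ▷ H) ≫ (α_ H M.invObj H).inv ≫
          (β_ H M.invObj).hom ▷ H ≫ (α_ M.invObj H H).hom ≫ M.invObj ◁ μ[H])) ⊗≫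
          (K.X ◁ (β_ L.X H).hom ⊗≫ K.actR ▷ L.X) ▷ (M.invObj ⊗ H) ⊗≫
          K.X ◁ (β_ L.X M.invObj).hom ▷ H ⊗≫
          K.X ◁ M.invObj ◁ L.actR ⊗≫ 𝟙 ((K.X ⊗ M.invObj) ⊗ L.X) := by
      rw [← whisker_exchange, hp]
      monoidal
    _ = r ▷ M.X ⊗≫ (K.X ⊗ L.X) ◁ ((M.coactL ≫ H ◁ M.coactR ≫ (α_ H M.X H).inv) ≫
          (H ◁ M.pr) ▷ H) ⊗≫
          (K.X ◁ (β_ L.X H).hom ⊗≫ K.actR ▷ L.X) ▷ (M.invObj ⊗ H) ⊗≫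
          K.X ◁ (β_ L.X M.invObj).hom ▷ H ⊗≫
          K.X ◁ M.invObj ◁ L.actR ⊗≫ 𝟙 ((K.X ⊗ M.invObj) ⊗ L.X) := by
      rw [hC]
      monoidal
    _ = r ▷ M.X ⊗≫ (K.X ⊗ L.X) ◁ (M.coactR ≫ (M.coactL ≫ H ◁ M.pr) ▷ H) ⊗≫
          K.X ◁ (β_ L.X H).hom ▷ (M.invObj ⊗ H) ⊗≫ (K.actR ▷ (L.X ⊗ M.invObj) ≫
          K.X ◁ (β_ L.X M.invObj).hom) ▷ H ⊗≫
          K.X ◁ M.invObj ◁ L.actR ⊗≫ 𝟙 ((K.X ⊗ M.invObj) ⊗ L.X) := by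
      rw [← hM.coact_assoc]
      monoidal
    _ = r ▷ M.X ⊗≫ (K.X ⊗ L.X) ◁ M.coactR ⊗≫
          K.X ◁ (L.X ◁ (M.coactL ≫ H ◁ M.pr) ≫ (β_ L.X (H ⊗ M.invObj)).hom) ▷ H ⊗≫
          (K.actR ▷ (M.invObj ⊗ L.X ⊗ H) ≫ K.X ◁ (M.invObj ◁ L.actR)) ⊗≫
          𝟙 ((K.X ⊗ M.invObj) ⊗ L.X) := by
      rw [← whisker_exchange, BraidedCategory.braiding_tensor_right_hom]
      monoidal
    _ = r ▷ M.X ⊗≫ (K.X ⊗ L.X) ◁ M.coactR ⊗≫ K.X ◁ (β_ L.X M.X).hom ▷ H ⊗≫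
          K.X ◁ ((M.coactL ≫ H ◁ M.pr) ▷ (L.X ⊗ H) ≫ (H ⊗ M.invObj) ◁ L.actR) ⊗≫
          K.actR ▷ (M.invObj ⊗ L.X) ⊗≫ 𝟙 ((K.X ⊗ M.invObj) ⊗ L.X) := by
      rw [BraidedCategory.braiding_naturality_right, ← whisker_exchange]
      monoidal
    _ = _ := by
      rw [← whisker_exchange, swapAct]
      monoidal

end
end HopfBimodData

namespace HopfBimodData
section

open HopfObj

variable {C : Type u} [Category.{v} C] [MonoidalCategory C] [BraidedCategory C]
  [IsIdempotentComplete C] {H : C} [HopfObj H]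

/-- The canonical morphisms to and from the tensor product over `H` intertwine the braiding of `C`
with the exchange of the middle factors over `H`. -/
theorem toTensor_exchange_ofCotensor {K L M N : HopfBimodData H} (hK : K.IsHopfBimod)
    (hL : L.IsHopfBimod) (hM : M.IsHopfBimod) (hN : N.IsHopfBimod) :
    toTensor (K.tensor L) (M.tensor N) ≫ exchange K L M N ≫ ofCotensor (K.tensor M) (L.tensor N) =
      (ofCotensor K L ⊗ₘ ofCotensor M N) ≫ tensorμ K.X L.X M.X N.X ≫
        (toTensor K M ⊗ₘ toTensor L N) := by
  have key : toTensor (K.tensor L) M ≫ (α_ K.X L.invObj M.invObj).hom ≫ K.X ◁ invBraid L M ≫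
        (α_ K.X M.invObj L.invObj).inv ≫ ofCotensor (K.tensor M) L =
      ofCotensor K L ▷ M.X ≫ (α_ K.X L.X M.X).hom ≫ K.X ◁ swapAct L M ≫
        (α_ K.X M.X L.X).inv ≫ toTensor K M ▷ L.X := toTensor_invBraid_ofCotensor hK hL hM
  have h1 := toTensor_tensorInj_pr (K.tensor L) N hM
  have h2 := inj_tensorPr_ofCotensor (K.tensor M) N hL
  have h3 := hN.inj_actL_coactL_pr
  rw [exchange_eq N hL hM hN]
  -- The canonical morphisms with domains and codomains spelled out as tensor products in `C`, the
  -- form that `monoidal` recognizes.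
  obtain ⟨t, ht⟩ : ∃ t : (K.X ⊗ L.invObj) ⊗ (M.X ⊗ N.invObj) ⟶
    (K.X ⊗ L.invObj) ⊗ (M.tensor N).invObj, t = toTensor (K.tensor L) (M.tensor N) := ⟨_, rfl⟩
  obtain ⟨s, hs⟩ : ∃ s : (K.X ⊗ M.invObj) ⊗ (L.tensor N).invObj ⟶
    (K.X ⊗ M.invObj) ⊗ (L.X ⊗ N.invObj), s = ofCotensor (K.tensor M) (L.tensor N) := ⟨_, rfl⟩
  obtain ⟨t', ht'⟩ : ∃ t' : (K.X ⊗ L.invObj) ⊗ M.X ⟶ (K.X ⊗ L.invObj) ⊗ M.invObj,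
    t' = toTensor (K.tensor L) M := ⟨_, rfl⟩
  obtain ⟨s', hs'⟩ : ∃ s' : (K.X ⊗ M.invObj) ⊗ L.invObj ⟶ (K.X ⊗ M.invObj) ⊗ L.X,
    s' = ofCotensor (K.tensor M) L := ⟨_, rfl⟩
  obtain ⟨r, hr⟩ : ∃ r : K.X ⊗ L.invObj ⟶ K.X ⊗ L.X, r = ofCotensor K L := ⟨_, rfl⟩
  obtain ⟨l, hl⟩ : ∃ l : K.X ⊗ M.X ⟶ K.X ⊗ M.invObj, l = toTensor K M := ⟨_, rfl⟩
  replace h1 : t ≫ (K.X ⊗ L.invObj) ◁ (tensorInj M N ≫ M.pr ▷ N.invObj) =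
      (α_ (K.X ⊗ L.invObj) M.X N.invObj).inv ≫ t' ▷ N.invObj ≫
        (α_ (K.X ⊗ L.invObj) M.invObj N.invObj).hom := by
    rw [ht, ht']; exact h1
  replace h2 : (K.X ⊗ M.invObj) ◁ (L.inj ▷ N.invObj ≫ tensorPr L N) ≫ s =
      (α_ (K.X ⊗ M.invObj) L.invObj N.invObj).inv ≫ s' ▷ N.invObj ≫
        (α_ (K.X ⊗ M.invObj) L.X N.invObj).hom := by
    rw [hs, hs']; exact h2
  replace key : t' ≫ (α_ K.X L.invObj M.invObj).hom ≫ K.X ◁ invBraid L M ≫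
        (α_ K.X M.invObj L.invObj).inv ≫ s' =
      r ▷ M.X ≫ (α_ K.X L.X M.X).hom ≫ K.X ◁ swapAct L M ≫
        (α_ K.X M.X L.X).inv ≫ l ▷ L.X := by
    rw [ht', hs', hr, hl]; exact key
  refine Eq.trans (b := t ≫ ((K.X ⊗ L.invObj) ◁ (tensorInj M N ≫ M.pr ▷ N.invObj) ⊗≫
        K.X ◁ invBraid L M ▷ N.invObj ⊗≫
        (K.X ⊗ M.invObj) ◁ (L.inj ▷ N.invObj ≫ tensorPr L N)) ≫ s)
    (by rw [ht, hs]; rfl) ?_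
  refine Eq.trans (b := (r ⊗ₘ
      (M.coactR ▷ N.invObj ≫ (α_ M.X H N.invObj).hom ≫ M.X ◁ (H ◁ N.inj ≫ N.actL))) ≫
      tensorμ K.X L.X M.X N.X ≫
      (l ⊗ₘ (L.X ◁ (N.coactL ≫ H ◁ N.pr) ≫ (α_ L.X H N.invObj).inv ≫ L.actR ▷ N.invObj)))
    ?_ (by rw [hr, hl]; rfl)
  calc
    _ = (t ≫ (K.X ⊗ L.invObj) ◁ (tensorInj M N ≫ M.pr ▷ N.invObj)) ⊗≫
        K.X ◁ invBraid L M ▷ N.invObj ⊗≫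
        ((K.X ⊗ M.invObj) ◁ (L.inj ▷ N.invObj ≫ tensorPr L N) ≫ s) := by
      monoidal
    _ = 𝟙 ((K.X ⊗ L.invObj) ⊗ (M.X ⊗ N.invObj)) ⊗≫
          (t' ≫ (α_ K.X L.invObj M.invObj).hom ≫ K.X ◁ invBraid L M ≫
          (α_ K.X M.invObj L.invObj).inv ≫ s') ▷ N.invObj ⊗≫
          𝟙 ((K.X ⊗ M.invObj) ⊗ (L.X ⊗ N.invObj)) := by
      rw [h1, h2]
      monoidal
    _ = r ▷ (M.X ⊗ N.invObj) ⊗≫ (K.X ⊗ L.X) ◁ M.coactR ▷ N.invObj ⊗≫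
          K.X ◁ (β_ L.X M.X).hom ▷ (H ⊗ N.invObj) ⊗≫
          ((K.X ⊗ M.X) ◁ (L.actR ▷ N.invObj) ≫ l ▷ (L.X ⊗ N.invObj)) := by
      rw [key, swapAct]
      monoidal
    -- The fourth factor enters by inserting the identity `H ⊗ _H N ⟶ N ⟶ H ⊗ _H N`.
    _ = r ▷ (M.X ⊗ N.invObj) ⊗≫ (K.X ⊗ L.X) ◁ M.coactR ▷ N.invObj ⊗≫
          K.X ◁ ((β_ L.X M.X).hom ▷ (H ⊗ N.invObj) ≫
            (M.X ⊗ L.X) ◁ (H ◁ N.inj ≫ N.actL ≫ N.coactL ≫ H ◁ N.pr)) ⊗≫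
          l ▷ ((L.X ⊗ H) ⊗ N.invObj) ⊗≫ K.X ◁ M.invObj ◁ L.actR ▷ N.invObj ⊗≫
          𝟙 ((K.X ⊗ M.invObj) ⊗ (L.X ⊗ N.invObj)) := by
      rw [h3, whisker_exchange]
      monoidal
    _ = r ▷ (M.X ⊗ N.invObj) ⊗≫ (K.X ⊗ L.X) ◁ M.coactR ▷ N.invObj ⊗≫
          (K.X ⊗ L.X) ◁ M.X ◁ (H ◁ N.inj ≫ N.actL) ⊗≫
          K.X ◁ (((L.X ⊗ M.X) ◁ (N.coactL ≫ H ◁ N.pr) ≫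
            (β_ L.X M.X).hom ▷ (H ⊗ N.invObj))) ⊗≫
          l ▷ ((L.X ⊗ H) ⊗ N.invObj) ⊗≫ K.X ◁ M.invObj ◁ L.actR ▷ N.invObj ⊗≫
          𝟙 ((K.X ⊗ M.invObj) ⊗ (L.X ⊗ N.invObj)) := by
      rw [← whisker_exchange]
      monoidal
    _ = r ▷ (M.X ⊗ N.invObj) ⊗≫ (K.X ⊗ L.X) ◁ M.coactR ▷ N.invObj ⊗≫
          (K.X ⊗ L.X) ◁ M.X ◁ (H ◁ N.inj ≫ N.actL) ⊗≫
          K.X ◁ (β_ L.X M.X).hom ▷ N.X ⊗≫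
          ((K.X ⊗ M.X) ◁ L.X ◁ (N.coactL ≫ H ◁ N.pr) ≫ l ▷ (L.X ⊗ H ⊗ N.invObj)) ⊗≫
          K.X ◁ M.invObj ◁ L.actR ▷ N.invObj ⊗≫
          𝟙 ((K.X ⊗ M.invObj) ⊗ (L.X ⊗ N.invObj)) := by
      rw [whisker_exchange]
      monoidal
    _ = _ := by
      rw [whisker_exchange, tensorμ, MonoidalCategory.tensorHom_def,
        MonoidalCategory.tensorHom_def]
      monoidal

end
end HopfBimodData

/-! ### From bialgebras of Hopf bimodules to bialgebra projections -/

namespace HopfBimodBialgData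
section

open HopfBimodData

variable {C : Type u} [Category.{v} C] [MonoidalCategory C] [BraidedCategory C]
  [IsIdempotentComplete C] {H : C} [HopfObj H] {B : HopfBimodBialgData H}

/-- The left action on a bialgebra over `H` is multiplication by the image of `H` under the unit. -/
theorem IsBialg.one_toTensor_mul (hB : B.IsBialg) :
    B.one ▷ B.base.X ≫ toTensor B.base B.base ≫ B.mul = B.base.actL := by
  have h : B.one ▷ B.base.X ≫ toTensor B.base B.base = toTensor (regular H) B.base ≫
      tensorMap (regular H) B.base B.base B.base B.one (𝟙 B.base.X) :=
    (congrArg (· ≫ toTensor B.base B.base) (tensorHom_id B.one B.base.X).symm).trans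
      (toTensor_naturality hB.one_hom (IsHom.id B.base) hB.isHopfBimod.idem_idem
        hB.isHopfBimod.idem_idem).symm
  exact (Category.assoc _ _ _).symm.trans ((congrArg (· ≫ B.mul) h).trans
    ((Category.assoc _ _ _).trans ((congrArg (toTensor (regular H) B.base ≫ ·) hB.one_mul).trans
      hB.isHopfBimod.toTensor_leftUnitHom)))

/-- The right action on a bialgebra over `H` is multiplication by the image of `H` under the
unit. -/
theorem IsBialg.toTensor_mul_one (hB : B.IsBialg) :
    B.base.X ◁ B.one ≫ toTensor B.base B.base ≫ B.mul = B.base.actR := by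
  have h : B.base.X ◁ B.one ≫ toTensor B.base B.base = toTensor B.base (regular H) ≫
      tensorMap B.base B.base (regular H) B.base (𝟙 B.base.X) B.one :=
    (congrArg (· ≫ toTensor B.base B.base) (id_tensorHom B.base.X B.one).symm).trans
      (toTensor_naturality (IsHom.id B.base) hB.one_hom isHopfBimod_regular.idem_idem
        hB.isHopfBimod.idem_idem).symm
  exact (Category.assoc _ _ _).symm.trans ((congrArg (· ≫ B.mul) h).trans
    ((Category.assoc _ _ _).trans ((congrArg (toTensor B.base (regular H) ≫ ·) hB.mul_one).trans
      (toTensor_rightUnitHom _))))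

/-- The left coaction on a bialgebra over `H` is the comultiplication followed by the counit to `H`
in the first factor. -/
theorem IsBialg.comul_ofCotensor_counit (hB : B.IsBialg) :
    B.comul ≫ ofCotensor B.base B.base ≫ B.counit ▷ B.base.X = B.base.coactL := by
  have h : ofCotensor B.base B.base ≫ B.counit ▷ B.base.X =
      tensorMap B.base (regular H) B.base B.base B.counit (𝟙 B.base.X) ≫
        leftUnitHom B.base ≫ B.base.coactL :=
    (congrArg (ofCotensor B.base B.base ≫ ·) (tensorHom_id B.counit B.base.X).symm).trans
      ((ofCotensor_naturality hB.counit_hom (IsHom.id B.base) hB.isHopfBimod.idem_idem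
        hB.isHopfBimod.idem_idem).symm.trans
          (congrArg (_ ≫ ·) hB.isHopfBimod.leftUnitHom_coactL.symm))
  rw [h]
  exact (by simp only [Category.assoc] : _ = (_ ≫ _ ≫ _) ≫ _).trans
    ((congrArg (· ≫ B.base.coactL) hB.counit_comul).trans (Category.id_comp _))

/-- The right coaction on a bialgebra over `H` is the comultiplication followed by the counit to `H`
in the second factor. -/
theorem IsBialg.comul_ofCotensor_counit' (hB : B.IsBialg) :
    B.comul ≫ ofCotensor B.base B.base ≫ B.base.X ◁ B.counit = B.base.coactR := by
  have h : ofCotensor B.base B.base ≫ B.base.X ◁ B.counit =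
      tensorMap B.base B.base B.base (regular H) (𝟙 B.base.X) B.counit ≫
        rightUnitHom B.base ≫ B.base.coactR :=
    (congrArg (ofCotensor B.base B.base ≫ ·) (id_tensorHom B.base.X B.counit).symm).trans
      ((ofCotensor_naturality (IsHom.id B.base) hB.counit_hom hB.isHopfBimod.idem_idem
        isHopfBimod_regular.idem_idem).symm.trans
          (congrArg (_ ≫ ·) (rightUnitHom_coactR _).symm))
  rw [h]
  exact (by simp only [Category.assoc] : _ = (_ ≫ _ ≫ _) ≫ _).trans
    ((congrArg (· ≫ B.base.coactR) hB.comul_counit).trans (Category.id_comp _))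

theorem IsBialg.toTensor_mul_assoc (hB : B.IsBialg) :
    (toTensor B.base B.base ≫ B.mul) ▷ B.base.X ≫ toTensor B.base B.base ≫ B.mul =
      (α_ B.base.X B.base.X B.base.X).hom ≫ B.base.X ◁ (toTensor B.base B.base ≫ B.mul) ≫
        toTensor B.base B.base ≫ B.mul := by
  have hX := hB.isHopfBimod
  have h1 := toTensor_naturality hB.mul_hom (IsHom.id B.base) hX.idem_idem hX.idem_idem
  have h2 := toTensor_naturality (IsHom.id B.base) hB.mul_hom (hX.tensor_idem_idem _) hX.idem_idem
  rw [tensorHom_id] at h1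
  rw [id_tensorHom] at h2
  rw [comp_whiskerRight, Category.assoc, ← reassoc_of% h1, hB.mul_assoc,
    reassoc_of% toTensor_assoc hX hX, reassoc_of% h2, whiskerLeft_comp, Category.assoc]

theorem IsBialg.comul_ofCotensor_assoc (hB : B.IsBialg) :
    (B.comul ≫ ofCotensor B.base B.base) ≫ (B.comul ≫ ofCotensor B.base B.base) ▷ B.base.X ≫
        (α_ B.base.X B.base.X B.base.X).hom =
      (B.comul ≫ ofCotensor B.base B.base) ≫
        B.base.X ◁ (B.comul ≫ ofCotensor B.base B.base) := by
  have hX := hB.isHopfBimod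
  have h1 := ofCotensor_naturality hB.comul_hom (IsHom.id B.base) hX.idem_idem hX.idem_idem
  have h2 := ofCotensor_naturality (IsHom.id B.base) hB.comul_hom hX.idem_idem
    (hX.tensor_idem_idem _)
  rw [tensorHom_id] at h1
  rw [id_tensorHom] at h2
  rw [comp_whiskerRight, Category.assoc, Category.assoc, ← reassoc_of% h1,
    ofCotensor_assoc hX hX, reassoc_of% hB.comul_assoc, whiskerLeft_comp, Category.assoc,
    ← reassoc_of% h2]

theorem IsBialg.toTensor_mul_comul (hB : B.IsBialg) :
    (toTensor B.base B.base ≫ B.mul) ≫ B.comul ≫ ofCotensor B.base B.base =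
      ((B.comul ≫ ofCotensor B.base B.base) ⊗ₘ (B.comul ≫ ofCotensor B.base B.base)) ≫
        tensorμ B.base.X B.base.X B.base.X B.base.X ≫
        ((toTensor B.base B.base ≫ B.mul) ⊗ₘ (toTensor B.base B.base ≫ B.mul)) := by
  have hX := hB.isHopfBimod
  have h1 := toTensor_naturality hB.comul_hom hB.comul_hom hX.idem_idem (hX.tensor_idem_idem _)
  have h2 := ofCotensor_naturality hB.mul_hom hB.mul_hom (hX.tensor_idem_idem _) hX.idem_idem
  have h3 := toTensor_exchange_ofCotensor hX hX hX hX
  rw [Category.assoc, reassoc_of% hB.mul_comul, reassoc_of% h1, h2, reassoc_of% h3,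
    tensorHom_comp_tensorHom, tensorHom_comp_tensorHom_assoc]

theorem IsBialg.one_comul_ofCotensor (hB : B.IsBialg) :
    B.one ≫ B.comul ≫ ofCotensor B.base B.base = Δ[H] ≫ (B.one ⊗ₘ B.one) := by
  have h := ofCotensor_naturality hB.one_hom hB.one_hom isHopfBimod_regular.idem_idem
    hB.isHopfBimod.idem_idem
  have h1 : leftUnitInv (regular H) ≫ ofCotensor (regular H) (regular H) = Δ[H] :=
    leftUnitInv_ofCotensor
  exact (Category.assoc _ _ _).symm.trans
    ((congrArg (· ≫ ofCotensor B.base B.base) hB.one_comul).trans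
    ((Category.assoc _ _ _).trans ((congrArg (leftUnitInv (regular H) ≫ ·) h).trans
    ((Category.assoc _ _ _).symm.trans (congrArg (· ≫ (B.one ⊗ₘ B.one)) h1)))))

theorem IsBialg.toTensor_mul_counit (hB : B.IsBialg) :
    (toTensor B.base B.base ≫ B.mul) ≫ B.counit = (B.counit ⊗ₘ B.counit) ≫ μ[H] := by
  have h := toTensor_naturality hB.counit_hom hB.counit_hom hB.isHopfBimod.idem_idem
    isHopfBimod_regular.idem_idem
  exact (Category.assoc _ _ _).trans
    ((congrArg (toTensor B.base B.base ≫ ·) hB.mul_counit).trans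
    ((Category.assoc _ _ _).symm.trans ((congrArg (· ≫ leftUnitHom (regular H)) h).trans
    ((Category.assoc _ _ _).trans (congrArg ((B.counit ⊗ₘ B.counit) ≫ ·)
      isHopfBimod_regular.toTensor_leftUnitHom)))))

/-- The bialgebra in `C` underlying a bialgebra of Hopf bimodules. -/
noncomputable abbrev IsBialg.bimonObj (hB : B.IsBialg) : BimonObj B.base.X where
  one := η[H] ≫ B.one
  mul := toTensor B.base B.base ≫ B.mul
  counit := B.counit ≫ ε[H]
  comul := B.comul ≫ ofCotensor B.base B.base
  one_mul := by
    rw [comp_whiskerRight, Category.assoc, hB.one_toTensor_mul, hB.isHopfBimod.one_actL]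
  mul_one := by
    rw [whiskerLeft_comp, Category.assoc, hB.toTensor_mul_one, hB.isHopfBimod.actR_one]
  mul_assoc := hB.toTensor_mul_assoc
  counit_comul := by
    rw [comp_whiskerRight, Category.assoc, reassoc_of% hB.comul_ofCotensor_counit,
      hB.isHopfBimod.coactL_counit]
  comul_counit := by
    rw [whiskerLeft_comp, Category.assoc, reassoc_of% hB.comul_ofCotensor_counit',
      hB.isHopfBimod.coactR_counit]
  comul_assoc := hB.comul_ofCotensor_assoc.symm
  mul_comul := hB.toTensor_mul_comul
  one_comul := by
    change (η[H] ≫ B.one) ≫ B.comul ≫ ofCotensor B.base B.base =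
      (λ_ (𝟙_ C)).inv ≫ ((η[H] ≫ B.one) ⊗ₘ (η[H] ≫ B.one))
    rw [Category.assoc, hB.one_comul_ofCotensor, Bimon.one_comul_assoc,
      tensorHom_comp_tensorHom]
  mul_counit := by
    change (toTensor B.base B.base ≫ B.mul) ≫ B.counit ≫ ε[H] =
      ((B.counit ≫ ε[H]) ⊗ₘ (B.counit ≫ ε[H])) ≫ (λ_ (𝟙_ C)).hom
    rw [← Category.assoc, hB.toTensor_mul_counit, Category.assoc, Bimon.mul_counit,
      tensorHom_comp_tensorHom_assoc]
  one_counit := by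
    rw [Category.assoc, reassoc_of% hB.one_counit, BimonObj.one_counit]

end
end HopfBimodBialgData

namespace HopfBimodBialg
section

open HopfBimodData

variable {C : Type u} [Category.{v} C] [MonoidalCategory C] [BraidedCategory C]
  [IsIdempotentComplete C] {H : C} [HopfObj H]

/-- The bialgebra projection underlying a bialgebra of Hopf bimodules. -/
noncomputable def toBialgProj (B : HopfBimodBialg H) : BialgProj H :=
  letI := B.isBialg.bimonObj
  { X := B.base.X
    incl := B.one
    proj := B.counit
    incl_hom :=
      { one_hom := rfl
        mul_hom := by
          change μ[H] ≫ B.one = (B.one ⊗ₘ B.one) ≫ toTensor B.base B.base ≫ B.mul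
          rw [MonoidalCategory.tensorHom_def', Category.assoc, B.isBialg.one_toTensor_mul]
          exact B.isBialg.one_hom.actL
        hom_counit := by
          change B.one ≫ B.counit ≫ ε[H] = ε[H]
          rw [reassoc_of% B.isBialg.one_counit]
        hom_comul := B.isBialg.one_comul_ofCotensor }
    proj_hom :=
      { one_hom := by
          change (η[H] ≫ B.one) ≫ B.counit = η[H]
          rw [Category.assoc, B.isBialg.one_counit, Category.comp_id]
        mul_hom := B.isBialg.toTensor_mul_counit
        hom_counit := rfl
        hom_comul := by
          change B.counit ≫ Δ[H] =
            (B.comul ≫ ofCotensor B.base B.base) ≫ (B.counit ⊗ₘ B.counit)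
          rw [MonoidalCategory.tensorHom_def, Category.assoc,
            reassoc_of% B.isBialg.comul_ofCotensor_counit]
          exact B.isBialg.counit_hom.coactL.symm }
    incl_proj := B.isBialg.one_counit }

/-- Morphisms of bialgebras of Hopf bimodules are morphisms of the bialgebra projections. -/
noncomputable def Hom.toBialgProj {A B : HopfBimodBialg H} (f : Hom A B) :
    BialgProj.Hom A.toBialgProj B.toBialgProj where
  hom := f.hom
  isBimonHom :=
    { one_hom := by
        change (η[H] ≫ A.one) ≫ f.hom = η[H] ≫ B.one
        rw [Category.assoc, f.one_hom]
      mul_hom := by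
        change (toTensor A.base A.base ≫ A.mul) ≫ f.hom =
          (f.hom ⊗ₘ f.hom) ≫ toTensor B.base B.base ≫ B.mul
        rw [Category.assoc, f.mul_hom, reassoc_of% toTensor_naturality f.isHom f.isHom
          A.isBialg.isHopfBimod.idem_idem B.isBialg.isHopfBimod.idem_idem]
      hom_counit := by
        change f.hom ≫ B.counit ≫ ε[H] = A.counit ≫ ε[H]
        rw [← Category.assoc, f.hom_counit]
      hom_comul := by
        change f.hom ≫ B.comul ≫ ofCotensor B.base B.base =
          (A.comul ≫ ofCotensor A.base A.base) ≫ (f.hom ⊗ₘ f.hom)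
        rw [Category.assoc, ← ofCotensor_naturality f.isHom f.isHom
          A.isBialg.isHopfBimod.idem_idem B.isBialg.isHopfBimod.idem_idem, ← Category.assoc,
          f.hom_comul, Category.assoc] }
  incl_hom := f.one_hom
  hom_proj := f.hom_counit

/-- The functor from bialgebras of Hopf bimodules to bialgebra projections. -/
noncomputable def toBialgProjFunctor (H : C) [HopfObj H] : HopfBimodBialg H ⥤ BialgProj H where
  obj := toBialgProj
  map f := f.toBialgProj
  map_id _ := rfl
  map_comp _ _ := rfl

end
end HopfBimodBialg

/-! ### From bialgebra projections to bialgebras of Hopf bimodules -/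

namespace BialgProj
section

open HopfBimodData

variable {C : Type u} [Category.{v} C] [MonoidalCategory C] [BraidedCategory C] {H : C}

theorem tensorHom_tensorμ_tensorHom {A B A₁ A₂ B₁ B₂ X₁ X₂ Y₁ Y₂ U₁ U₂ V₁ V₂ D E : C}
    (x : A ⟶ A₁ ⊗ A₂) (y : B ⟶ B₁ ⊗ B₂) (u₁ : A₁ ⟶ X₁) (u₂ : A₂ ⟶ X₂) (v₁ : B₁ ⟶ Y₁)
    (v₂ : B₂ ⟶ Y₂) (h₁ : X₁ ⟶ U₁) (h₂ : Y₁ ⟶ U₂) (k₁ : X₂ ⟶ V₁) (k₂ : Y₂ ⟶ V₂)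
    (m : U₁ ⊗ U₂ ⟶ D) (n : V₁ ⊗ V₂ ⟶ E) :
    ((x ≫ (u₁ ⊗ₘ u₂)) ⊗ₘ (y ≫ (v₁ ⊗ₘ v₂))) ≫ tensorμ X₁ X₂ Y₁ Y₂ ≫
        (((h₁ ⊗ₘ h₂) ≫ m) ⊗ₘ ((k₁ ⊗ₘ k₂) ≫ n)) =
      (x ⊗ₘ y) ≫ tensorμ A₁ A₂ B₁ B₂ ≫
        ((((u₁ ≫ h₁) ⊗ₘ (v₁ ≫ h₂)) ≫ m) ⊗ₘ (((u₂ ≫ k₁) ⊗ₘ (v₂ ≫ k₂)) ≫ n)) := by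
  simp only [← tensorHom_comp_tensorHom, Category.assoc, tensorμ_natural_assoc]

/-- The bialgebra axiom, with arbitrary morphisms compatible with `Δ` before the multiplication and
arbitrary morphisms compatible with `μ` after the comultiplication. The compatibilities of the
actions and coactions of a bialgebra projection are the cases in which these are identities, `incl`
and `proj`. -/
theorem mul_comul_of {X A B A₁ A₂ B₁ B₂ D E U₁ U₂ V₁ V₂ : C} [BimonObj X] {f : A ⟶ X} {g : B ⟶ X}
    {h : X ⟶ D} {k : X ⟶ E} {x : A ⟶ A₁ ⊗ A₂} {y : B ⟶ B₁ ⊗ B₂} {u₁ : A₁ ⟶ X} {u₂ : A₂ ⟶ X}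
    {v₁ : B₁ ⟶ X} {v₂ : B₂ ⟶ X} {h₁ : X ⟶ U₁} {h₂ : X ⟶ U₂} {k₁ : X ⟶ V₁} {k₂ : X ⟶ V₂}
    {m : U₁ ⊗ U₂ ⟶ D} {n : V₁ ⊗ V₂ ⟶ E}
    (hf : f ≫ Δ[X] = x ≫ (u₁ ⊗ₘ u₂)) (hg : g ≫ Δ[X] = y ≫ (v₁ ⊗ₘ v₂))
    (hh : μ[X] ≫ h = (h₁ ⊗ₘ h₂) ≫ m) (hk : μ[X] ≫ k = (k₁ ⊗ₘ k₂) ≫ n) :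
    ((f ⊗ₘ g) ≫ μ[X]) ≫ Δ[X] ≫ (h ⊗ₘ k) =
      (x ⊗ₘ y) ≫ tensorμ A₁ A₂ B₁ B₂ ≫
        ((((u₁ ≫ h₁) ⊗ₘ (v₁ ≫ h₂)) ≫ m) ⊗ₘ (((u₂ ≫ k₁) ⊗ₘ (v₂ ≫ k₂)) ≫ n)) := by
  rw [Category.assoc, BimonObj.mul_comul_assoc, tensorHom_comp_tensorHom,
    tensorHom_comp_tensorHom_assoc, hf, hg, hh, hk, tensorHom_tensorμ_tensorHom]

variable [BimonObj H]

/-- The Hopf bimodule underlying a bialgebra projection. -/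
abbrev base (P : BialgProj H) : HopfBimodData H := P.toData.toHopfBimodData

theorem mul_coactL (P : BialgProj H) :
    μ[P.X] ≫ Δ[P.X] ≫ P.proj ▷ P.X =
      ((Δ[P.X] ≫ P.proj ▷ P.X) ⊗ₘ (Δ[P.X] ≫ P.proj ▷ P.X)) ≫ tensorμ H P.X H P.X ≫
        (μ[H] ⊗ₘ μ[P.X]) := by
  have h := mul_comul_of (f := 𝟙 P.X) (g := 𝟙 P.X) (h := P.proj) (k := 𝟙 P.X) (x := Δ[P.X])
    (y := Δ[P.X]) (u₁ := 𝟙 _) (u₂ := 𝟙 _) (v₁ := 𝟙 _) (v₂ := 𝟙 _) (h₁ := P.proj) (h₂ := P.proj)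
    (k₁ := 𝟙 _) (k₂ := 𝟙 _) (m := μ[H]) (n := μ[P.X]) (by simp) (by simp) (by simp) (by simp)
  have h' := tensorHom_tensorμ_tensorHom Δ[P.X] Δ[P.X] P.proj (𝟙 P.X) P.proj (𝟙 P.X)
    (𝟙 H) (𝟙 H) (𝟙 P.X) (𝟙 P.X) μ[H] μ[P.X]
  simp only [id_whiskerRight, Category.id_comp, Category.comp_id, tensorHom_id] at h h'
  rw [h, h']

theorem mul_coactR (P : BialgProj H) :
    μ[P.X] ≫ Δ[P.X] ≫ P.X ◁ P.proj =
      ((Δ[P.X] ≫ P.X ◁ P.proj) ⊗ₘ (Δ[P.X] ≫ P.X ◁ P.proj)) ≫ tensorμ P.X H P.X H ≫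
        (μ[P.X] ⊗ₘ μ[H]) := by
  have h := mul_comul_of (f := 𝟙 P.X) (g := 𝟙 P.X) (h := 𝟙 P.X) (k := P.proj) (x := Δ[P.X])
    (y := Δ[P.X]) (u₁ := 𝟙 _) (u₂ := 𝟙 _) (v₁ := 𝟙 _) (v₂ := 𝟙 _) (h₁ := 𝟙 _) (h₂ := 𝟙 _)
    (k₁ := P.proj) (k₂ := P.proj) (m := μ[P.X]) (n := μ[H]) (by simp) (by simp) (by simp) (by simp)
  have h' := tensorHom_tensorμ_tensorHom Δ[P.X] Δ[P.X] (𝟙 P.X) P.proj (𝟙 P.X) P.proj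
    (𝟙 P.X) (𝟙 P.X) (𝟙 H) (𝟙 H) μ[P.X] μ[H]
  simp only [MonoidalCategory.whiskerLeft_id, Category.id_comp, Category.comp_id, id_tensorHom]
    at h h'
  rw [h, h']

theorem actL_comul (P : BialgProj H) :
    (P.incl ▷ P.X ≫ μ[P.X]) ≫ Δ[P.X] =
      (Δ[H] ⊗ₘ Δ[P.X]) ≫ tensorμ H H P.X P.X ≫
        ((P.incl ▷ P.X ≫ μ[P.X]) ⊗ₘ (P.incl ▷ P.X ≫ μ[P.X])) := by
  have h := mul_comul_of (f := P.incl) (g := 𝟙 P.X) (h := 𝟙 P.X) (k := 𝟙 P.X) (x := Δ[H])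
    (y := Δ[P.X]) (u₁ := P.incl) (u₂ := P.incl) (v₁ := 𝟙 _) (v₂ := 𝟙 _) (h₁ := 𝟙 _) (h₂ := 𝟙 _)
    (k₁ := 𝟙 _) (k₂ := 𝟙 _) (m := μ[P.X]) (n := μ[P.X]) (by simp) (by simp) (by simp) (by simp)
  simp only [id_whiskerRight, Category.comp_id, tensorHom_id] at h
  exact h

theorem actR_comul (P : BialgProj H) :
    (P.X ◁ P.incl ≫ μ[P.X]) ≫ Δ[P.X] =
      (Δ[P.X] ⊗ₘ Δ[H]) ≫ tensorμ P.X P.X H H ≫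
        ((P.X ◁ P.incl ≫ μ[P.X]) ⊗ₘ (P.X ◁ P.incl ≫ μ[P.X])) := by
  have h := mul_comul_of (f := 𝟙 P.X) (g := P.incl) (h := 𝟙 P.X) (k := 𝟙 P.X) (x := Δ[P.X])
    (y := Δ[H]) (u₁ := 𝟙 _) (u₂ := 𝟙 _) (v₁ := P.incl) (v₂ := P.incl) (h₁ := 𝟙 _) (h₂ := 𝟙 _)
    (k₁ := 𝟙 _) (k₂ := 𝟙 _) (m := μ[P.X]) (n := μ[P.X]) (by simp) (by simp) (by simp) (by simp)
  simp only [MonoidalCategory.whiskerLeft_id, Category.comp_id, id_tensorHom] at h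
  exact h

theorem actL_coactL (P : BialgProj H) :
    (P.incl ▷ P.X ≫ μ[P.X]) ≫ Δ[P.X] ≫ P.proj ▷ P.X =
      (Δ[H] ⊗ₘ (Δ[P.X] ≫ P.proj ▷ P.X)) ≫ tensorμ H H H P.X ≫
        (μ[H] ⊗ₘ (P.incl ▷ P.X ≫ μ[P.X])) := by
  have h := mul_comul_of (f := P.incl) (g := 𝟙 P.X) (h := P.proj) (k := 𝟙 P.X) (x := Δ[H])
    (y := Δ[P.X]) (u₁ := P.incl) (u₂ := P.incl) (v₁ := 𝟙 _) (v₂ := 𝟙 _) (h₁ := P.proj)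
    (h₂ := P.proj) (k₁ := 𝟙 _) (k₂ := 𝟙 _) (m := μ[H]) (n := μ[P.X])
    (by simp) (by simp) (by simp) (by simp)
  have h' := tensorHom_tensorμ_tensorHom Δ[H] Δ[P.X] (𝟙 H) (𝟙 H) P.proj (𝟙 P.X)
    (𝟙 H) (𝟙 H) P.incl (𝟙 P.X) μ[H] μ[P.X]
  simp only [id_whiskerRight, Category.id_comp, Category.comp_id, tensorHom_id, id_tensorHom,
    P.incl_proj] at h h'
  rw [h, h']

theorem actR_coactL (P : BialgProj H) :
    (P.X ◁ P.incl ≫ μ[P.X]) ≫ Δ[P.X] ≫ P.proj ▷ P.X =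
      ((Δ[P.X] ≫ P.proj ▷ P.X) ⊗ₘ Δ[H]) ≫ tensorμ H P.X H H ≫
        (μ[H] ⊗ₘ (P.X ◁ P.incl ≫ μ[P.X])) := by
  have h := mul_comul_of (f := 𝟙 P.X) (g := P.incl) (h := P.proj) (k := 𝟙 P.X) (x := Δ[P.X])
    (y := Δ[H]) (u₁ := 𝟙 _) (u₂ := 𝟙 _) (v₁ := P.incl) (v₂ := P.incl) (h₁ := P.proj)
    (h₂ := P.proj) (k₁ := 𝟙 _) (k₂ := 𝟙 _) (m := μ[H]) (n := μ[P.X])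
    (by simp) (by simp) (by simp) (by simp)
  have h' := tensorHom_tensorμ_tensorHom Δ[P.X] Δ[H] P.proj (𝟙 P.X) (𝟙 H) (𝟙 H)
    (𝟙 H) (𝟙 H) (𝟙 P.X) P.incl μ[H] μ[P.X]
  simp only [id_whiskerRight, Category.id_comp, Category.comp_id, tensorHom_id, id_tensorHom,
    P.incl_proj] at h h'
  rw [h, h']

theorem actL_coactR (P : BialgProj H) :
    (P.incl ▷ P.X ≫ μ[P.X]) ≫ Δ[P.X] ≫ P.X ◁ P.proj =
      (Δ[H] ⊗ₘ (Δ[P.X] ≫ P.X ◁ P.proj)) ≫ tensorμ H H P.X H ≫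
        ((P.incl ▷ P.X ≫ μ[P.X]) ⊗ₘ μ[H]) := by
  have h := mul_comul_of (f := P.incl) (g := 𝟙 P.X) (h := 𝟙 P.X) (k := P.proj) (x := Δ[H])
    (y := Δ[P.X]) (u₁ := P.incl) (u₂ := P.incl) (v₁ := 𝟙 _) (v₂ := 𝟙 _) (h₁ := 𝟙 _)
    (h₂ := 𝟙 _) (k₁ := P.proj) (k₂ := P.proj) (m := μ[P.X]) (n := μ[H])
    (by simp) (by simp) (by simp) (by simp)
  have h' := tensorHom_tensorμ_tensorHom Δ[H] Δ[P.X] (𝟙 H) (𝟙 H) (𝟙 P.X) P.proj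
    P.incl (𝟙 P.X) (𝟙 H) (𝟙 H) μ[P.X] μ[H]
  simp only [id_whiskerRight, Category.id_comp, Category.comp_id, tensorHom_id, id_tensorHom,
    P.incl_proj] at h h'
  rw [h, h']

theorem actR_coactR (P : BialgProj H) :
    (P.X ◁ P.incl ≫ μ[P.X]) ≫ Δ[P.X] ≫ P.X ◁ P.proj =
      ((Δ[P.X] ≫ P.X ◁ P.proj) ⊗ₘ Δ[H]) ≫ tensorμ P.X H H H ≫
        ((P.X ◁ P.incl ≫ μ[P.X]) ⊗ₘ μ[H]) := by
  have h := mul_comul_of (f := 𝟙 P.X) (g := P.incl) (h := 𝟙 P.X) (k := P.proj) (x := Δ[P.X])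
    (y := Δ[H]) (u₁ := 𝟙 _) (u₂ := 𝟙 _) (v₁ := P.incl) (v₂ := P.incl) (h₁ := 𝟙 _)
    (h₂ := 𝟙 _) (k₁ := P.proj) (k₂ := P.proj) (m := μ[P.X]) (n := μ[H])
    (by simp) (by simp) (by simp) (by simp)
  have h' := tensorHom_tensorμ_tensorHom Δ[P.X] Δ[H] (𝟙 P.X) P.proj (𝟙 H) (𝟙 H)
    (𝟙 P.X) P.incl (𝟙 H) (𝟙 H) μ[P.X] μ[H]
  simp only [id_whiskerRight, Category.id_comp, Category.comp_id, tensorHom_id, id_tensorHom,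
    P.incl_proj] at h h'
  rw [h, h']

theorem isHopfBimod (P : BialgProj H) : P.base.IsHopfBimod where
  one_actL := by
    change η[H] ▷ P.X ≫ P.incl ▷ P.X ≫ μ[P.X] = (λ_ P.X).hom
    rw [← comp_whiskerRight_assoc, IsMonHom.one_hom, MonObj.one_mul]
  mul_actL := by
    change μ[H] ▷ P.X ≫ P.incl ▷ P.X ≫ μ[P.X] = (α_ H H P.X).hom ≫
      H ◁ (P.incl ▷ P.X ≫ μ[P.X]) ≫ P.incl ▷ P.X ≫ μ[P.X]
    calc
      _ = (P.incl ⊗ₘ P.incl) ▷ P.X ≫ (μ[P.X] ▷ P.X ≫ μ[P.X]) := by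
        rw [← comp_whiskerRight_assoc, IsMonHom.mul_hom, comp_whiskerRight_assoc]
      _ = 𝟙 ((H ⊗ H) ⊗ P.X) ⊗≫ P.incl ▷ H ▷ P.X ⊗≫ P.X ◁ (P.incl ▷ P.X ≫ μ[P.X]) ≫ μ[P.X] := by
        rw [MonObj.mul_assoc, MonoidalCategory.tensorHom_def]
        monoidal
      _ = 𝟙 ((H ⊗ H) ⊗ P.X) ⊗≫ (P.incl ▷ (H ⊗ P.X) ≫ P.X ◁ (P.incl ▷ P.X ≫ μ[P.X])) ≫ μ[P.X] := by
        monoidal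
      _ = _ := by
        rw [← whisker_exchange]
        monoidal
  actR_one := by
    change P.X ◁ η[H] ≫ P.X ◁ P.incl ≫ μ[P.X] = (ρ_ P.X).hom
    rw [← whiskerLeft_comp_assoc, IsMonHom.one_hom, MonObj.mul_one]
  actR_mul := by
    change P.X ◁ μ[H] ≫ P.X ◁ P.incl ≫ μ[P.X] = (α_ P.X H H).inv ≫
      (P.X ◁ P.incl ≫ μ[P.X]) ▷ H ≫ P.X ◁ P.incl ≫ μ[P.X]
    calc
      _ = P.X ◁ (P.incl ⊗ₘ P.incl) ≫ (P.X ◁ μ[P.X] ≫ μ[P.X]) := by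
        rw [← whiskerLeft_comp_assoc, IsMonHom.mul_hom, whiskerLeft_comp_assoc]
      _ = 𝟙 (P.X ⊗ H ⊗ H) ⊗≫
            ((P.X ⊗ H) ◁ P.incl ≫ (P.X ◁ P.incl ≫ μ[P.X]) ▷ P.X) ≫ μ[P.X] := by
        rw [MonObj.mul_assoc_flip, MonoidalCategory.tensorHom_def']
        monoidal
      _ = _ := by
        rw [whisker_exchange]
        monoidal
  act_assoc := by
    change (P.incl ▷ P.X ≫ μ[P.X]) ▷ H ≫ P.X ◁ P.incl ≫ μ[P.X] = (α_ H P.X H).hom ≫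
      H ◁ (P.X ◁ P.incl ≫ μ[P.X]) ≫ P.incl ▷ P.X ≫ μ[P.X]
    calc
      _ = P.incl ▷ P.X ▷ H ⊗≫ (μ[P.X] ▷ H ≫ P.X ◁ P.incl) ≫ μ[P.X] := by
        monoidal
      _ = P.incl ▷ P.X ▷ H ⊗≫ P.X ◁ P.X ◁ P.incl ⊗≫ (μ[P.X] ▷ P.X ≫ μ[P.X]) := by
        rw [← whisker_exchange]
        monoidal
      _ = 𝟙 ((H ⊗ P.X) ⊗ H) ⊗≫ (P.incl ▷ (P.X ⊗ H) ≫ P.X ◁ (P.X ◁ P.incl ≫ μ[P.X])) ≫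
            μ[P.X] := by
        rw [MonObj.mul_assoc]
        monoidal
      _ = _ := by
        rw [← whisker_exchange]
        monoidal
  coactL_counit := by
    change (Δ[P.X] ≫ P.proj ▷ P.X) ≫ ε[H] ▷ P.X = (λ_ P.X).inv
    rw [Category.assoc, ← comp_whiskerRight, IsComonHom.hom_counit, ComonObj.counit_comul]
  coactL_comul := by
    change (Δ[P.X] ≫ P.proj ▷ P.X) ≫ Δ[H] ▷ P.X = (Δ[P.X] ≫ P.proj ▷ P.X) ≫
      H ◁ (Δ[P.X] ≫ P.proj ▷ P.X) ≫ (α_ H H P.X).inv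
    calc
      _ = (Δ[P.X] ≫ Δ[P.X] ▷ P.X) ≫ (P.proj ⊗ₘ P.proj) ▷ P.X := by
        rw [Category.assoc, ← comp_whiskerRight, IsComonHom.hom_comul, comp_whiskerRight,
          Category.assoc]
      _ = Δ[P.X] ≫ (P.X ◁ (Δ[P.X] ≫ P.proj ▷ P.X) ≫ P.proj ▷ (H ⊗ P.X)) ⊗≫
            𝟙 ((H ⊗ H) ⊗ P.X) := by
        rw [ComonObj.comul_assoc_flip, MonoidalCategory.tensorHom_def']
        monoidal
      _ = _ := by
        rw [whisker_exchange]
        monoidal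
  coactR_counit := by
    change (Δ[P.X] ≫ P.X ◁ P.proj) ≫ P.X ◁ ε[H] = (ρ_ P.X).inv
    rw [Category.assoc, ← whiskerLeft_comp, IsComonHom.hom_counit, ComonObj.comul_counit]
  coactR_comul := by
    change (Δ[P.X] ≫ P.X ◁ P.proj) ≫ P.X ◁ Δ[H] = (Δ[P.X] ≫ P.X ◁ P.proj) ≫
      (Δ[P.X] ≫ P.X ◁ P.proj) ▷ H ≫ (α_ P.X H H).hom
    calc
      _ = (Δ[P.X] ≫ P.X ◁ Δ[P.X]) ≫ P.X ◁ (P.proj ⊗ₘ P.proj) := by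
        rw [Category.assoc, ← whiskerLeft_comp, IsComonHom.hom_comul, whiskerLeft_comp,
          Category.assoc]
      _ = Δ[P.X] ≫ ((Δ[P.X] ≫ P.X ◁ P.proj) ▷ P.X ≫ (P.X ⊗ H) ◁ P.proj) ⊗≫
            𝟙 (P.X ⊗ H ⊗ H) := by
        rw [ComonObj.comul_assoc, MonoidalCategory.tensorHom_def]
        monoidal
      _ = _ := by
        rw [← whisker_exchange]
        monoidal
  coact_assoc := by
    change (Δ[P.X] ≫ P.X ◁ P.proj) ≫ (Δ[P.X] ≫ P.proj ▷ P.X) ▷ H = (Δ[P.X] ≫ P.proj ▷ P.X) ≫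
      H ◁ (Δ[P.X] ≫ P.X ◁ P.proj) ≫ (α_ H P.X H).inv
    calc
      _ = Δ[P.X] ≫ (P.X ◁ P.proj ≫ (Δ[P.X] ≫ P.proj ▷ P.X) ▷ H) := by
        monoidal
      _ = (Δ[P.X] ≫ Δ[P.X] ▷ P.X) ≫ P.proj ▷ P.X ▷ P.X ⊗≫ H ◁ P.X ◁ P.proj ⊗≫
            𝟙 ((H ⊗ P.X) ⊗ H) := by
        rw [whisker_exchange]
        monoidal
      _ = Δ[P.X] ≫ P.X ◁ Δ[P.X] ≫ (P.proj ▷ (P.X ⊗ P.X) ≫ H ◁ P.X ◁ P.proj) ⊗≫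
            𝟙 ((H ⊗ P.X) ⊗ H) := by
        rw [ComonObj.comul_assoc_flip]
        monoidal
      _ = Δ[P.X] ≫ (P.X ◁ (Δ[P.X] ≫ P.X ◁ P.proj) ≫ P.proj ▷ (P.X ⊗ H)) ⊗≫
            𝟙 ((H ⊗ P.X) ⊗ H) := by
        rw [← whisker_exchange]
        monoidal
      _ = _ := by
        rw [whisker_exchange]
        monoidal
  actL_coactL := P.actL_coactL
  actR_coactL := P.actR_coactL
  actL_coactR := P.actL_coactR
  actR_coactR := P.actR_coactR

theorem one_isHom (P : BialgProj H) : IsHom (regular H) P.base P.incl where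
  actL := by
    change μ[H] ≫ P.incl = H ◁ P.incl ≫ P.incl ▷ P.X ≫ μ[P.X]
    rw [IsMonHom.mul_hom, MonoidalCategory.tensorHom_def', Category.assoc]
  actR := by
    change μ[H] ≫ P.incl = P.incl ▷ H ≫ P.X ◁ P.incl ≫ μ[P.X]
    rw [IsMonHom.mul_hom, MonoidalCategory.tensorHom_def, Category.assoc]
  coactL := by
    change Δ[H] ≫ H ◁ P.incl = P.incl ≫ Δ[P.X] ≫ P.proj ▷ P.X
    rw [IsComonHom.hom_comul_assoc, MonoidalCategory.tensorHom_def', Category.assoc,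
      ← comp_whiskerRight, P.incl_proj, id_whiskerRight, Category.comp_id]
  coactR := by
    change Δ[H] ≫ P.incl ▷ H = P.incl ≫ Δ[P.X] ≫ P.X ◁ P.proj
    rw [IsComonHom.hom_comul_assoc, MonoidalCategory.tensorHom_def, Category.assoc,
      ← MonoidalCategory.whiskerLeft_comp, P.incl_proj, MonoidalCategory.whiskerLeft_id,
      Category.comp_id]

theorem counit_isHom (P : BialgProj H) : IsHom P.base (regular H) P.proj where
  actL := by
    change (P.incl ▷ P.X ≫ μ[P.X]) ≫ P.proj = H ◁ P.proj ≫ μ[H]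
    rw [Category.assoc, IsMonHom.mul_hom, MonoidalCategory.tensorHom_def, Category.assoc,
      ← comp_whiskerRight_assoc, P.incl_proj, id_whiskerRight, Category.id_comp]
  actR := by
    change (P.X ◁ P.incl ≫ μ[P.X]) ≫ P.proj = P.proj ▷ H ≫ μ[H]
    rw [Category.assoc, IsMonHom.mul_hom, MonoidalCategory.tensorHom_def', Category.assoc,
      ← MonoidalCategory.whiskerLeft_comp_assoc, P.incl_proj, MonoidalCategory.whiskerLeft_id,
      Category.id_comp]
  coactL := by
    change (Δ[P.X] ≫ P.proj ▷ P.X) ≫ H ◁ P.proj = P.proj ≫ Δ[H]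
    rw [IsComonHom.hom_comul, MonoidalCategory.tensorHom_def, Category.assoc]
  coactR := by
    change (Δ[P.X] ≫ P.X ◁ P.proj) ≫ P.proj ▷ H = P.proj ≫ Δ[H]
    rw [IsComonHom.hom_comul, MonoidalCategory.tensorHom_def', Category.assoc]

theorem Hom.isHom {P Q : BialgProj H} (f : Hom P Q) : IsHom P.base Q.base f.hom where
  actL := by
    have := f.isBimonHom
    change (P.incl ▷ P.X ≫ μ[P.X]) ≫ f.hom = H ◁ f.hom ≫ Q.incl ▷ Q.X ≫ μ[Q.X]
    rw [Category.assoc, IsMonHom.mul_hom, MonoidalCategory.tensorHom_def, Category.assoc,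
      ← comp_whiskerRight_assoc, f.incl_hom, whisker_exchange_assoc]
  actR := by
    have := f.isBimonHom
    change (P.X ◁ P.incl ≫ μ[P.X]) ≫ f.hom = f.hom ▷ H ≫ Q.X ◁ Q.incl ≫ μ[Q.X]
    rw [Category.assoc, IsMonHom.mul_hom, MonoidalCategory.tensorHom_def', Category.assoc,
      ← MonoidalCategory.whiskerLeft_comp_assoc, f.incl_hom, whisker_exchange_assoc]
  coactL := by
    have := f.isBimonHom
    change (Δ[P.X] ≫ P.proj ▷ P.X) ≫ H ◁ f.hom = f.hom ≫ Δ[Q.X] ≫ Q.proj ▷ Q.X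
    rw [IsComonHom.hom_comul_assoc, MonoidalCategory.tensorHom_def', Category.assoc,
      Category.assoc, ← comp_whiskerRight, f.hom_proj, whisker_exchange]
  coactR := by
    have := f.isBimonHom
    change (Δ[P.X] ≫ P.X ◁ P.proj) ≫ f.hom ▷ H = f.hom ≫ Δ[Q.X] ≫ Q.X ◁ Q.proj
    rw [IsComonHom.hom_comul_assoc, MonoidalCategory.tensorHom_def, Category.assoc,
      Category.assoc, ← MonoidalCategory.whiskerLeft_comp, f.hom_proj, whisker_exchange]

end
end BialgProj

/-! ### The multiplication and the comultiplication over `H` -/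

namespace HopfBimodData
section

variable {C : Type u} [Category.{v} C] [MonoidalCategory C] [BraidedCategory C]
  [IsIdempotentComplete C] {H : C} [HopfObj H] {N M : HopfBimodData H}

theorem IsHopfBimod.epi_toTensor (hN : N.IsHopfBimod) (hM : M.IsHopfBimod) :
    Epi (toTensor N M) :=
  (SplitEpi.mk (N.X ◁ M.inj) (hN.inj_toTensor hM)).epi

theorem IsHopfBimod.mono_ofCotensor (hN : N.IsHopfBimod) (hM : M.IsHopfBimod) :
    Mono (ofCotensor N M) :=
  (SplitMono.mk (N.X ◁ M.pr) (hN.ofCotensor_pr hM)).mono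

theorem IsHopfBimod.epi_toTensor_whiskerRight (hN : N.IsHopfBimod) (hM : M.IsHopfBimod) (Z : C) :
    Epi (toTensor N M ▷ Z) :=
  (SplitEpi.mk ((N.X ◁ M.inj) ▷ Z) ((comp_whiskerRight _ _ _).symm.trans
    ((congrArg (· ▷ Z) (hN.inj_toTensor hM)).trans (id_whiskerRight _ _)))).epi

theorem IsHopfBimod.mono_ofCotensor_whiskerRight (hN : N.IsHopfBimod) (hM : M.IsHopfBimod)
    (Z : C) : Mono (ofCotensor N M ▷ Z) :=
  (SplitMono.mk ((N.X ◁ M.pr) ▷ Z) ((comp_whiskerRight _ _ _).symm.trans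
    ((congrArg (· ▷ Z) (hN.ofCotensor_pr hM)).trans (id_whiskerRight _ _)))).mono

end
end HopfBimodData

namespace BialgProj
section

open HopfBimodData

variable {C : Type u} [Category.{v} C] [MonoidalCategory C] [BraidedCategory C]
  [IsIdempotentComplete C] {H : C} [HopfObj H]

/-- The inclusion of the invariants, with codomain the object `P.X`. -/
noncomputable def invInj (P : BialgProj H) : P.base.invObj ⟶ P.X :=
  P.base.inj

/-- The projection to the invariants, with domain the object `P.X`. -/
noncomputable def invPr (P : BialgProj H) : P.X ⟶ P.base.invObj :=
  P.base.pr

/-- The multiplication `B ⊗_H B ⟶ B` induced on the bialgebra `B` of a bialgebra projection. -/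
noncomputable def tensorMul (P : BialgProj H) : (P.base.tensor P.base).X ⟶ P.base.X :=
  P.toData.toHopfBimodBialgData.mul

/-- The comultiplication `B ⟶ B ⊗_H B` induced on the bialgebra `B` of a bialgebra projection. -/
noncomputable def tensorComul (P : BialgProj H) : P.base.X ⟶ (P.base.tensor P.base).X :=
  P.toData.toHopfBimodBialgData.comul

/-- The multiplication over `H` of a bialgebra projection determines the one in `C`. -/
theorem toTensor_tensorMul (P : BialgProj H) :
    toTensor P.base P.base ≫ P.tensorMul = μ[P.X] := by
  have h : (Δ[P.X] ≫ P.proj ▷ P.X) ≫ H ◁ P.invPr ≫ H ◁ P.invInj ≫ P.incl ▷ P.X ≫ μ[P.X] =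
      𝟙 P.X := P.isHopfBimod.coactL_pr_inj_actL
  change (P.X ◁ ((Δ[P.X] ≫ P.proj ▷ P.X) ≫ H ◁ P.invPr) ≫ (α_ P.X H P.base.invObj).inv ≫
    (P.X ◁ P.incl ≫ μ[P.X]) ▷ P.base.invObj) ≫ P.X ◁ P.invInj ≫ μ[P.X] = _
  calc
    _ = P.X ◁ ((Δ[P.X] ≫ P.proj ▷ P.X) ≫ H ◁ P.invPr) ⊗≫
          (P.X ◁ P.incl) ▷ P.base.invObj ≫ (μ[P.X] ▷ P.base.invObj ≫ P.X ◁ P.invInj) ≫ μ[P.X] := by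
      monoidal
    _ = P.X ◁ ((Δ[P.X] ≫ P.proj ▷ P.X) ≫ H ◁ P.invPr) ⊗≫
          P.X ◁ (P.incl ▷ P.base.invObj ≫ P.X ◁ P.invInj) ⊗≫ (μ[P.X] ▷ P.X ≫ μ[P.X]) := by
      rw [← whisker_exchange]
      monoidal
    _ = P.X ◁ ((Δ[P.X] ≫ P.proj ▷ P.X) ≫ H ◁ P.invPr ≫ H ◁ P.invInj ≫ P.incl ▷ P.X ≫ μ[P.X]) ≫
          μ[P.X] := by
      rw [MonObj.mul_assoc, ← whisker_exchange]
      monoidal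
    _ = _ := by
      rw [h]
      simp

/-- The comultiplication over `H` of a bialgebra projection determines the one in `C`. -/
theorem tensorComul_ofCotensor (P : BialgProj H) :
    P.tensorComul ≫ ofCotensor P.base P.base = Δ[P.X] := by
  have h : (Δ[P.X] ≫ P.proj ▷ P.X) ≫ H ◁ P.invPr ≫ H ◁ P.invInj ≫ P.incl ▷ P.X ≫ μ[P.X] =
      𝟙 P.X := P.isHopfBimod.coactL_pr_inj_actL
  change (Δ[P.X] ≫ P.X ◁ P.invPr) ≫ (Δ[P.X] ≫ P.X ◁ P.proj) ▷ P.base.invObj ≫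
    (α_ P.X H P.base.invObj).hom ≫ P.X ◁ (H ◁ P.invInj ≫ P.incl ▷ P.X ≫ μ[P.X]) = _
  calc
    _ = Δ[P.X] ≫ (P.X ◁ P.invPr ≫ (Δ[P.X] ≫ P.X ◁ P.proj) ▷ P.base.invObj) ⊗≫
          P.X ◁ (H ◁ P.invInj ≫ P.incl ▷ P.X ≫ μ[P.X]) := by
      monoidal
    _ = (Δ[P.X] ≫ Δ[P.X] ▷ P.X) ⊗≫ P.X ◁ (P.proj ▷ P.X ≫ H ◁ P.invPr) ⊗≫
          P.X ◁ (H ◁ P.invInj ≫ P.incl ▷ P.X ≫ μ[P.X]) := by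
      rw [whisker_exchange]
      monoidal
    _ = Δ[P.X] ≫ P.X ◁ ((Δ[P.X] ≫ P.proj ▷ P.X) ≫ H ◁ P.invPr ≫ H ◁ P.invInj ≫
          P.incl ▷ P.X ≫ μ[P.X]) := by
      rw [ComonObj.comul_assoc_flip]
      monoidal
    _ = _ := by
      rw [h]
      simp

theorem mul_isHom (P : BialgProj H) :
    IsHom (P.base.tensor P.base) P.base P.tensorMul where
  actL := by
    change ((α_ H P.X P.base.invObj).inv ≫ (P.incl ▷ P.X ≫ μ[P.X]) ▷ P.base.invObj) ≫
      P.X ◁ P.invInj ≫ μ[P.X] = H ◁ (P.X ◁ P.invInj ≫ μ[P.X]) ≫ P.incl ▷ P.X ≫ μ[P.X]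
    calc
      _ = 𝟙 (H ⊗ P.X ⊗ P.base.invObj) ⊗≫
            ((P.incl ▷ P.X ≫ μ[P.X]) ▷ P.base.invObj ≫ P.X ◁ P.invInj) ≫ μ[P.X] := by
        monoidal
      _ = H ◁ P.X ◁ P.invInj ⊗≫ P.incl ▷ P.X ▷ P.X ⊗≫ (μ[P.X] ▷ P.X ≫ μ[P.X]) := by
        rw [← whisker_exchange]
        monoidal
      _ = H ◁ P.X ◁ P.invInj ⊗≫ (P.incl ▷ (P.X ⊗ P.X) ≫ P.X ◁ μ[P.X]) ≫ μ[P.X] := by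
        rw [MonObj.mul_assoc]
        monoidal
      _ = _ := by
        rw [← whisker_exchange]
        monoidal
  actR := by
    have := P.isHopfBimod.epi_toTensor_whiskerRight P.isHopfBimod H
    have h := P.isHopfBimod.toTensor_actR P.isHopfBimod
    have h2 : (α_ P.X P.X H).hom ≫ P.X ◁ (P.X ◁ P.incl ≫ μ[P.X]) ≫ μ[P.X] =
        μ[P.X] ▷ H ≫ P.X ◁ P.incl ≫ μ[P.X] := by
      calc
        _ = (α_ P.X P.X H).hom ≫ P.X ◁ P.X ◁ P.incl ≫ (P.X ◁ μ[P.X] ≫ μ[P.X]) := by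
          monoidal
        _ = ((P.X ⊗ P.X) ◁ P.incl ≫ μ[P.X] ▷ P.X) ≫ μ[P.X] := by
          rw [MonObj.mul_assoc_flip]
          monoidal
        _ = _ := by
          rw [whisker_exchange]
          monoidal
    rw [← cancel_epi (toTensor P.base P.base ▷ H), reassoc_of% h, P.toTensor_tensorMul,
      ← comp_whiskerRight_assoc, P.toTensor_tensorMul]
    exact h2
  coactL := by
    have h : P.invInj ≫ Δ[P.X] ≫ P.proj ▷ P.X = P.invInj ≫ (λ_ P.X).inv ≫ η[H] ▷ P.X :=
      P.isHopfBimod.inj_coactL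
    change ((Δ[P.X] ≫ P.proj ▷ P.X) ▷ P.base.invObj ≫ (α_ H P.X P.base.invObj).hom) ≫
      H ◁ (P.X ◁ P.invInj ≫ μ[P.X]) = (P.X ◁ P.invInj ≫ μ[P.X]) ≫ Δ[P.X] ≫ P.proj ▷ P.X
    symm
    calc
      _ = P.X ◁ (P.invInj ≫ Δ[P.X] ≫ P.proj ▷ P.X) ≫ (Δ[P.X] ≫ P.proj ▷ P.X) ▷ (H ⊗ P.X) ⊗≫
            H ◁ (β_ P.X H).hom ▷ P.X ⊗≫ H ◁ H ◁ μ[P.X] ⊗≫ μ[H] ▷ P.X := by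
        rw [Category.assoc, P.mul_coactL, MonoidalCategory.tensorHom_def',
          MonoidalCategory.tensorHom_def', tensorμ]
        monoidal
      _ = P.X ◁ P.invInj ⊗≫ P.X ◁ η[H] ▷ P.X ⊗≫ (Δ[P.X] ≫ P.proj ▷ P.X) ▷ (H ⊗ P.X) ⊗≫
            H ◁ (β_ P.X H).hom ▷ P.X ⊗≫ H ◁ H ◁ μ[P.X] ⊗≫ μ[H] ▷ P.X := by
        rw [h]
        monoidal
      _ = P.X ◁ P.invInj ⊗≫ (P.X ◁ η[H] ≫ (Δ[P.X] ≫ P.proj ▷ P.X) ▷ H) ▷ P.X ⊗≫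
            H ◁ (β_ P.X H).hom ▷ P.X ⊗≫ H ◁ H ◁ μ[P.X] ⊗≫ μ[H] ▷ P.X := by
        monoidal
      _ = P.X ◁ P.invInj ≫ (Δ[P.X] ≫ P.proj ▷ P.X) ▷ P.X ⊗≫
            H ◁ (P.X ◁ η[H] ≫ (β_ P.X H).hom) ▷ P.X ⊗≫ H ◁ H ◁ μ[P.X] ⊗≫ μ[H] ▷ P.X := by
        rw [whisker_exchange]
        monoidal
      _ = P.X ◁ P.invInj ≫ (Δ[P.X] ≫ P.proj ▷ P.X) ▷ P.X ⊗≫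
            H ◁ (η[H] ▷ (P.X ⊗ P.X) ≫ H ◁ μ[P.X]) ⊗≫ μ[H] ▷ P.X := by
        rw [BraidedCategory.braiding_naturality_right, braiding_tensorUnit_right]
        monoidal
      _ = (P.X ◁ P.invInj ≫ (Δ[P.X] ≫ P.proj ▷ P.X) ▷ P.X) ⊗≫
            H ◁ μ[P.X] ⊗≫ (H ◁ η[H] ≫ μ[H]) ▷ P.X := by
        rw [← whisker_exchange]
        monoidal
      _ = _ := by
        rw [whisker_exchange, MonObj.mul_one]
        monoidal
  coactR := by
    have h : P.invInj ≫ Δ[P.X] ≫ P.X ◁ P.proj = P.base.invCoact ≫ P.invInj ▷ H :=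
      P.isHopfBimod.inj_coactR
    change (((Δ[P.X] ≫ P.X ◁ P.proj) ⊗ₘ P.base.invCoact) ≫ tensorμ P.X H P.base.invObj H ≫
      (P.X ⊗ P.base.invObj) ◁ μ[H]) ≫ (P.X ◁ P.invInj ≫ μ[P.X]) ▷ H =
        (P.X ◁ P.invInj ≫ μ[P.X]) ≫ Δ[P.X] ≫ P.X ◁ P.proj
    have h3 := tensorμ_natural (𝟙 P.X) (𝟙 H) P.invInj (𝟙 H)
    simp only [id_whiskerRight, id_tensorHom, tensorHom_id] at h3
    rw [Category.assoc (P.X ◁ P.invInj), P.mul_coactR, ← id_tensorHom P.X P.invInj,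
      tensorHom_comp_tensorHom_assoc, Category.id_comp, h, id_tensorHom]
    calc
      _ = ((Δ[P.X] ≫ P.X ◁ P.proj) ⊗ₘ P.base.invCoact) ≫ (tensorμ P.X H P.base.invObj H ≫
            ((P.X ◁ P.invInj) ▷ (H ⊗ H))) ≫ (μ[P.X] ⊗ₘ μ[H]) := by
        rw [MonoidalCategory.tensorHom_def' μ[P.X] μ[H]]
        simp only [Category.assoc, comp_whiskerRight]
        rw [whisker_exchange_assoc]
      _ = _ := by
        rw [← h3]
        simp only [MonoidalCategory.tensorHom_def, MonoidalCategory.whiskerLeft_comp,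
          Category.assoc]

theorem comul_isHom (P : BialgProj H) :
    IsHom P.base (P.base.tensor P.base) P.tensorComul where
  coactL := by
    change (Δ[P.X] ≫ P.proj ▷ P.X) ≫ H ◁ (Δ[P.X] ≫ P.X ◁ P.invPr) =
      (Δ[P.X] ≫ P.X ◁ P.invPr) ≫ (Δ[P.X] ≫ P.proj ▷ P.X) ▷ P.base.invObj ≫
        (α_ H P.X P.base.invObj).hom
    symm
    calc
      _ = Δ[P.X] ≫ (P.X ◁ P.invPr ≫ (Δ[P.X] ≫ P.proj ▷ P.X) ▷ P.base.invObj) ⊗≫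
            𝟙 (H ⊗ P.X ⊗ P.base.invObj) := by
        monoidal
      _ = (Δ[P.X] ≫ Δ[P.X] ▷ P.X) ≫ P.proj ▷ P.X ▷ P.X ⊗≫ H ◁ P.X ◁ P.invPr := by
        rw [whisker_exchange]
        monoidal
      _ = Δ[P.X] ≫ (P.X ◁ Δ[P.X] ≫ P.proj ▷ (P.X ⊗ P.X)) ≫ H ◁ P.X ◁ P.invPr := by
        rw [ComonObj.comul_assoc_flip]
        monoidal
      _ = _ := by
        rw [whisker_exchange]
        monoidal
  coactR := by
    have := P.isHopfBimod.mono_ofCotensor_whiskerRight P.isHopfBimod H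
    have h := P.isHopfBimod.coactR_ofCotensor P.isHopfBimod
    have h2 : (Δ[P.X] ≫ P.X ◁ P.proj) ≫ Δ[P.X] ▷ H =
        Δ[P.X] ≫ P.X ◁ (Δ[P.X] ≫ P.X ◁ P.proj) ≫ (α_ P.X P.X H).inv := by
      calc
        _ = Δ[P.X] ≫ (P.X ◁ P.proj ≫ Δ[P.X] ▷ H) := by
          monoidal
        _ = (Δ[P.X] ≫ Δ[P.X] ▷ P.X) ≫ (P.X ⊗ P.X) ◁ P.proj := by
          rw [whisker_exchange]
          monoidal
        _ = _ := by
          rw [ComonObj.comul_assoc_flip]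
          monoidal
    rw [← cancel_mono (ofCotensor P.base P.base ▷ H), Category.assoc, Category.assoc, h,
      reassoc_of% P.tensorComul_ofCotensor, ← comp_whiskerRight, P.tensorComul_ofCotensor]
    exact h2
  actL := by
    have h : (P.incl ▷ P.X ≫ μ[P.X]) ≫ P.invPr = ε[H] ▷ P.X ≫ (λ_ P.X).hom ≫ P.invPr :=
      P.isHopfBimod.actL_pr
    change (P.incl ▷ P.X ≫ μ[P.X]) ≫ Δ[P.X] ≫ P.X ◁ P.invPr = H ◁ (Δ[P.X] ≫ P.X ◁ P.invPr) ≫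
      (α_ H P.X P.base.invObj).inv ≫ (P.incl ▷ P.X ≫ μ[P.X]) ▷ P.base.invObj
    obtain ⟨a, ha⟩ : ∃ a : H ⊗ P.X ⟶ P.X, a = P.incl ▷ P.X ≫ μ[P.X] := ⟨_, rfl⟩
    have h1 := P.actL_comul
    rw [← ha] at h h1 ⊢
    calc
      _ = Δ[H] ▷ P.X ≫ (H ⊗ H) ◁ Δ[P.X] ⊗≫ H ◁ (β_ H P.X).hom ▷ P.X ⊗≫ a ▷ (H ⊗ P.X) ≫
            P.X ◁ (a ≫ P.invPr) := by
        rw [reassoc_of% h1, MonoidalCategory.tensorHom_def,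
          MonoidalCategory.tensorHom_def, tensorμ]
        monoidal
      _ = Δ[H] ▷ P.X ≫ (H ⊗ H) ◁ Δ[P.X] ⊗≫ H ◁ (β_ H P.X).hom ▷ P.X ⊗≫ (a ▷ (H ⊗ P.X) ≫
            P.X ◁ (ε[H] ▷ P.X)) ⊗≫ P.X ◁ P.invPr := by
        rw [h]
        monoidal
      _ = Δ[H] ▷ P.X ≫ (H ⊗ H) ◁ Δ[P.X] ⊗≫ H ◁ ((β_ H P.X).hom ≫ P.X ◁ ε[H]) ▷ P.X ⊗≫
            a ▷ P.X ⊗≫ P.X ◁ P.invPr := by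
        rw [← whisker_exchange]
        monoidal
      _ = Δ[H] ▷ P.X ⊗≫ H ◁ (H ◁ Δ[P.X] ≫ ε[H] ▷ (P.X ⊗ P.X)) ⊗≫
            a ▷ P.X ⊗≫ P.X ◁ P.invPr := by
        rw [← BraidedCategory.braiding_naturality_left, braiding_tensorUnit_left]
        monoidal
      _ = (Δ[H] ≫ H ◁ ε[H]) ▷ P.X ⊗≫ H ◁ Δ[P.X] ⊗≫ (a ▷ P.X ≫ P.X ◁ P.invPr) := by
        rw [whisker_exchange]
        monoidal
      _ = _ := by
        rw [ComonObj.comul_counit, ← whisker_exchange]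
        monoidal
  actR := by
    have h : (P.X ◁ P.incl ≫ μ[P.X]) ≫ P.invPr = P.invPr ▷ H ≫ P.base.invAct :=
      P.isHopfBimod.actR_pr
    change (P.X ◁ P.incl ≫ μ[P.X]) ≫ Δ[P.X] ≫ P.X ◁ P.invPr = (Δ[P.X] ≫ P.X ◁ P.invPr) ▷ H ≫
      (P.X ⊗ P.base.invObj) ◁ Δ[H] ≫ tensorμ P.X P.base.invObj H H ≫
        ((P.X ◁ P.incl ≫ μ[P.X]) ⊗ₘ P.base.invAct)
    obtain ⟨a, ha⟩ : ∃ a : P.X ⊗ H ⟶ P.X, a = P.X ◁ P.incl ≫ μ[P.X] := ⟨_, rfl⟩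
    have h1 := P.actR_comul
    rw [← ha] at h h1 ⊢
    have h3 := tensorμ_natural (𝟙 P.X) P.invPr (𝟙 H) (𝟙 H)
    simp only [id_whiskerRight, id_tensorHom, tensorHom_id] at h3
    rw [reassoc_of% h1, ← id_tensorHom P.X P.invPr, tensorHom_comp_tensorHom, Category.comp_id, h,
      id_tensorHom]
    calc
      _ = (Δ[P.X] ⊗ₘ Δ[H]) ≫ (tensorμ P.X P.X H H ≫ (P.X ⊗ H) ◁ P.invPr ▷ H) ≫
            (a ⊗ₘ P.base.invAct) := by
        simp only [MonoidalCategory.tensorHom_def', MonoidalCategory.whiskerLeft_comp,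
          Category.assoc]
      _ = _ := by
        rw [← h3]
        simp only [MonoidalCategory.tensorHom_def, comp_whiskerRight,
          whisker_exchange_assoc, Category.assoc]

end
end BialgProj

/-! ### The bialgebra axioms over `H` -/

namespace HopfBimodData
section

variable {C : Type u} [Category.{v} C] [MonoidalCategory C] [BraidedCategory C]
  [IsIdempotentComplete C] {H : C} [HopfObj H] {N : HopfBimodData H}

/-- The restriction to `N ⊗_H N` of an associative multiplication is associative. -/
theorem IsHopfBimod.inj_mul_assoc (hN : N.IsHopfBimod) {m : N.X ⊗ N.X ⟶ N.X}
    (h : m ▷ N.X ≫ m = (α_ N.X N.X N.X).hom ≫ N.X ◁ m ≫ m)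
    (hm : IsHom (N.tensor N) N (N.X ◁ N.inj ≫ m)) :
    tensorMap (N.tensor N) N N N (N.X ◁ N.inj ≫ m) (𝟙 N.X) ≫ N.X ◁ N.inj ≫ m =
      assocHom N N N ≫ tensorMap N N (N.tensor N) N (𝟙 N.X) (N.X ◁ N.inj ≫ m) ≫
        N.X ◁ N.inj ≫ m := by
  have hm' : (N.X ◁ N.inj ≫ m) ≫ N.idem = N.idem ▷ N.invObj ≫ N.X ◁ N.inj ≫ m :=
    hm.idem.symm.trans (congrArg (· ≫ N.X ◁ N.inj ≫ m) (tensor_idem N N))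
  have key : (N.inj ▷ N.invObj ≫ tensorPr N N) ≫
      (tensorInj N N ≫ (N.X ◁ N.inj ≫ m) ≫ N.pr) ≫ N.inj =
        N.inj ▷ N.invObj ≫ N.X ◁ N.inj ≫ m := by
    calc
      _ = N.inj ▷ N.invObj ≫ (tensorPr N N ≫ tensorInj N N) ≫
            (N.X ◁ N.inj ≫ m) ≫ N.pr ≫ N.inj := by
        simp only [Category.assoc]
      _ = (N.inj ≫ N.idem ≫ N.idem) ▷ N.invObj ≫ N.X ◁ N.inj ≫ m := by
        rw [hN.tensorPr_tensorInj, hN.pr_inj, hm']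
        simp only [comp_whiskerRight, Category.assoc]
      _ = _ := by
        rw [hN.idem_idem, hN.inj_idem]
  change ((N.X ◁ N.inj ≫ m) ⊗ₘ (N.inj ≫ 𝟙 N.X ≫ N.pr)) ≫ N.X ◁ N.inj ≫ m =
    ((α_ N.X N.invObj N.invObj).hom ≫ N.X ◁ (N.inj ▷ N.invObj ≫ tensorPr N N)) ≫
    (𝟙 N.X ⊗ₘ (tensorInj N N ≫ (N.X ◁ N.inj ≫ m) ≫ N.pr)) ≫ N.X ◁ N.inj ≫ m
  calc
    _ = ((N.X ◁ N.inj) ▷ N.invObj ≫ (m ▷ N.invObj ≫ N.X ◁ N.inj)) ≫ m := by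
      rw [Category.id_comp, hN.inj_pr, tensorHom_id]
      monoidal
    _ = (N.X ◁ N.inj) ▷ N.invObj ≫ (N.X ⊗ N.X) ◁ N.inj ≫ (m ▷ N.X ≫ m) := by
      rw [← whisker_exchange]
      monoidal
    _ = (α_ N.X N.invObj N.invObj).hom ≫
          N.X ◁ (N.inj ▷ N.invObj ≫ N.X ◁ N.inj ≫ m) ≫ m := by
      rw [h]
      monoidal
    _ = _ := by
      rw [← key, id_tensorHom]
      simp only [MonoidalCategory.whiskerLeft_comp, Category.assoc]

/-- The corestriction to `N ⊗_H N` of a coassociative comultiplication is coassociative. -/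
theorem IsHopfBimod.comul_pr_assoc (hN : N.IsHopfBimod) {d : N.X ⟶ N.X ⊗ N.X}
    (h : d ≫ d ▷ N.X = d ≫ N.X ◁ d ≫ (α_ N.X N.X N.X).inv)
    (hd : IsHom N (N.tensor N) (d ≫ N.X ◁ N.pr)) :
    (d ≫ N.X ◁ N.pr) ≫ tensorMap N (N.tensor N) N N (d ≫ N.X ◁ N.pr) (𝟙 N.X) ≫ assocHom N N N =
      (d ≫ N.X ◁ N.pr) ≫ tensorMap N N N (N.tensor N) (𝟙 N.X) (d ≫ N.X ◁ N.pr) := by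
  have hd' : N.idem ≫ (d ≫ N.X ◁ N.pr) ≫ tensorPr N N = (d ≫ N.X ◁ N.pr) ≫ tensorPr N N :=
    (Category.assoc _ _ _).symm.trans ((congrArg (· ≫ tensorPr N N) hd.idem).trans
      ((Category.assoc _ _ _).trans
        (congrArg ((d ≫ N.X ◁ N.pr) ≫ ·) (HopfBimodData.idem_pr (hN.tensor_idem_idem N)))))
  change (d ≫ N.X ◁ N.pr) ≫ ((d ≫ N.X ◁ N.pr) ⊗ₘ (N.inj ≫ 𝟙 N.X ≫ N.pr)) ≫
        (α_ N.X N.invObj N.invObj).hom ≫ N.X ◁ (N.inj ▷ N.invObj ≫ tensorPr N N) =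
    (d ≫ N.X ◁ N.pr) ≫ (𝟙 N.X ⊗ₘ (N.inj ≫ (d ≫ N.X ◁ N.pr) ≫ tensorPr N N))
  calc
    _ = d ≫ (N.X ◁ N.pr ≫ d ▷ N.invObj) ⊗≫ N.X ◁ ((N.pr ≫ N.inj) ▷ N.invObj ≫ tensorPr N N) := by
      rw [Category.id_comp, hN.inj_pr, tensorHom_id]
      monoidal
    _ = (d ≫ d ▷ N.X) ⊗≫ N.X ◁ N.X ◁ N.pr ≫ N.X ◁ tensorPr N N := by
      rw [whisker_exchange, hN.pr_inj, hN.idem_tensorPr]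
      monoidal
    _ = d ≫ N.X ◁ ((d ≫ N.X ◁ N.pr) ≫ tensorPr N N) := by
      rw [h]
      monoidal
    _ = _ := by
      rw [id_tensorHom]
      conv_lhs => rw [← hd', ← hN.pr_inj]
      simp only [MonoidalCategory.whiskerLeft_comp, Category.assoc]

end
end HopfBimodData

namespace BialgProj
section

open HopfBimodData

variable {C : Type u} [Category.{v} C] [MonoidalCategory C] [BraidedCategory C]
  [IsIdempotentComplete C] {H : C} [HopfObj H]

theorem tensorMul_one_mul (P : BialgProj H) :
    tensorMap (regular H) P.base P.base P.base P.incl (𝟙 P.base.X) ≫ P.tensorMul =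
      leftUnitHom P.base := by
  have := isHopfBimod_regular.epi_toTensor P.isHopfBimod
  have h := toTensor_naturality P.one_isHom (IsHom.id P.base) P.isHopfBimod.idem_idem
    P.isHopfBimod.idem_idem
  refine (cancel_epi (toTensor (regular H) P.base)).1 ?_
  exact (Category.assoc _ _ _).symm.trans ((congrArg (· ≫ P.tensorMul) h).trans
    ((Category.assoc _ _ _).trans ((congrArg (_ ≫ ·) P.toTensor_tensorMul).trans
    ((congrArg (· ≫ μ[P.X]) (tensorHom_id P.incl P.X)).trans
      P.isHopfBimod.toTensor_leftUnitHom.symm))))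

theorem tensorMul_mul_one (P : BialgProj H) :
    tensorMap P.base P.base (regular H) P.base (𝟙 P.base.X) P.incl ≫ P.tensorMul =
      rightUnitHom P.base := by
  have := P.isHopfBimod.epi_toTensor isHopfBimod_regular
  have h := toTensor_naturality (IsHom.id P.base) P.one_isHom isHopfBimod_regular.idem_idem
    P.isHopfBimod.idem_idem
  refine (cancel_epi (toTensor P.base (regular H))).1 ?_
  exact (Category.assoc _ _ _).symm.trans ((congrArg (· ≫ P.tensorMul) h).trans
    ((Category.assoc _ _ _).trans ((congrArg (_ ≫ ·) P.toTensor_tensorMul).trans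
    ((congrArg (· ≫ μ[P.X]) (id_tensorHom P.X P.incl)).trans
      (toTensor_rightUnitHom P.base).symm))))

theorem tensorComul_counit_comul (P : BialgProj H) :
    P.tensorComul ≫ tensorMap P.base (regular H) P.base P.base P.proj (𝟙 P.base.X) ≫
      leftUnitHom P.base = 𝟙 P.base.X := by
  have : Mono P.base.coactL :=
    (SplitMono.mk (ε[H] ▷ P.base.X ≫ (λ_ P.base.X).hom) (by
      rw [reassoc_of% P.isHopfBimod.coactL_counit, Iso.inv_hom_id])).mono
  have h : tensorMap P.base (regular H) P.base P.base P.proj (𝟙 P.base.X) ≫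
      ofCotensor (regular H) P.base = ofCotensor P.base P.base ≫ P.proj ▷ P.base.X :=
    (ofCotensor_naturality P.counit_isHom (IsHom.id P.base) P.isHopfBimod.idem_idem
      P.isHopfBimod.idem_idem).trans (congrArg (_ ≫ ·) (tensorHom_id P.proj P.X))
  rw [← cancel_mono P.base.coactL, Category.assoc, Category.assoc,
    P.isHopfBimod.leftUnitHom_coactL]
  exact (congrArg (P.tensorComul ≫ ·) h).trans ((Category.assoc _ _ _).symm.trans
    ((congrArg (· ≫ P.proj ▷ P.X) P.tensorComul_ofCotensor).trans (Category.id_comp _).symm))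

theorem tensorComul_comul_counit (P : BialgProj H) :
    P.tensorComul ≫ tensorMap P.base P.base P.base (regular H) (𝟙 P.base.X) P.proj ≫
      rightUnitHom P.base = 𝟙 P.base.X := by
  have : Mono P.base.coactR :=
    (SplitMono.mk (P.base.X ◁ ε[H] ≫ (ρ_ P.base.X).hom) (by
      rw [reassoc_of% P.isHopfBimod.coactR_counit, Iso.inv_hom_id])).mono
  have h : tensorMap P.base P.base P.base (regular H) (𝟙 P.base.X) P.proj ≫
      ofCotensor P.base (regular H) = ofCotensor P.base P.base ≫ P.base.X ◁ P.proj :=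
    (ofCotensor_naturality (IsHom.id P.base) P.counit_isHom P.isHopfBimod.idem_idem
      isHopfBimod_regular.idem_idem).trans (congrArg (_ ≫ ·) (id_tensorHom P.X P.proj))
  rw [← cancel_mono P.base.coactR, Category.assoc, Category.assoc, rightUnitHom_coactR]
  exact (congrArg (P.tensorComul ≫ ·) h).trans ((Category.assoc _ _ _).symm.trans
    ((congrArg (· ≫ P.X ◁ P.proj) P.tensorComul_ofCotensor).trans (Category.id_comp _).symm))

theorem tensorMul_mul_assoc (P : BialgProj H) :
    tensorMap (P.base.tensor P.base) P.base P.base P.base P.tensorMul (𝟙 P.base.X) ≫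
        P.tensorMul =
      assocHom P.base P.base P.base ≫
        tensorMap P.base P.base (P.base.tensor P.base) P.base (𝟙 P.base.X) P.tensorMul ≫
          P.tensorMul :=
  P.isHopfBimod.inj_mul_assoc (MonObj.mul_assoc P.X) P.mul_isHom

theorem tensorComul_comul_assoc (P : BialgProj H) :
    P.tensorComul ≫
        tensorMap P.base (P.base.tensor P.base) P.base P.base P.tensorComul (𝟙 P.base.X) ≫
          assocHom P.base P.base P.base =
      P.tensorComul ≫
        tensorMap P.base P.base P.base (P.base.tensor P.base) (𝟙 P.base.X) P.tensorComul :=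
  P.isHopfBimod.comul_pr_assoc (ComonObj.comul_assoc_flip P.X) P.comul_isHom

/-- The bialgebra axiom over `H` follows from the one in `C` after cancelling `toTensor` on the left
and `ofCotensor` on the right. -/
theorem tensorMul_tensorComul (P : BialgProj H) :
    P.tensorMul ≫ P.tensorComul =
      tensorMap P.base (P.base.tensor P.base) P.base (P.base.tensor P.base)
          P.tensorComul P.tensorComul ≫
        exchange P.base P.base P.base P.base ≫
        tensorMap (P.base.tensor P.base) P.base (P.base.tensor P.base) P.base
          P.tensorMul P.tensorMul := by
  have hX := P.isHopfBimod
  have := hX.epi_toTensor hX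
  have := hX.mono_ofCotensor hX
  have h1 := toTensor_naturality P.comul_isHom P.comul_isHom hX.idem_idem
    (hX.tensor_idem_idem _)
  have h2 := ofCotensor_naturality P.mul_isHom P.mul_isHom (hX.tensor_idem_idem _) hX.idem_idem
  have h3 := toTensor_exchange_ofCotensor hX hX hX hX
  refine (cancel_epi (toTensor P.base P.base)).1 ((cancel_mono (ofCotensor P.base P.base)).1 ?_)
  have h4 : (toTensor P.base P.base ≫ P.tensorMul) ≫ P.tensorComul ≫ ofCotensor P.base P.base =
      ((P.tensorComul ≫ ofCotensor P.base P.base) ⊗ₘ (P.tensorComul ≫ ofCotensor P.base P.base)) ≫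
        tensorμ P.base.X P.base.X P.base.X P.base.X ≫
        ((toTensor P.base P.base ≫ P.tensorMul) ⊗ₘ (toTensor P.base P.base ≫ P.tensorMul)) := by
    rw [P.toTensor_tensorMul, P.tensorComul_ofCotensor]
    exact BimonObj.mul_comul P.X
  simp only [← tensorHom_comp_tensorHom, Category.assoc] at h4
  rw [← reassoc_of% h3, ← h2, ← reassoc_of% h1] at h4
  simpa only [Category.assoc] using h4

theorem incl_tensorComul (P : BialgProj H) :
    P.incl ≫ P.tensorComul = leftUnitInv (regular H) ≫
      tensorMap (regular H) P.base (regular H) P.base P.incl P.incl := by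
  have hX := P.isHopfBimod
  have := hX.mono_ofCotensor hX
  have h := ofCotensor_naturality P.one_isHom P.one_isHom isHopfBimod_regular.idem_idem
    hX.idem_idem
  have h1 : leftUnitInv (regular H) ≫ ofCotensor (regular H) (regular H) = Δ[H] :=
    leftUnitInv_ofCotensor
  refine (cancel_mono (ofCotensor P.base P.base)).1 ?_
  refine ((Category.assoc _ _ _).trans ((congrArg (P.incl ≫ ·) P.tensorComul_ofCotensor).trans
    (IsComonHom.hom_comul P.incl))).trans (Eq.symm ?_)
  exact (Category.assoc _ _ _).trans ((congrArg (leftUnitInv (regular H) ≫ ·) h).trans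
    ((Category.assoc _ _ _).symm.trans (congrArg (· ≫ (P.incl ⊗ₘ P.incl)) h1)))

theorem tensorMul_proj (P : BialgProj H) :
    P.tensorMul ≫ P.proj =
      tensorMap P.base (regular H) P.base (regular H) P.proj P.proj ≫ leftUnitHom (regular H) := by
  have hX := P.isHopfBimod
  have := hX.epi_toTensor hX
  have h := toTensor_naturality P.counit_isHom P.counit_isHom hX.idem_idem
    isHopfBimod_regular.idem_idem
  refine (cancel_epi (toTensor P.base P.base)).1 ?_
  refine ((Category.assoc _ _ _).symm.trans ((congrArg (· ≫ P.proj) P.toTensor_tensorMul).trans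
    (IsMonHom.mul_hom P.proj))).trans (Eq.symm ?_)
  exact (Category.assoc _ _ _).symm.trans ((congrArg (· ≫ leftUnitHom (regular H)) h).trans
    ((Category.assoc _ _ _).trans (congrArg ((P.proj ⊗ₘ P.proj) ≫ ·)
      isHopfBimod_regular.toTensor_leftUnitHom)))

theorem isBialg (P : BialgProj H) : P.toData.toHopfBimodBialgData.IsBialg where
  isHopfBimod := P.isHopfBimod
  mul_hom := P.mul_isHom
  one_hom := P.one_isHom
  comul_hom := P.comul_isHom
  counit_hom := P.counit_isHom
  one_mul := P.tensorMul_one_mul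
  mul_one := P.tensorMul_mul_one
  mul_assoc := P.tensorMul_mul_assoc
  counit_comul := P.tensorComul_counit_comul
  comul_counit := P.tensorComul_comul_counit
  comul_assoc := P.tensorComul_comul_assoc
  mul_comul := P.tensorMul_tensorComul
  one_comul := P.incl_tensorComul
  mul_counit := P.tensorMul_proj
  one_counit := P.incl_proj

/-- The bialgebra of Hopf bimodules attached to a bialgebra projection. -/
noncomputable def toHopfBimodBialg (P : BialgProj H) : HopfBimodBialg H where
  toHopfBimodBialgData := P.toData.toHopfBimodBialgData
  isBialg := P.isBialg

/-- Morphisms of bialgebra projections are morphisms of the bialgebras of Hopf bimodules. -/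
noncomputable def Hom.toHopfBimodBialg {P Q : BialgProj H} (f : Hom P Q) :
    HopfBimodBialg.Hom P.toHopfBimodBialg Q.toHopfBimodBialg where
  hom := f.hom
  isHom := f.isHom
  mul_hom := by
    have := f.isBimonHom
    have hP := P.isHopfBimod
    have hQ := Q.isHopfBimod
    have := hP.epi_toTensor hP
    change P.tensorMul ≫ f.hom = tensorMap P.base Q.base P.base Q.base f.hom f.hom ≫ Q.tensorMul
    have h := toTensor_naturality f.isHom f.isHom hP.idem_idem hQ.idem_idem
    have h1 : P.base.toTensor P.base ≫ P.tensorMul ≫ f.hom = (f.hom ⊗ₘ f.hom) ≫ μ[Q.X] :=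
      (Category.assoc _ _ _).symm.trans ((congrArg (· ≫ f.hom) P.toTensor_tensorMul).trans
        (IsMonHom.mul_hom f.hom))
    refine (cancel_epi (toTensor P.base P.base)).1 (h1.trans (Eq.symm ?_))
    exact (Category.assoc _ _ _).symm.trans ((congrArg (· ≫ Q.tensorMul) h).trans
      ((Category.assoc _ _ _).trans (congrArg ((f.hom ⊗ₘ f.hom) ≫ ·) Q.toTensor_tensorMul)))
  one_hom := f.incl_hom
  hom_comul := by
    have := f.isBimonHom
    have hP := P.isHopfBimod
    have hQ := Q.isHopfBimod
    have := hQ.mono_ofCotensor hQ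
    change f.hom ≫ Q.tensorComul = P.tensorComul ≫ tensorMap P.base Q.base P.base Q.base f.hom f.hom
    have h := ofCotensor_naturality f.isHom f.isHom hP.idem_idem hQ.idem_idem
    have h1 : (f.hom ≫ Q.tensorComul) ≫ Q.base.ofCotensor Q.base = Δ[P.X] ≫ (f.hom ⊗ₘ f.hom) :=
      (Category.assoc _ _ _).trans ((congrArg (f.hom ≫ ·) Q.tensorComul_ofCotensor).trans
        (IsComonHom.hom_comul f.hom))
    refine (cancel_mono (ofCotensor Q.base Q.base)).1 (h1.trans (Eq.symm ?_))
    exact (Category.assoc _ _ _).trans ((congrArg (P.tensorComul ≫ ·) h).trans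
      ((Category.assoc _ _ _).symm.trans
        (congrArg (· ≫ (f.hom ⊗ₘ f.hom)) P.tensorComul_ofCotensor)))
  hom_counit := f.hom_proj

/-- The functor from bialgebra projections to bialgebras of Hopf bimodules. -/
noncomputable def toHopfBimodBialgFunctor (H : C) [HopfObj H] : BialgProj H ⥤ HopfBimodBialg H where
  obj := toHopfBimodBialg
  map f := f.toHopfBimodBialg
  map_id _ := rfl
  map_comp _ _ := rfl

end
end BialgProj

/-! ### The two functors are inverse to each other -/

/-- A bialgebra over `H` is determined by its Hopf bimodule and by the structure it induces in `C`,
since `toTensor` is an epimorphism and `ofCotensor` a monomorphism. The equations are heterogeneous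
because the Hopf bimodules are only propositionally equal. -/
theorem HopfBimodBialgData.ext_of_ofCotensor {C : Type u} [Category.{v} C] [MonoidalCategory C]
    [BraidedCategory C] [IsIdempotentComplete C] {H : C} [HopfObj H]
    {A B : HopfBimodBialgData H} (hbase : A.base = B.base) (hB : B.base.IsHopfBimod)
    (hmul : HEq (A.base.toTensor A.base ≫ A.mul) (B.base.toTensor B.base ≫ B.mul))
    (hone : HEq A.one B.one)
    (hcomul : HEq (A.comul ≫ A.base.ofCotensor A.base) (B.comul ≫ B.base.ofCotensor B.base))
    (hcounit : HEq A.counit B.counit) : A = B := by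
  obtain ⟨N, m, e, d, c⟩ := A
  obtain ⟨M, m', e', d', c'⟩ := B
  obtain rfl : N = M := hbase
  have := hB.epi_toTensor hB
  have := hB.mono_ofCotensor hB
  obtain rfl : m = m' := (cancel_epi (N.toTensor N)).1 (eq_of_heq hmul)
  obtain rfl : d = d' := (cancel_mono (N.ofCotensor N)).1 (eq_of_heq hcomul)
  obtain rfl : e = e' := eq_of_heq hone
  obtain rfl : c = c' := eq_of_heq hcounit
  rfl

namespace BialgProj

theorem ext_of_toData {C : Type u} [Category.{v} C] [MonoidalCategory C] [BraidedCategory C]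
    {H : C} [BimonObj H] {P Q : BialgProj H} (h : P.toData = Q.toData) : P = Q := by
  rcases P with @⟨X, @⟨@⟨_, _, _, _, _⟩, @⟨_, _, _, _, _⟩, _, _, _, _⟩, _, _, _, _, _⟩
  rcases Q with @⟨Y, @⟨@⟨_, _, _, _, _⟩, @⟨_, _, _, _, _⟩, _, _, _, _⟩, _, _, _, _, _⟩
  dsimp only [toData] at h
  cases h
  rfl

theorem Hom.heq {C : Type u} [Category.{v} C] [MonoidalCategory C] [BraidedCategory C]
    {H : C} [BimonObj H] {P P' Q Q' : BialgProj H} (hP : P = P') (hQ : Q = Q') {f : Hom P Q}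
    {g : Hom P' Q'} (h : HEq f.hom g.hom) : HEq f g := by
  subst hP hQ
  exact heq_of_eq (Hom.ext (eq_of_heq h))

end BialgProj

namespace HopfBimodBialg

section

open HopfBimodData

variable {C : Type u} [Category.{v} C] [MonoidalCategory C]
    [BraidedCategory C] [IsIdempotentComplete C] {H : C} [HopfObj H]

theorem ext_of_toData {A B : HopfBimodBialg H}
    (h : A.toHopfBimodBialgData = B.toHopfBimodBialgData) : A = B := by
  cases A
  cases B
  subst h
  rfl

theorem Hom.heq {A A' B B' : HopfBimodBialg H} (hA : A = A') (hB : B = B') {f : Hom A B}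
    {g : Hom A' B'} (h : HEq f.hom g.hom) : HEq f g := by
  subst hA hB
  exact heq_of_eq (Hom.ext (eq_of_heq h))

/-- The Hopf bimodule rebuilt from the bialgebra projection of `B` is the original one, by the unit
and counit axioms of `B`. -/
theorem toBialgProj_base (B : HopfBimodBialg H) : B.toBialgProj.base = B.base :=
  HopfBimodData.ext rfl (heq_of_eq B.isBialg.one_toTensor_mul)
    (heq_of_eq B.isBialg.toTensor_mul_one)
    (heq_of_eq ((Category.assoc _ _ _).trans B.isBialg.comul_ofCotensor_counit))
    (heq_of_eq ((Category.assoc _ _ _).trans B.isBialg.comul_ofCotensor_counit'))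

theorem toBialgProj_toHopfBimodBialg (B : HopfBimodBialg H) :
    B.toBialgProj.toHopfBimodBialg = B :=
  ext_of_toData (HopfBimodBialgData.ext_of_ofCotensor B.toBialgProj_base B.isBialg.isHopfBimod
    (heq_of_eq B.toBialgProj.toTensor_tensorMul) HEq.rfl
    (heq_of_eq B.toBialgProj.tensorComul_ofCotensor) HEq.rfl)

end
end HopfBimodBialg

namespace BialgProj
section

variable {C : Type u} [Category.{v} C] [MonoidalCategory C]
    [BraidedCategory C] [IsIdempotentComplete C] {H : C} [HopfObj H]

theorem toHopfBimodBialg_toBialgProj (P : BialgProj H) :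
    P.toHopfBimodBialg.toBialgProj = P :=
  ext_of_toData (BialgProjData.ext rfl (heq_of_eq P.toTensor_tensorMul)
    (heq_of_eq (IsMonHom.one_hom P.incl)) (heq_of_eq P.tensorComul_ofCotensor)
    (heq_of_eq (IsComonHom.hom_counit P.proj)) HEq.rfl HEq.rfl)

theorem toHopfBimodBialgFunctor_comp_toBialgProjFunctor :
    toHopfBimodBialgFunctor H ⋙ HopfBimodBialg.toBialgProjFunctor H = 𝟭 (BialgProj H) :=
  CategoryTheory.Functor.hext toHopfBimodBialg_toBialgProj fun P Q _ =>
    Hom.heq P.toHopfBimodBialg_toBialgProj Q.toHopfBimodBialg_toBialgProj HEq.rfl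

theorem toBialgProjFunctor_comp_toHopfBimodBialgFunctor :
    HopfBimodBialg.toBialgProjFunctor H ⋙ toHopfBimodBialgFunctor H = 𝟭 (HopfBimodBialg H) :=
  CategoryTheory.Functor.hext HopfBimodBialg.toBialgProj_toHopfBimodBialg fun A B _ =>
    HopfBimodBialg.Hom.heq A.toBialgProj_toHopfBimodBialg B.toBialgProj_toHopfBimodBialg HEq.rfl

end
end BialgProj

/-! ### Convolution -/

namespace CategoryTheory.Conv
section

variable {C : Type u} [Category.{v} C]

/-- A morphism from a comonoid to a monoid, as an element of the convolution monoid. -/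
def of {A N : C} (f : A ⟶ N) : Conv A N := f

theorem of_injective {A N : C} {f g : A ⟶ N} (h : of f = of g) : f = g :=
  h

variable [MonoidalCategory C]

theorem of_mul_of {A N : C} [ComonObj A] [MonObj N] (f g : A ⟶ N) :
    of f * of g = of (Δ[A] ≫ f ▷ A ≫ N ◁ g ≫ μ[N]) :=
  rfl

theorem one_eq_of {A N : C} [ComonObj A] [MonObj N] : (1 : Conv A N) = of (ε[A] ≫ η[N]) :=
  rfl

theorem comp_convolution {A B : C} [ComonObj A] [ComonObj B] (h : A ⟶ B) [IsComonHom h] {N : C}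
    [MonObj N] (f g : B ⟶ N) :
    h ≫ Δ[B] ≫ f ▷ B ≫ N ◁ g ≫ μ[N] = Δ[A] ≫ (h ≫ f) ▷ A ≫ N ◁ (h ≫ g) ≫ μ[N] := by
  rw [IsComonHom.hom_comul_assoc, MonoidalCategory.tensorHom_def]
  simp only [Category.assoc, comp_whiskerRight, MonoidalCategory.whiskerLeft_comp,
    whisker_exchange_assoc]

theorem convolution_comp {A : C} [ComonObj A] {M N : C} [MonObj M] [MonObj N] (h : M ⟶ N)
    [IsMonHom h] (f g : A ⟶ M) :
    (Δ[A] ≫ f ▷ A ≫ M ◁ g ≫ μ[M]) ≫ h = Δ[A] ≫ (f ≫ h) ▷ A ≫ N ◁ (g ≫ h) ≫ μ[N] := by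
  simp only [Category.assoc, comp_whiskerRight, MonoidalCategory.whiskerLeft_comp]
  rw [IsMonHom.mul_hom, MonoidalCategory.tensorHom_def_assoc, whisker_exchange_assoc]

/-- Precomposition with a morphism of comonoids respects convolution. -/
def precomp {A B : C} [ComonObj A] [ComonObj B] (h : A ⟶ B) [IsComonHom h] (N : C) [MonObj N] :
    Conv B N →* Conv A N where
  toFun f := of (h ≫ (f : B ⟶ N))
  map_one' := IsComonHom.hom_counit_assoc h η[N]
  map_mul' f g := comp_convolution h (f : B ⟶ N) (g : B ⟶ N)

/-- Postcomposition with a morphism of monoids respects convolution. -/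
def postcomp (A : C) [ComonObj A] {M N : C} [MonObj M] [MonObj N] (h : M ⟶ N) [IsMonHom h] :
    Conv A M →* Conv A N where
  toFun f := of ((f : A ⟶ M) ≫ h)
  map_one' := (Category.assoc _ _ _).trans (congrArg (ε[A] ≫ ·) (IsMonHom.one_hom h))
  map_mul' f g := convolution_comp h (f : A ⟶ M) (g : A ⟶ M)

theorem precomp_of {A B : C} [ComonObj A] [ComonObj B] (h : A ⟶ B) [IsComonHom h] {N : C}
    [MonObj N] (f : B ⟶ N) : precomp h N (of f) = of (h ≫ f) :=
  rfl

theorem postcomp_of {A : C} [ComonObj A] {M N : C} [MonObj M] [MonObj N] (h : M ⟶ N)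
    [IsMonHom h] (f : A ⟶ M) : postcomp A h (of f) = of (f ≫ h) :=
  rfl

variable [BraidedCategory C]

/-- The projection of a tensor product of comonoids to its first factor. -/
def fst (A B : C) [ComonObj B] : A ⊗ B ⟶ A :=
  A ◁ ε[B] ≫ (ρ_ A).hom

/-- The projection of a tensor product of comonoids to its second factor. -/
def snd (A B : C) [ComonObj A] : A ⊗ B ⟶ B :=
  ε[A] ▷ B ≫ (λ_ B).hom

/-- The inclusion of the first factor in a tensor product of monoids. -/
def inl (A B : C) [MonObj B] : A ⟶ A ⊗ B :=
  (ρ_ A).inv ≫ A ◁ η[B]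

/-- The inclusion of the second factor in a tensor product of monoids. -/
def inr (A B : C) [MonObj A] : B ⟶ A ⊗ B :=
  (λ_ B).inv ≫ η[A] ▷ B

instance (A B : C) [ComonObj A] [ComonObj B] : IsComonHom (fst A B) where
  hom_counit := by
    simp only [fst, Comon.tensorObj_counit, MonoidalCategory.tensorHom_def']
    monoidal
  hom_comul := by
    symm
    calc
      _ = Δ[A] ▷ B ≫ (A ⊗ A) ◁ Δ[B] ⊗≫ A ◁ ((β_ A B).hom ≫ ε[B] ▷ A) ▷ B ⊗≫
            A ◁ A ◁ ε[B] ⊗≫ 𝟙 (A ⊗ A) := by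
        simp only [fst, Comon.tensorObj_comul, MonoidalCategory.tensorHom_def, tensorμ]
        monoidal
      _ = Δ[A] ▷ B ⊗≫ (A ⊗ A) ◁ (Δ[B] ≫ ε[B] ▷ B) ⊗≫ A ◁ A ◁ ε[B] ⊗≫ 𝟙 (A ⊗ A) := by
        rw [← BraidedCategory.braiding_naturality_right, braiding_tensorUnit_right]
        monoidal
      _ = (Δ[A] ▷ B ≫ (A ⊗ A) ◁ ε[B]) ⊗≫ 𝟙 (A ⊗ A) := by
        rw [ComonObj.counit_comul]
        monoidal
      _ = _ := by
        rw [← whisker_exchange, fst]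
        monoidal

instance (A B : C) [ComonObj A] [ComonObj B] : IsComonHom (snd A B) where
  hom_counit := by
    simp only [snd, Comon.tensorObj_counit, MonoidalCategory.tensorHom_def]
    monoidal
  hom_comul := by
    symm
    calc
      _ = A ◁ Δ[B] ≫ Δ[A] ▷ (B ⊗ B) ⊗≫ A ◁ ((β_ A B).hom ≫ B ◁ ε[A]) ▷ B ⊗≫
            ε[A] ▷ (B ⊗ B) ⊗≫ 𝟙 (B ⊗ B) := by
        simp only [snd, Comon.tensorObj_comul, MonoidalCategory.tensorHom_def', tensorμ]
        monoidal
      _ = A ◁ Δ[B] ≫ (Δ[A] ≫ A ◁ ε[A]) ▷ (B ⊗ B) ⊗≫ ε[A] ▷ (B ⊗ B) ⊗≫ 𝟙 (B ⊗ B) := by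
        rw [← BraidedCategory.braiding_naturality_left, braiding_tensorUnit_left]
        monoidal
      _ = (A ◁ Δ[B] ≫ ε[A] ▷ (B ⊗ B)) ⊗≫ 𝟙 (B ⊗ B) := by
        rw [ComonObj.comul_counit]
        monoidal
      _ = _ := by
        rw [whisker_exchange, snd]
        monoidal

instance (A B : C) [MonObj A] [MonObj B] : IsMonHom (inl A B) where
  one_hom := by
    simp only [inl, tensorObj.one_def, MonoidalCategory.tensorHom_def]
    monoidal
  mul_hom := by
    symm
    calc
      _ = 𝟙 (A ⊗ A) ⊗≫ A ◁ A ◁ η[B] ⊗≫ A ◁ (η[B] ▷ A ≫ (β_ B A).hom) ▷ B ⊗≫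
            μ[A] ▷ (B ⊗ B) ≫ A ◁ μ[B] := by
        rw [MonoidalCategory.tensorHom_def']
        simp only [inl, tensorObj.mul_def, MonoidalCategory.tensorHom_def, tensorμ]
        monoidal
      _ = 𝟙 (A ⊗ A) ⊗≫ A ◁ A ◁ η[B] ⊗≫ A ◁ A ◁ η[B] ▷ B ⊗≫
            (μ[A] ▷ (B ⊗ B) ≫ A ◁ μ[B]) := by
        rw [BraidedCategory.braiding_naturality_left, braiding_tensorUnit_left]
        monoidal
      _ = 𝟙 (A ⊗ A) ⊗≫ A ◁ A ◁ η[B] ⊗≫ A ◁ A ◁ (η[B] ▷ B ≫ μ[B]) ⊗≫ μ[A] ▷ B := by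
        rw [← whisker_exchange]
        monoidal
      _ = 𝟙 (A ⊗ A) ⊗≫ ((A ⊗ A) ◁ η[B] ≫ μ[A] ▷ B) := by
        rw [MonObj.one_mul]
        monoidal
      _ = _ := by
        rw [whisker_exchange, inl]
        monoidal

instance (A B : C) [MonObj A] [MonObj B] : IsMonHom (inr A B) where
  one_hom := by
    simp only [inr, tensorObj.one_def, MonoidalCategory.tensorHom_def']
    monoidal
  mul_hom := by
    symm
    calc
      _ = 𝟙 (B ⊗ B) ⊗≫ η[A] ▷ (B ⊗ B) ⊗≫ A ◁ (B ◁ η[A] ≫ (β_ B A).hom) ▷ B ⊗≫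
            μ[A] ▷ (B ⊗ B) ≫ A ◁ μ[B] := by
        simp only [inr, tensorObj.mul_def, MonoidalCategory.tensorHom_def, tensorμ]
        monoidal
      _ = 𝟙 (B ⊗ B) ⊗≫ η[A] ▷ (B ⊗ B) ⊗≫ (A ◁ η[A] ≫ μ[A]) ▷ (B ⊗ B) ⊗≫ A ◁ μ[B] := by
        rw [BraidedCategory.braiding_naturality_right, braiding_tensorUnit_right]
        monoidal
      _ = 𝟙 (B ⊗ B) ⊗≫ (η[A] ▷ (B ⊗ B) ≫ A ◁ μ[B]) := by
        rw [MonObj.mul_one]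
        monoidal
      _ = _ := by
        rw [← whisker_exchange, inr]
        monoidal

/-- On a tensor product of comonoids, the comultiplication followed by the two projections is the
identity. -/
theorem comul_fst_snd (A B : C) [ComonObj A] [ComonObj B] :
    Δ[A ⊗ B] ≫ fst A B ▷ (A ⊗ B) ≫ A ◁ snd A B = 𝟙 (A ⊗ B) := by
  calc
    _ = Δ[A] ▷ B ≫ (A ⊗ A) ◁ Δ[B] ⊗≫ A ◁ ((β_ A B).hom ≫ ε[B] ▷ A) ▷ B ⊗≫
          A ◁ ε[A] ▷ B ⊗≫ 𝟙 (A ⊗ B) := by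
      simp only [fst, snd, Comon.tensorObj_comul, MonoidalCategory.tensorHom_def, tensorμ]
      monoidal
    _ = Δ[A] ▷ B ⊗≫ (A ⊗ A) ◁ (Δ[B] ≫ ε[B] ▷ B) ⊗≫ A ◁ ε[A] ▷ B ⊗≫ 𝟙 (A ⊗ B) := by
      rw [← BraidedCategory.braiding_naturality_right, braiding_tensorUnit_right]
      monoidal
    _ = (Δ[A] ≫ A ◁ ε[A]) ▷ B ⊗≫ 𝟙 (A ⊗ B) := by
      rw [ComonObj.counit_comul]
      monoidal
    _ = _ := by
      rw [ComonObj.comul_counit]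
      monoidal

/-- On a tensor product of monoids, the product of the two inclusions is the identity. -/
theorem inl_inr_mul (A B : C) [MonObj A] [MonObj B] :
    inl A B ▷ B ≫ (A ⊗ B) ◁ inr A B ≫ μ[A ⊗ B] = 𝟙 (A ⊗ B) := by
  calc
    _ = 𝟙 (A ⊗ B) ⊗≫ A ◁ η[B] ▷ B ⊗≫ A ◁ (B ◁ η[A] ≫ (β_ B A).hom) ▷ B ⊗≫
          μ[A] ▷ (B ⊗ B) ≫ A ◁ μ[B] := by
      simp only [inl, inr, tensorObj.mul_def, MonoidalCategory.tensorHom_def, tensorμ]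
      monoidal
    _ = 𝟙 (A ⊗ B) ⊗≫ A ◁ η[B] ▷ B ⊗≫ (A ◁ η[A] ≫ μ[A]) ▷ (B ⊗ B) ⊗≫ A ◁ μ[B] := by
      rw [BraidedCategory.braiding_naturality_right, braiding_tensorUnit_right]
      monoidal
    _ = 𝟙 (A ⊗ B) ⊗≫ A ◁ (η[B] ▷ B ≫ μ[B]) := by
      rw [MonObj.mul_one]
      monoidal
    _ = _ := by
      rw [MonObj.one_mul]
      monoidal

/-- A product `f(a) g(b)` is the convolution of its two factors, as functions of `a ⊗ b`. -/
theorem fst_mul_snd {A B N : C} [ComonObj A] [ComonObj B] [MonObj N] (f : A ⟶ N) (g : B ⟶ N) :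
    precomp (fst A B) N (of f) * precomp (snd A B) N (of g) = of (f ▷ B ≫ N ◁ g ≫ μ[N]) := by
  rw [precomp_of, precomp_of, of_mul_of]
  congr 1
  rw [comp_whiskerRight, MonoidalCategory.whiskerLeft_comp, Category.assoc, Category.assoc,
    ← whisker_exchange_assoc, reassoc_of% comul_fst_snd A B]

/-- A coproduct `f(a₁) ⊗ g(a₂)` is the convolution of its two components. -/
theorem inl_mul_inr {A M N : C} [ComonObj A] [MonObj M] [MonObj N] (f : A ⟶ M) (g : A ⟶ N) :
    postcomp A (inl M N) (of f) * postcomp A (inr M N) (of g) = of (Δ[A] ≫ f ▷ A ≫ M ◁ g) := by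
  rw [postcomp_of, postcomp_of, of_mul_of]
  congr 1
  rw [comp_whiskerRight, MonoidalCategory.whiskerLeft_comp, Category.assoc, Category.assoc,
    ← whisker_exchange_assoc, inl_inr_mul M N, Category.comp_id]

end
end CategoryTheory.Conv

theorem mul_conj_left {G : Type*} [Monoid G] {x x' : G} (h : x' * x = 1) (p q r : G) :
    x * p * (q * x' * (x * r)) = x * (p * (q * r)) := by
  simp only [_root_.mul_assoc]
  rw [← _root_.mul_assoc x' x, h, _root_.one_mul]

theorem mul_conj_right {G : Type*} [Monoid G] {x x' : G} (h : x * x' = 1) (p q r : G) :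
    p * x * (x' * q * (r * x)) = p * (q * r) * x := by
  simp only [_root_.mul_assoc]
  rw [← _root_.mul_assoc x x', h, _root_.one_mul]

/-! ### Antipodes -/

namespace BialgProj
section

open HopfBimodData Conv

variable {C : Type u} [Category.{v} C] [MonoidalCategory C] [BraidedCategory C]
  {H : C} [HopfObj H]

theorem conv_id_mul_antipode : of (𝟙 H) * of (HopfObj.antipode (X := H)) = 1 := by
  rw [of_mul_of, id_whiskerRight, Category.id_comp, HopfObj.antipode_right, one_eq_of]

theorem conv_antipode_mul_id : of (HopfObj.antipode (X := H)) * of (𝟙 H) = 1 := by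
  rw [of_mul_of, MonoidalCategory.whiskerLeft_id, Category.id_comp, HopfObj.antipode_left,
    one_eq_of]

theorem conv_incl_mul_antipode (P : BialgProj H) :
    of P.incl * of (HopfObj.antipode (X := H) ≫ P.incl) = 1 := by
  have h := congrArg (postcomp H P.incl) (conv_id_mul_antipode (H := H))
  rwa [map_mul, map_one, postcomp_of, postcomp_of, Category.id_comp] at h

theorem conv_antipode_mul_incl (P : BialgProj H) :
    of (HopfObj.antipode (X := H) ≫ P.incl) * of P.incl = 1 := by
  have h := congrArg (postcomp H P.incl) (conv_antipode_mul_id (H := H))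
  rwa [map_mul, map_one, postcomp_of, postcomp_of, Category.id_comp] at h

theorem conv_proj_mul_antipode (P : BialgProj H) :
    of P.proj * of (P.proj ≫ HopfObj.antipode (X := H)) = 1 := by
  have h := congrArg (precomp P.proj H) (conv_id_mul_antipode (H := H))
  rwa [map_mul, map_one, precomp_of, precomp_of, Category.comp_id] at h

theorem conv_antipode_mul_proj (P : BialgProj H) :
    of (P.proj ≫ HopfObj.antipode (X := H)) * of P.proj = 1 := by
  have h := congrArg (precomp P.proj H) (conv_antipode_mul_id (H := H))
  rwa [map_mul, map_one, precomp_of, precomp_of, Category.comp_id] at h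

/-- The convolution inverse of the endomorphism `proj ≫ incl`. -/
def inclProjInv (P : BialgProj H) : P.X ⟶ P.X :=
  P.proj ≫ HopfObj.antipode (X := H) ≫ P.incl

theorem conv_inclProj_mul_inv (P : BialgProj H) :
    of (P.proj ≫ P.incl) * of P.inclProjInv = 1 := by
  have h := congrArg (precomp P.proj P.X) P.conv_incl_mul_antipode
  rwa [map_mul, map_one, precomp_of, precomp_of] at h

theorem conv_inv_mul_inclProj (P : BialgProj H) :
    of P.inclProjInv * of (P.proj ≫ P.incl) = 1 := by
  have h := congrArg (precomp P.proj P.X) P.conv_antipode_mul_incl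
  rwa [map_mul, map_one, precomp_of, precomp_of] at h

instance isComonHom_actL (P : BialgProj H) : IsComonHom (P.incl ▷ P.X ≫ μ[P.X]) where
  hom_counit := by
    rw [Category.assoc, Bimon.mul_counit, ← MonoidalCategory.tensorHom_id,
      tensorHom_comp_tensorHom_assoc, Category.id_comp, IsComonHom.hom_counit,
      Comon.tensorObj_counit]
  hom_comul := by
    rw [P.actL_comul, Comon.tensorObj_comul, Category.assoc]

instance isComonHom_actR (P : BialgProj H) : IsComonHom (P.X ◁ P.incl ≫ μ[P.X]) where
  hom_counit := by
    rw [Category.assoc, Bimon.mul_counit, ← MonoidalCategory.id_tensorHom,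
      tensorHom_comp_tensorHom_assoc, Category.id_comp, IsComonHom.hom_counit,
      Comon.tensorObj_counit]
  hom_comul := by
    rw [P.actR_comul, Comon.tensorObj_comul, Category.assoc]

instance isMonHom_coactL (P : BialgProj H) : IsMonHom (Δ[P.X] ≫ P.proj ▷ P.X) where
  one_hom := by
    rw [Bimon.one_comul_assoc, ← MonoidalCategory.tensorHom_id,
      tensorHom_comp_tensorHom, Category.comp_id, IsMonHom.one_hom, tensorObj.one_def]
  mul_hom := by
    rw [P.mul_coactL, tensorObj.mul_def]

instance isMonHom_coactR (P : BialgProj H) : IsMonHom (Δ[P.X] ≫ P.X ◁ P.proj) where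
  one_hom := by
    rw [Bimon.one_comul_assoc, ← MonoidalCategory.id_tensorHom,
      tensorHom_comp_tensorHom, Category.comp_id, IsMonHom.one_hom, tensorObj.one_def]
  mul_hom := by
    rw [P.mul_coactR, tensorObj.mul_def]

theorem precomp_actL_id (P : BialgProj H) :
    precomp (P.incl ▷ P.X ≫ μ[P.X]) P.X (of (𝟙 P.X)) =
      precomp (fst H P.X) P.X (of P.incl) * precomp (snd H P.X) P.X (of (𝟙 P.X)) := by
  rw [fst_mul_snd, precomp_of, MonoidalCategory.whiskerLeft_id, Category.id_comp, Category.comp_id]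

theorem precomp_actR_id (P : BialgProj H) :
    precomp (P.X ◁ P.incl ≫ μ[P.X]) P.X (of (𝟙 P.X)) =
      precomp (fst P.X H) P.X (of (𝟙 P.X)) * precomp (snd P.X H) P.X (of P.incl) := by
  rw [fst_mul_snd, precomp_of, id_whiskerRight, Category.id_comp, Category.comp_id]

theorem precomp_actL_inclProj (P : BialgProj H) :
    precomp (P.incl ▷ P.X ≫ μ[P.X]) P.X (of (P.proj ≫ P.incl)) =
      precomp (fst H P.X) P.X (of P.incl) * precomp (snd H P.X) P.X (of (P.proj ≫ P.incl)) := by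
  rw [fst_mul_snd, precomp_of]
  congr 1
  have h : (P.incl ▷ P.X ≫ μ[P.X]) ≫ P.proj = H ◁ P.proj ≫ μ[H] := P.counit_isHom.actL
  rw [← Category.assoc, h, Category.assoc, IsMonHom.mul_hom, MonoidalCategory.tensorHom_def',
    ← whisker_exchange_assoc, MonoidalCategory.whiskerLeft_comp]
  simp only [Category.assoc]

theorem precomp_actR_inclProj (P : BialgProj H) :
    precomp (P.X ◁ P.incl ≫ μ[P.X]) P.X (of (P.proj ≫ P.incl)) =
      precomp (fst P.X H) P.X (of (P.proj ≫ P.incl)) * precomp (snd P.X H) P.X (of P.incl) := by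
  rw [fst_mul_snd, precomp_of]
  congr 1
  have h : (P.X ◁ P.incl ≫ μ[P.X]) ≫ P.proj = P.proj ▷ H ≫ μ[H] := P.counit_isHom.actR
  rw [← Category.assoc, h, Category.assoc, IsMonHom.mul_hom, MonoidalCategory.tensorHom_def,
    comp_whiskerRight]
  simp only [Category.assoc]

theorem postcomp_coactL_id (P : BialgProj H) :
    postcomp P.X (Δ[P.X] ≫ P.proj ▷ P.X) (of (𝟙 P.X)) =
      postcomp P.X (inl H P.X) (of P.proj) * postcomp P.X (inr H P.X) (of (𝟙 P.X)) := by
  rw [inl_mul_inr, postcomp_of, MonoidalCategory.whiskerLeft_id, Category.id_comp,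
    Category.comp_id]

theorem postcomp_coactR_id (P : BialgProj H) :
    postcomp P.X (Δ[P.X] ≫ P.X ◁ P.proj) (of (𝟙 P.X)) =
      postcomp P.X (inl P.X H) (of (𝟙 P.X)) * postcomp P.X (inr P.X H) (of P.proj) := by
  rw [inl_mul_inr, postcomp_of, id_whiskerRight, Category.id_comp, Category.id_comp]

theorem postcomp_coactL_inclProj (P : BialgProj H) :
    postcomp P.X (Δ[P.X] ≫ P.proj ▷ P.X) (of (P.proj ≫ P.incl)) =
      postcomp P.X (inl H P.X) (of P.proj) *
        postcomp P.X (inr H P.X) (of (P.proj ≫ P.incl)) := by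
  rw [inl_mul_inr, postcomp_of]
  congr 1
  have h : Δ[H] ≫ H ◁ P.incl = P.incl ≫ Δ[P.X] ≫ P.proj ▷ P.X := P.one_isHom.coactL
  rw [Category.assoc, ← h, IsComonHom.hom_comul_assoc, MonoidalCategory.tensorHom_def,
    MonoidalCategory.whiskerLeft_comp]
  simp only [Category.assoc]

theorem postcomp_coactR_inclProj (P : BialgProj H) :
    postcomp P.X (Δ[P.X] ≫ P.X ◁ P.proj) (of (P.proj ≫ P.incl)) =
      postcomp P.X (inl P.X H) (of (P.proj ≫ P.incl)) *
        postcomp P.X (inr P.X H) (of P.proj) := by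
  rw [inl_mul_inr, postcomp_of]
  congr 1
  have h : Δ[H] ≫ P.incl ▷ H = P.incl ≫ Δ[P.X] ≫ P.X ◁ P.proj := P.one_isHom.coactR
  rw [Category.assoc, ← h, IsComonHom.hom_comul_assoc, MonoidalCategory.tensorHom_def',
    ← whisker_exchange, comp_whiskerRight]
  simp only [Category.assoc]

/-- The morphism `x ↦ π(x₁) s(x₂) π(x₃)`, with `π = proj ≫ incl`, as an iterated convolution. -/
theorem of_bimodAntipode (P : BialgProj H) (s : P.X ⟶ P.X) :
    of (P.toData.bimodAntipode s : P.X ⟶ P.X) =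
      of (P.proj ≫ P.incl) * (of s * of (P.proj ≫ P.incl)) := by
  rw [of_mul_of, of_mul_of]
  change of (((Δ[P.X] ≫ P.proj ▷ P.X) ≫ H ◁ (Δ[P.X] ≫ P.X ◁ P.proj)) ≫ H ◁ s ▷ H ≫
    H ◁ (P.X ◁ P.incl ≫ μ[P.X]) ≫ P.incl ▷ P.X ≫ μ[P.X]) = _
  congr 1
  calc
    _ = Δ[P.X] ≫ P.proj ▷ P.X ≫ (H ◁ (Δ[P.X] ≫ P.X ◁ P.proj ≫ s ▷ H ≫ P.X ◁ P.incl ≫ μ[P.X]) ≫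
          P.incl ▷ P.X) ≫ μ[P.X] := by
      monoidal
    _ = _ := by
      rw [whisker_exchange, whisker_exchange_assoc]
      monoidal

/-- The relative antipode is `x ↦ ϖ(x₁) x₂ ϖ(x₃)` with `ϖ` the convolution inverse of
`proj ≫ incl`. -/
theorem of_relAntipode_comp (P : BialgProj H) {f : P.X ⟶ P.X} (hf : IsHom P.base P.base f) :
    of (P.base.relAntipode ≫ f : P.X ⟶ P.X) =
      of P.inclProjInv * (of f * of P.inclProjInv) := by
  have hL : (P.incl ▷ P.X ≫ μ[P.X]) ≫ f = H ◁ f ≫ P.incl ▷ P.X ≫ μ[P.X] := hf.actL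
  have hR : (P.X ◁ P.incl ≫ μ[P.X]) ≫ f = f ▷ H ≫ P.X ◁ P.incl ≫ μ[P.X] := hf.actR
  rw [of_mul_of, of_mul_of]
  change of ((((Δ[P.X] ≫ P.proj ▷ P.X) ≫ H ◁ (Δ[P.X] ≫ P.X ◁ P.proj)) ≫
    (HopfObj.antipode (X := H) ⊗ₘ (P.X ◁ HopfObj.antipode (X := H))) ≫
    H ◁ (P.X ◁ P.incl ≫ μ[P.X]) ≫ P.incl ▷ P.X ≫ μ[P.X]) ≫ f) = _
  congr 1
  calc
    _ = Δ[P.X] ≫ P.proj ▷ P.X ≫ H ◁ (Δ[P.X] ≫ P.X ◁ P.proj) ≫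
          (HopfObj.antipode (X := H) ⊗ₘ (P.X ◁ HopfObj.antipode (X := H))) ≫
          H ◁ (P.X ◁ P.incl ≫ μ[P.X]) ≫ ((P.incl ▷ P.X ≫ μ[P.X]) ≫ f) := by
      simp only [Category.assoc]
    _ = Δ[P.X] ≫ P.proj ▷ P.X ≫ (H ◁ (Δ[P.X] ≫ P.X ◁ P.proj) ≫
          HopfObj.antipode (X := H) ▷ (P.X ⊗ H)) ≫ H ◁ (P.X ◁ HopfObj.antipode (X := H)) ≫
          H ◁ ((P.X ◁ P.incl ≫ μ[P.X]) ≫ f) ≫ P.incl ▷ P.X ≫ μ[P.X] := by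
      rw [hL, MonoidalCategory.tensorHom_def]
      monoidal
    _ = Δ[P.X] ≫ (P.proj ≫ HopfObj.antipode (X := H)) ▷ P.X ≫ (H ◁ (Δ[P.X] ≫
          (P.X ◁ (P.proj ≫ HopfObj.antipode (X := H)) ≫ f ▷ H) ≫ P.X ◁ P.incl ≫ μ[P.X]) ≫
          P.incl ▷ P.X) ≫ μ[P.X] := by
      rw [whisker_exchange, hR]
      monoidal
    _ = _ := by
      rw [whisker_exchange, whisker_exchange, inclProjInv]
      monoidal

/-- If `s` is an antipode of `P.X`, then `π * s * π` is a morphism of Hopf bimodules, because `s`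
reverses the factors of the actions and the coactions of `H` while `π` preserves them. -/
theorem isHom_of_conv (P : BialgProj H) {s t : P.X ⟶ P.X} (h₁ : of s * of (𝟙 P.X) = 1)
    (h₂ : of (𝟙 P.X) * of s = 1)
    (ht : of t = of (P.proj ≫ P.incl) * (of s * of (P.proj ≫ P.incl))) :
    IsHom P.base P.base t where
  actL := by
    set A := precomp (P.incl ▷ P.X ≫ μ[P.X]) P.X with hA
    set F := precomp (fst H P.X) P.X with hF
    set G := precomp (snd H P.X) P.X with hG
    -- `s(h x) = s(x) S(h)`, both sides being convolution inverse to `h ⊗ x ↦ h x`.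
    have hs : A (of s) = G (of s) * F (of (HopfObj.antipode (X := H) ≫ P.incl)) := by
      refine left_inv_eq_right_inv (a := A (of (𝟙 P.X))) ?_ ?_
      · rw [← map_mul, h₁, map_one]
      · rw [hA, P.precomp_actL_id, _root_.mul_assoc, ← _root_.mul_assoc (G _) (G _), ← map_mul G,
          h₂, map_one, _root_.one_mul, ← map_mul F, P.conv_incl_mul_antipode, map_one]
    have h : F (of (HopfObj.antipode (X := H) ≫ P.incl)) * F (of P.incl) = 1 := by
      rw [← map_mul, P.conv_antipode_mul_incl, map_one]
    have key : A (of t) = F (of P.incl) * G (of t) := by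
      rw [ht, map_mul, map_mul, hs, hA, P.precomp_actL_inclProj, mul_conj_left h, map_mul, map_mul]
    rw [hF, hG, fst_mul_snd, hA, precomp_of] at key
    change (P.incl ▷ P.X ≫ μ[P.X]) ≫ t = H ◁ t ≫ P.incl ▷ P.X ≫ μ[P.X]
    rw [of_injective key, whisker_exchange_assoc]
  actR := by
    set A := precomp (P.X ◁ P.incl ≫ μ[P.X]) P.X with hA
    set F := precomp (fst P.X H) P.X with hF
    set G := precomp (snd P.X H) P.X with hG
    -- `s(x h) = S(h) s(x)`, both sides being convolution inverse to `x ⊗ h ↦ x h`.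
    have hs : A (of s) = G (of (HopfObj.antipode (X := H) ≫ P.incl)) * F (of s) := by
      refine left_inv_eq_right_inv (a := A (of (𝟙 P.X))) ?_ ?_
      · rw [← map_mul, h₁, map_one]
      · rw [hA, P.precomp_actR_id, _root_.mul_assoc, ← _root_.mul_assoc (G _) (G _), ← map_mul G,
          P.conv_incl_mul_antipode, map_one, _root_.one_mul, ← map_mul F, h₂, map_one]
    have h : G (of P.incl) * G (of (HopfObj.antipode (X := H) ≫ P.incl)) = 1 := by
      rw [← map_mul, P.conv_incl_mul_antipode, map_one]
    have key : A (of t) = F (of t) * G (of P.incl) := by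
      rw [ht, map_mul, map_mul, hs, hA, P.precomp_actR_inclProj, mul_conj_right h, map_mul,
        map_mul]
    rw [hF, hG, fst_mul_snd, hA, precomp_of] at key
    exact of_injective key
  coactL := by
    set A := postcomp P.X (Δ[P.X] ≫ P.proj ▷ P.X) with hA
    set F := postcomp P.X (inl H P.X) with hF
    set G := postcomp P.X (inr H P.X) with hG
    -- The left coaction of `s(x)` is `S(proj x₂) ⊗ s(x₁)`, both sides being convolution inverse to
    -- the left coaction.
    have hs : A (of s) = G (of s) * F (of (P.proj ≫ HopfObj.antipode (X := H))) := by
      refine left_inv_eq_right_inv (a := A (of (𝟙 P.X))) ?_ ?_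
      · rw [← map_mul, h₁, map_one]
      · rw [hA, P.postcomp_coactL_id, _root_.mul_assoc, ← _root_.mul_assoc (G _) (G _),
          ← map_mul G, h₂, map_one, _root_.one_mul, ← map_mul F, P.conv_proj_mul_antipode, map_one]
    have h : F (of (P.proj ≫ HopfObj.antipode (X := H))) * F (of P.proj) = 1 := by
      rw [← map_mul, P.conv_antipode_mul_proj, map_one]
    have key : A (of t) = F (of P.proj) * G (of t) := by
      rw [ht, map_mul, map_mul, hs, hA, P.postcomp_coactL_inclProj, mul_conj_left h, map_mul,
        map_mul]
    rw [hF, hG, inl_mul_inr, hA, postcomp_of] at key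
    exact (Category.assoc _ _ _).trans (of_injective key).symm
  coactR := by
    set A := postcomp P.X (Δ[P.X] ≫ P.X ◁ P.proj) with hA
    set F := postcomp P.X (inl P.X H) with hF
    set G := postcomp P.X (inr P.X H) with hG
    -- The right coaction of `s(x)` is `s(x₂) ⊗ S(proj x₁)`, both sides being convolution inverse to
    -- the right coaction.
    have hs : A (of s) = G (of (P.proj ≫ HopfObj.antipode (X := H))) * F (of s) := by
      refine left_inv_eq_right_inv (a := A (of (𝟙 P.X))) ?_ ?_
      · rw [← map_mul, h₁, map_one]
      · rw [hA, P.postcomp_coactR_id, _root_.mul_assoc, ← _root_.mul_assoc (G _) (G _),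
          ← map_mul G, P.conv_proj_mul_antipode, map_one, _root_.one_mul, ← map_mul F, h₂, map_one]
    have h : G (of P.proj) * G (of (P.proj ≫ HopfObj.antipode (X := H))) = 1 := by
      rw [← map_mul, P.conv_proj_mul_antipode, map_one]
    have key : A (of t) = F (of t) * G (of P.proj) := by
      rw [ht, map_mul, map_mul, hs, hA, P.postcomp_coactR_inclProj, mul_conj_right h, map_mul,
        map_mul]
    rw [hF, hG, inl_mul_inr, hA, postcomp_of] at key
    change (Δ[P.X] ≫ P.X ◁ P.proj) ≫ t ▷ H = t ≫ Δ[P.X] ≫ P.X ◁ P.proj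
    rw [of_injective key, Category.assoc, whisker_exchange]

/-- An antipode is a two-sided convolution inverse of the identity. -/
theorem isAntipode_iff_conv (P : BialgProj H) {s : P.X ⟶ P.X} :
    P.toData.IsAntipode s ↔ of s * of (𝟙 P.X) = 1 ∧ of (𝟙 P.X) * of s = 1 := by
  rw [of_mul_of, of_mul_of, MonoidalCategory.whiskerLeft_id, Category.id_comp, id_whiskerRight,
    Category.id_comp]
  exact ⟨fun h => ⟨h.left, h.right⟩, fun h => ⟨h.1, h.2⟩⟩

/-- The idempotent onto the invariants is the convolution `ϖ * 𝟙`. -/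
theorem of_idem_comp (P : BialgProj H) {g : P.X ⟶ P.X} (hg : IsHom P.base P.base g) :
    of (P.base.idem ≫ g : P.X ⟶ P.X) = of P.inclProjInv * of g := by
  have hL : (P.incl ▷ P.X ≫ μ[P.X]) ≫ g = H ◁ g ≫ P.incl ▷ P.X ≫ μ[P.X] := hg.actL
  rw [of_mul_of]
  change of (((Δ[P.X] ≫ P.proj ▷ P.X) ≫ HopfObj.antipode (X := H) ▷ P.X ≫
    P.incl ▷ P.X ≫ μ[P.X]) ≫ g) = _
  congr 1
  simp only [Category.assoc] at hL ⊢
  rw [hL, inclProjInv, comp_whiskerRight, comp_whiskerRight]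
  simp only [Category.assoc, whisker_exchange_assoc]

variable [IsIdempotentComplete C]

/-- The convolution product of `f` and `g` in the category of Hopf bimodules is `f * ϖ * g`. -/
theorem of_tensorComul_tensorMap_tensorMul (P : BialgProj H) {f g : P.X ⟶ P.X}
    (hg : IsHom P.base P.base g) :
    of (P.tensorComul ≫ tensorMap P.base P.base P.base P.base f g ≫ P.tensorMul : P.X ⟶ P.X) =
      of f * (of P.inclProjInv * of g) := by
  have h : P.invPr ≫ (P.invInj ≫ g ≫ P.invPr) ≫ P.invInj = P.base.idem ≫ g := by
    have hp : P.invPr ≫ P.invInj = P.base.idem := P.isHopfBimod.pr_inj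
    obtain ⟨e, he⟩ : ∃ e : P.X ⟶ P.X, e = P.base.idem := ⟨_, rfl⟩
    have hi : e ≫ g = g ≫ e := he ▸ hg.idem
    have hii : e ≫ e = e := he ▸ P.isHopfBimod.idem_idem
    rw [← he] at hp ⊢
    simp only [Category.assoc, hp]
    rw [reassoc_of% hp, ← hi, reassoc_of% hii]
    rfl
  refine Eq.trans (b := of f * of (P.invPr ≫ (P.invInj ≫ g ≫ P.invPr) ≫ P.invInj)) ?_
    (congrArg (of f * ·) ((congrArg of h).trans (P.of_idem_comp hg)))
  rw [of_mul_of]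
  change of ((Δ[P.X] ≫ P.X ◁ P.invPr) ≫ (f ⊗ₘ (P.invInj ≫ g ≫ P.invPr)) ≫ P.X ◁ P.invInj ≫
    μ[P.X]) = _
  congr 1
  calc
    _ = Δ[P.X] ≫ (P.X ◁ P.invPr ≫ f ▷ P.base.invObj) ≫ P.X ◁ (P.invInj ≫ g ≫ P.invPr) ≫
          P.X ◁ P.invInj ≫ μ[P.X] := by
      rw [MonoidalCategory.tensorHom_def]
      simp only [Category.assoc]
    _ = _ := by
      rw [whisker_exchange]
      simp only [MonoidalCategory.whiskerLeft_comp, Category.assoc]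

/-- Antipodes over `H` in terms of convolution: `t * ϖ * 𝟙 = π = 𝟙 * ϖ * t`, with `π = proj ≫ incl`
the unit of the convolution over `H` and `ϖ` its convolution inverse. -/
theorem isAntipode_iff (P : BialgProj H) {t : P.X ⟶ P.X} (ht : IsHom P.base P.base t) :
    P.toData.toHopfBimodBialgData.IsAntipode t ↔
      of t * (of P.inclProjInv * of (𝟙 P.X)) = of (P.proj ≫ P.incl) ∧
        of (𝟙 P.X) * (of P.inclProjInv * of t) = of (P.proj ≫ P.incl) := by
  have e₁ := P.of_tensorComul_tensorMap_tensorMul (f := t) (IsHom.id P.base)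
  have e₂ := P.of_tensorComul_tensorMap_tensorMul (f := 𝟙 P.X) ht
  exact ⟨fun h => ⟨e₁.symm.trans (congrArg of h.left), e₂.symm.trans (congrArg of h.right)⟩,
    fun h => ⟨ht, of_injective (e₁.trans h.1), of_injective (e₂.trans h.2)⟩⟩

/-- `(π * s * π) * ϖ * 𝟙 = π * (s * 𝟙) = π`, and symmetrically. -/
theorem isAntipode_bimodAntipode (P : BialgProj H) {s : P.X ⟶ P.X} (h : P.toData.IsAntipode s) :
    P.toData.toHopfBimodBialgData.IsAntipode (P.toData.bimodAntipode s) := by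
  obtain ⟨h₁, h₂⟩ := P.isAntipode_iff_conv.1 h
  obtain ⟨t, ht⟩ : ∃ t : P.X ⟶ P.X, t = P.toData.bimodAntipode s := ⟨_, rfl⟩
  have ht' : of t = of (P.proj ≫ P.incl) * (of s * of (P.proj ≫ P.incl)) := by
    rw [ht]
    exact P.of_bimodAntipode s
  have h₃ := P.conv_inclProj_mul_inv
  rw [← ht]
  refine (P.isAntipode_iff (P.isHom_of_conv h₁ h₂ ht')).2 ⟨?_, ?_⟩
  · rw [ht', _root_.mul_assoc, _root_.mul_assoc, ← _root_.mul_assoc (of (P.proj ≫ P.incl))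
      (of P.inclProjInv), h₃, _root_.one_mul, h₁, _root_.mul_one]
  · rw [ht', ← _root_.mul_assoc (of P.inclProjInv), P.conv_inv_mul_inclProj, _root_.one_mul,
      ← _root_.mul_assoc, h₂, _root_.one_mul]

/-- `(ϖ * t * ϖ) * 𝟙 = ϖ * π = 1`, and symmetrically. -/
theorem isAntipode_relAntipode_comp (P : BialgProj H) {t : P.X ⟶ P.X}
    (h : P.toData.toHopfBimodBialgData.IsAntipode t) :
    P.toData.IsAntipode (P.base.relAntipode ≫ t) := by
  obtain ⟨h₁, h₂⟩ := (P.isAntipode_iff h.hom).1 h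
  obtain ⟨r, hr⟩ : ∃ r : P.X ⟶ P.X, r = P.base.relAntipode ≫ t := ⟨_, rfl⟩
  have ht : of r = of P.inclProjInv * (of t * of P.inclProjInv) :=
    (congrArg of hr).trans (P.of_relAntipode_comp h.hom)
  suffices hs : P.toData.IsAntipode r from hr ▸ hs
  refine P.isAntipode_iff_conv.2 ⟨?_, ?_⟩
  · rw [ht, _root_.mul_assoc, _root_.mul_assoc, h₁, P.conv_inv_mul_inclProj]
  · rw [ht, ← _root_.mul_assoc (of P.inclProjInv), ← _root_.mul_assoc, h₂, P.conv_inclProj_mul_inv]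

end
end BialgProj

namespace HopfBimodData

/-- The relative antipode is natural for morphisms of Hopf bimodules. -/
theorem IsHom.relAntipode_comp {C : Type u} [Category.{v} C] [MonoidalCategory C]
    [BraidedCategory C] {H : C} [HopfObj H] {M N : HopfBimodData H} {f : M.X ⟶ N.X}
    (hf : IsHom M N f) : M.relAntipode ≫ f = f ≫ N.relAntipode := by
  have h₁ : M.biact ≫ f = H ◁ f ▷ H ≫ N.biact := by
    simp only [biact, Category.assoc, hf.actL, ← MonoidalCategory.whiskerLeft_comp_assoc, hf.actR]
  have h₂ : M.bicoact ≫ H ◁ f ▷ H = f ≫ N.bicoact := by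
    simp only [bicoact, Category.assoc, ← MonoidalCategory.whiskerLeft_comp, hf.coactR]
    simp only [MonoidalCategory.whiskerLeft_comp, reassoc_of% hf.coactL]
  have h₃ : (HopfObj.antipode (X := H) ⊗ₘ (M.X ◁ HopfObj.antipode (X := H))) ≫ H ◁ f ▷ H =
      H ◁ f ▷ H ≫ (HopfObj.antipode (X := H) ⊗ₘ (N.X ◁ HopfObj.antipode (X := H))) := by
    rw [MonoidalCategory.tensorHom_def, MonoidalCategory.tensorHom_def, Category.assoc,
      ← MonoidalCategory.whiskerLeft_comp, whisker_exchange, MonoidalCategory.whiskerLeft_comp,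
      whisker_exchange_assoc]
  simp only [relAntipode, Category.assoc, h₁, reassoc_of% h₃, reassoc_of% h₂]

end HopfBimodData

/-- The statement for bialgebra projections transfers along `toBialgProj_toHopfBimodBialg`. -/
theorem HopfBimodBialg.isAntipode_relAntipode_comp {C : Type u} [Category.{v} C]
    [MonoidalCategory C] [BraidedCategory C] [IsIdempotentComplete C] {H : C} [HopfObj H]
    (B : HopfBimodBialg H) {t : B.base.X ⟶ B.base.X} (h : B.IsAntipode t) :
    B.toBialgProjData.IsAntipode (B.base.relAntipode ≫ t) := by
  obtain ⟨P, rfl⟩ : ∃ P : BialgProj H, P.toHopfBimodBialg = B :=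
    ⟨B.toBialgProj, B.toBialgProj_toHopfBimodBialg⟩
  have hs := P.isAntipode_relAntipode_comp h
  have e₁ := IsComonHom.hom_counit P.proj
  have e₂ := IsMonHom.one_hom P.incl
  exact
    ⟨(congrArg₂ (fun (d : P.X ⟶ P.X ⊗ P.X) (m : P.X ⊗ P.X ⟶ P.X) =>
        d ≫ (P.base.relAntipode ≫ t) ▷ P.X ≫ m) P.tensorComul_ofCotensor
        P.toTensor_tensorMul).trans (hs.left.trans (congrArg₂ (· ≫ ·) e₁.symm e₂.symm)),
      (congrArg₂ (fun (d : P.X ⟶ P.X ⊗ P.X) (m : P.X ⊗ P.X ⟶ P.X) =>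
        d ≫ P.X ◁ (P.base.relAntipode ≫ t) ≫ m) P.tensorComul_ofCotensor
        P.toTensor_tensorMul).trans (hs.right.trans (congrArg₂ (· ≫ ·) e₁.symm e₂.symm))⟩

theorem mainTheorem2 {C : Type u} [Category.{v} C] [MonoidalCategory C] [BraidedCategory C]
    [IsIdempotentComplete C] (H : C) [HopfObj H] [IsIso (HopfObj.antipode (X := H))] :
    (∃ (F : BialgProj H ⥤ HopfBimodBialg H) (G : HopfBimodBialg H ⥤ BialgProj H),
      (∀ P : BialgProj H,
        (F.obj P).toHopfBimodBialgData = P.toData.toHopfBimodBialgData) ∧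
      (∀ B : HopfBimodBialg H,
        (G.obj B).toData = B.toHopfBimodBialgData.toBialgProjData) ∧
      (∀ (P P' : BialgProj H) (f : P ⟶ P'), HEq (F.map f).hom f.hom) ∧
      (∀ (B B' : HopfBimodBialg H) (g : B ⟶ B'), HEq (G.map g).hom g.hom) ∧
      F ⋙ G = 𝟭 (BialgProj H) ∧ G ⋙ F = 𝟭 (HopfBimodBialg H)) ∧
    (∀ (P : BialgProj H) (s : P.X ⟶ P.X), P.toData.IsAntipode s →
      P.toData.toHopfBimodBialgData.IsAntipode (P.toData.bimodAntipode s)) ∧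
    (∀ (B : HopfBimodBialg H) (t : B.base.X ⟶ B.base.X), B.IsAntipode t →
      B.toBialgProjData.IsAntipode (B.base.relAntipode ≫ t) ∧
      B.base.relAntipode ≫ t = t ≫ B.base.relAntipode) := by
  refine ⟨⟨BialgProj.toHopfBimodBialgFunctor H, HopfBimodBialg.toBialgProjFunctor H, fun _ => rfl,
    fun _ => rfl, fun _ _ _ => HEq.rfl, fun _ _ _ => HEq.rfl,
    BialgProj.toHopfBimodBialgFunctor_comp_toBialgProjFunctor,
    BialgProj.toBialgProjFunctor_comp_toHopfBimodBialgFunctor⟩,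
    fun P s hs => P.isAntipode_bimodAntipode hs, fun B t ht =>
      ⟨B.isAntipode_relAntipode_comp ht, ht.hom.relAntipode_comp⟩⟩
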